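/- Let $\tau\in\mathbb R$, $0<\varphi<\pi$, and $$\mathcal L f(s)=i(\tfrac12-is)\,f(s+i)+2(s-\tau)\cos\varphi\, f(s)-i(\tfrac12+is-2i\tau)\,f(s-i).$$ Consider the operator $\mathcal L\oplus\mathcal L:(f_1,f_2)\mapsto(\mathcal Lf_1,\mathcal Lf_2)$ in the Hilbert space $L^2(\mathbb R,ds)\oplus L^2(\mathbb R,e^{2\pi s}ds)$. A function is called holomorphic in the closed strip $|\operatorname{Im}s|\le1$ (outside a given set) if it is holomorphic in some larger strip $|\operatorname{Im}s|<1+\delta$, $\delta>0$ (outside this set). Consider the decay conditions: for some $\varepsilon>0$, in the strip $|\operatorname{Im}s|\le1$, $$f_1(s)=O(|\operatorname{Re}s|^{-3/2-\varepsilon}),\qquad e^{\pi s}f_2(s)=O(|\operatorname{Re}s|^{-3/2-\varepsilon}),\qquad |\operatorname{Re}s|\to\infty.\tag{1}$$ Let $\mathcal H$ be the space of pairs $(f_1,f_2)$ holomorphic in the closed strip $|\operatorname{Im}s|\le1$ and satisfying (1). For $\sigma\in\mathbb R$ let $\mathcal H_\sigma$ be the space of pairs $(f_1,f_2)$ that satisfy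 (1), are holomorphic in the closed strip $|\operatorname{Im}s|\le1$ outside the points $i/2$ and $-i/2+2\tau$, have at most simple poles at these two points, and satisfy $$\operatorname*{res}_{s=i/2}f_1(s)=\operatorname*{res}_{s=i/2}f_2(s),\qquad \operatorname*{res}_{s=-i/2+2\tau}f_1(s)=-e^{2\pi(\tau+i\sigma)}\operatorname*{res}_{s=-i/2+2\tau}f_2(s).$$ Elements of $\mathcal H$ and $\mathcal H_\sigma$ are identified with elements of the Hilbert space by restriction to the real line. Then: (a) the operator $\mathcal L\oplus\mathcal L$ with domain $\mathcal H$ is densely defined and symmetric, and its defect indices are $(2,2)$; (b) for every $\sigma\in\mathbb R$, the operator $\mathcal L\oplus\mathcal L$ is essentially self-adjoint on the domain $\mathcal H_\sigma$. -/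

import Mathlib

open MeasureTheory Filter Topology Asymptotics
open scoped ENNReal LinearPMap

namespace DiffSL

noncomputable section

/-! ### The Hilbert space `L²(ℝ, ds) ⊕ L²(ℝ, e^{2πs} ds)` -/

/-- The measure `e^{2πs} ds` on the real line. -/
def expMeasure : Measure ℝ :=
  volume.withDensity fun s => ENNReal.ofReal (Real.exp (2 * Real.pi * s))

/-- The Hilbert direct sum `L²(ℝ, ds) ⊕ L²(ℝ, e^{2πs} ds)` of complex `L²` spaces. -/
abbrev L2Sum : Type :=
  WithLp 2 (Lp ℂ 2 (volume : Measure ℝ) × Lp ℂ 2 expMeasure)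

/-! ### Defect indices and essential self-adjointness of unbounded operators -/

section Abstract

variable {E : Type*} [NormedAddCommGroup E] [InnerProductSpace ℂ E] [CompleteSpace E]

/-- The eigenspace `ker (T† - z)` of the adjoint of an unbounded operator. -/
def defectSpace (T : E →ₗ.[ℂ] E) (z : ℂ) : Submodule ℂ E :=
  (LinearMap.ker (T†.toFun - z • T†.domain.subtype)).map T†.domain.subtype

/-- `T` is a densely defined symmetric operator and its defect indices
`(dim ker (T† - i), dim ker (T† + i))` are `(m, n)`. -/
def HasDefectIndices (T : E →ₗ.[ℂ] E) (m n : ℕ) : Prop :=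
  Dense (T.domain : Set E) ∧ T.IsFormalAdjoint T ∧
    Module.rank ℂ (defectSpace T Complex.I) = m ∧
    Module.rank ℂ (defectSpace T (-Complex.I)) = n

/-- `T` is essentially self-adjoint: it is densely defined and closable, and its closure
is self-adjoint. -/
def IsEssentiallySelfAdjoint (T : E →ₗ.[ℂ] E) : Prop :=
  Dense (T.domain : Set E) ∧ T.IsClosable ∧ IsSelfAdjoint T.closure

end Abstract

/-! ### Function spaces -/

/-- `f` is holomorphic in the closed strip `|Im s| ≤ 1` outside `P`, that is, it is holomorphic
in a larger open strip `|Im s| < 1 + δ` outside `P`. -/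
def HolomorphicOff (P : Set ℂ) (f : ℂ → ℂ) : Prop :=
  ∃ δ : ℝ, 0 < δ ∧ DifferentiableOn ℂ f ({s : ℂ | |s.im| < 1 + δ} \ P)

/-- The filter `|Re s| → ∞` in the closed strip `|Im s| ≤ 1`. -/
def stripInfty : Filter ℂ :=
  comap (fun s : ℂ => |s.re|) atTop ⊓ 𝓟 {s : ℂ | |s.im| ≤ 1}

/-- `f(s) = O(|Re s|^{-3/2-ε})` for some `ε > 0` as `|Re s| → ∞`, in the strip `|Im s| ≤ 1`. -/
def Decays (f : ℂ → ℂ) : Prop :=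
  ∃ ε : ℝ, 0 < ε ∧ f =O[stripInfty] fun s => |s.re| ^ (-(3 / 2) - ε : ℝ)

/-- Near `a`, the function `f` is holomorphic except for at most a simple pole at `a`, with
residue `r` there (for `r = 0` the singularity is removable). -/
def HasSimplePoleResidue (f : ℂ → ℂ) (a r : ℂ) : Prop :=
  ∃ g : ℂ → ℂ, AnalyticAt ℂ g a ∧ ∀ᶠ s in 𝓝[≠] a, f s = r / (s - a) + g s

/-- The two admissible poles `i/2` and `-i/2 + 2τ`. -/
def poles (τ : ℝ) : Set ℂ := {Complex.I / 2, -Complex.I / 2 + 2 * τ}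

theorem HolomorphicOff.mono {P Q : Set ℂ} (h : P ⊆ Q) {f : ℂ → ℂ} (hf : HolomorphicOff P f) :
    HolomorphicOff Q f := by
  obtain ⟨δ, hδ, hd⟩ := hf
  exact ⟨δ, hδ, hd.mono (Set.sdiff_subset_sdiff_right h)⟩

theorem HolomorphicOff.zero (P : Set ℂ) : HolomorphicOff P 0 :=
  ⟨1, one_pos, differentiableOn_const 0⟩

theorem HolomorphicOff.add {P : Set ℂ} {f g : ℂ → ℂ} (hf : HolomorphicOff P f)
    (hg : HolomorphicOff P g) : HolomorphicOff P (f + g) := by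
  obtain ⟨δ, hδ, hd⟩ := hf
  obtain ⟨δ', hδ', hd'⟩ := hg
  refine ⟨min δ δ', lt_min hδ hδ', (hd.mono ?_).add (hd'.mono ?_)⟩
  · rintro s ⟨hs, hP⟩
    exact ⟨lt_of_lt_of_le (Set.mem_ofPred_eq ▸ hs) (by gcongr; exact min_le_left _ _), hP⟩
  · rintro s ⟨hs, hP⟩
    exact ⟨lt_of_lt_of_le (Set.mem_ofPred_eq ▸ hs) (by gcongr; exact min_le_right _ _), hP⟩

theorem HolomorphicOff.smul {P : Set ℂ} {f : ℂ → ℂ} (c : ℂ) (hf : HolomorphicOff P f) :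
    HolomorphicOff P (c • f) := by
  obtain ⟨δ, hδ, hd⟩ := hf
  exact ⟨δ, hδ, hd.const_smul c⟩

theorem Decays.zero : Decays 0 := ⟨1, one_pos, isBigO_zero _ _⟩

theorem decay_mono {ε ε' : ℝ} (h : ε ≤ ε') :
    (fun s : ℂ => |s.re| ^ (-(3 / 2) - ε' : ℝ)) =O[stripInfty]
      fun s => |s.re| ^ (-(3 / 2) - ε : ℝ) := by
  refine IsBigO.of_bound 1 ?_
  have h1 : ∀ᶠ s : ℂ in stripInfty, (1 : ℝ) ≤ |s.re| :=
    Filter.Eventually.filter_mono inf_le_left ((eventually_ge_atTop (1 : ℝ)).comap _)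
  filter_upwards [h1] with s hs
  rw [one_mul, Real.norm_of_nonneg (by positivity), Real.norm_of_nonneg (by positivity)]
  exact Real.rpow_le_rpow_of_exponent_le hs (by linarith)

theorem Decays.add {f g : ℂ → ℂ} (hf : Decays f) (hg : Decays g) : Decays (f + g) := by
  obtain ⟨ε, hε, h⟩ := hf
  obtain ⟨ε', hε', h'⟩ := hg
  exact ⟨min ε ε', lt_min hε hε', (h.trans (decay_mono (min_le_left _ _))).add
    (h'.trans (decay_mono (min_le_right _ _)))⟩

theorem Decays.smul {f : ℂ → ℂ} (c : ℂ) (hf : Decays f) : Decays (c • f) := by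
  obtain ⟨ε, hε, h⟩ := hf
  exact ⟨ε, hε, h.const_smul_left c⟩

theorem HasSimplePoleResidue.zero (a : ℂ) : HasSimplePoleResidue 0 a 0 :=
  ⟨0, analyticAt_const, by simp⟩

theorem HasSimplePoleResidue.add {f g : ℂ → ℂ} {a r r' : ℂ} (hf : HasSimplePoleResidue f a r)
    (hg : HasSimplePoleResidue g a r') : HasSimplePoleResidue (f + g) a (r + r') := by
  obtain ⟨u, hu, h⟩ := hf
  obtain ⟨v, hv, h'⟩ := hg
  refine ⟨u + v, hu.add hv, ?_⟩
  filter_upwards [h, h'] with s hs hs'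
  simp only [Pi.add_apply, hs, hs']
  ring

theorem HasSimplePoleResidue.smul {f : ℂ → ℂ} {a r : ℂ} (c : ℂ)
    (hf : HasSimplePoleResidue f a r) : HasSimplePoleResidue (c • f) a (c * r) := by
  obtain ⟨u, hu, h⟩ := hf
  refine ⟨c • u, hu.const_smul, ?_⟩
  filter_upwards [h] with s hs
  simp only [Pi.smul_apply, hs, smul_eq_mul]
  ring

/-- Pairs `(f₁, f₂)` holomorphic in the closed strip `|Im s| ≤ 1` outside `P` such that
`f₁(s)` and `e^{πs} f₂(s)` are `O(|Re s|^{-3/2-ε})` in the strip. -/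
def pairsOff (P : Set ℂ) : Submodule ℂ ((ℂ → ℂ) × (ℂ → ℂ)) where
  carrier := {f | HolomorphicOff P f.1 ∧ HolomorphicOff P f.2 ∧ Decays f.1 ∧
    Decays fun s => Complex.exp (Real.pi * s) * f.2 s}
  zero_mem' := by
    refine ⟨.zero P, .zero P, .zero, ?_⟩
    convert Decays.zero using 1
    funext s
    simp
  add_mem' := by
    rintro f g ⟨h1, h2, h3, h4⟩ ⟨k1, k2, k3, k4⟩
    refine ⟨h1.add k1, h2.add k2, h3.add k3, ?_⟩
    convert h4.add k4 using 1
    funext s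
    simp [mul_add]
  smul_mem' := by
    rintro c f ⟨h1, h2, h3, h4⟩
    refine ⟨h1.smul c, h2.smul c, h3.smul c, ?_⟩
    convert h4.smul c using 1
    funext s
    simp [mul_left_comm]

/-- The space `𝓗` of pairs holomorphic in the closed strip with the prescribed decay. -/
def domH : Submodule ℂ ((ℂ → ℂ) × (ℂ → ℂ)) := pairsOff ∅

/-- The space `𝓗_σ` of pairs holomorphic in the closed strip except for at most simple poles at
`i/2` and `-i/2 + 2τ`, with the prescribed decay, such that
`res_{i/2} f₁ = res_{i/2} f₂` and
`res_{-i/2+2τ} f₁ = -e^{2π(τ+iσ)} res_{-i/2+2τ} f₂`. -/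
def domHσ (τ σ : ℝ) : Submodule ℂ ((ℂ → ℂ) × (ℂ → ℂ)) where
  carrier := {f | f ∈ pairsOff (poles τ) ∧
    (∃ r₁ r₂ : ℂ, HasSimplePoleResidue f.1 (Complex.I / 2) r₁ ∧
      HasSimplePoleResidue f.2 (Complex.I / 2) r₂ ∧ r₁ = r₂) ∧
    (∃ r₁ r₂ : ℂ, HasSimplePoleResidue f.1 (-Complex.I / 2 + 2 * τ) r₁ ∧
      HasSimplePoleResidue f.2 (-Complex.I / 2 + 2 * τ) r₂ ∧
      r₁ = -Complex.exp (2 * Real.pi * (τ + Complex.I * σ)) * r₂)}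
  zero_mem' := ⟨zero_mem _, ⟨0, 0, .zero _, .zero _, rfl⟩, ⟨0, 0, .zero _, .zero _, by simp⟩⟩
  add_mem' := by
    rintro f g ⟨h, ⟨r₁, r₂, h1, h2, h3⟩, ⟨q₁, q₂, h4, h5, h6⟩⟩
      ⟨k, ⟨s₁, s₂, k1, k2, k3⟩, ⟨t₁, t₂, k4, k5, k6⟩⟩
    exact ⟨add_mem h k, ⟨_, _, h1.add k1, h2.add k2, by rw [h3, k3]⟩,
      ⟨_, _, h4.add k4, h5.add k5, by rw [h6, k6]; ring⟩⟩
  smul_mem' := by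
    rintro c f ⟨h, ⟨r₁, r₂, h1, h2, h3⟩, ⟨q₁, q₂, h4, h5, h6⟩⟩
    exact ⟨Submodule.smul_mem _ c h, ⟨_, _, h1.smul c, h2.smul c, by rw [h3]⟩,
      ⟨_, _, h4.smul c, h5.smul c, by rw [h6]; ring⟩⟩

theorem domH_le (τ : ℝ) : domH ≤ pairsOff (poles τ) := fun _ h =>
  ⟨h.1.mono (Set.empty_subset _), h.2.1.mono (Set.empty_subset _), h.2.2.1, h.2.2.2⟩

theorem domHσ_le (τ σ : ℝ) : domHσ τ σ ≤ pairsOff (poles τ) := fun _ h => h.1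

/-! ### The difference operator -/

/-- The difference expression
`𝓛 f(s) = i(1/2 - is) f(s+i) + 2(s-τ) cos φ f(s) - i(1/2 + is - 2iτ) f(s-i)`. -/
def diffOp (φ τ : ℝ) : (ℂ → ℂ) →ₗ[ℂ] (ℂ → ℂ) where
  toFun f s :=
    Complex.I * (1 / 2 - Complex.I * s) * f (s + Complex.I)
      + 2 * (s - τ) * Real.cos φ * f s
      - Complex.I * (1 / 2 + Complex.I * s - 2 * Complex.I * τ) * f (s - Complex.I)
  map_add' f g := by
    funext s
    simp only [Pi.add_apply]
    ring
  map_smul' c f := by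
    funext s
    simp only [Pi.smul_apply, smul_eq_mul, RingHom.id_apply]
    ring

/-- Restriction to the real line. -/
def restrict (f : ℂ → ℂ) : ℝ → ℂ := fun x => f x

theorem memLp_of_decay {g : ℝ → ℂ} (hg : Continuous g) {ε : ℝ} (hε : 0 < ε)
    (h : g =O[cocompact ℝ] fun x => |x| ^ (-(1 / 2) - ε : ℝ)) : MemLp g 2 volume := by
  rw [memLp_two_iff_integrable_sq_norm hg.aestronglyMeasurable]
  have hint : Integrable (fun x : ℝ => (1 + ‖x‖) ^ (-(1 + 2 * ε))) volume :=
    integrable_one_add_norm (by simpa using hε)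
  refine LocallyIntegrable.integrable_of_isBigO_cocompact
    (hg.norm.pow 2).locallyIntegrable ?_ (hint.integrableAtFilter _)
  have h1 : ∀ᶠ x : ℝ in cocompact ℝ, (1 : ℝ) ≤ |x| :=
    (tendsto_norm_cocompact_atTop (E := ℝ)).eventually_ge_atTop 1
  refine (h.norm_left.pow 2).trans (IsBigO.of_bound (2 ^ (1 + 2 * ε)) ?_)
  filter_upwards [h1] with x hx
  have hx0 : 0 < |x| := by linarith
  rw [Real.norm_of_nonneg (by positivity), Real.norm_of_nonneg (by positivity),
    ← Real.rpow_natCast, ← Real.rpow_mul hx0.le, Real.norm_eq_abs]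
  have e : (-(1 / 2) - ε) * ((2 : ℕ) : ℝ) = -(1 + 2 * ε) := by push_cast; ring
  rw [e, Real.rpow_neg hx0.le, Real.rpow_neg (by positivity), ← div_eq_mul_inv,
    inv_eq_one_div, div_le_div_iff₀ (by positivity) (by positivity), one_mul,
    ← Real.mul_rpow (by norm_num) hx0.le]
  exact Real.rpow_le_rpow (by positivity) (by linarith) (by linarith)

theorem memLp_expMeasure {g : ℝ → ℂ} (hg : Continuous g)
    (h : MemLp (fun x : ℝ => Complex.exp (Real.pi * x) * g x) 2 volume) :
    MemLp g 2 expMeasure := by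
  rw [memLp_two_iff_integrable_sq_norm h.1] at h
  rw [memLp_two_iff_integrable_sq_norm hg.aestronglyMeasurable, expMeasure,
    integrable_withDensity_iff_integrable_smul' (by fun_prop) (by simp)]
  refine h.congr (Eventually.of_forall fun x => ?_)
  have : ‖Complex.exp (Real.pi * x)‖ = Real.exp (Real.pi * x) := by
    rw [Complex.norm_exp]; simp
  simp only [norm_mul, this]
  rw [ENNReal.toReal_ofReal (Real.exp_pos _).le, mul_pow, ← Real.exp_nat_mul, smul_eq_mul]
  push_cast
  ring_nf

theorem notMem_poles {τ : ℝ} {s : ℂ} (h : s.im = 0 ∨ s.im = 1 ∨ s.im = -1) : s ∉ poles τ := by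
  rintro (rfl | rfl) <;> norm_num [Complex.div_im] at h

theorem continuous_shift {τ : ℝ} {f : ℂ → ℂ} (hf : HolomorphicOff (poles τ) f) {z : ℂ}
    (h : z.im = 0 ∨ z.im = 1 ∨ z.im = -1) : Continuous fun x : ℝ => f (x + z) := by
  obtain ⟨δ, hδ, hd⟩ := hf
  refine hd.continuousOn.comp_continuous (by fun_prop) fun x => ⟨?_, notMem_poles (by simpa using h)⟩
  rcases h with h | h | h <;> simp [h] <;> linarith

theorem decay_shift {h : ℂ → ℂ} {ε : ℝ}
    (hh : h =O[stripInfty] fun s => |s.re| ^ (-(3 / 2) - ε : ℝ)) {z : ℂ} (hz : z.re = 0)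
    (hz' : |z.im| ≤ 1) :
    (fun x : ℝ => h (x + z)) =O[cocompact ℝ] fun x => |x| ^ (-(3 / 2) - ε : ℝ) := by
  have ht : Tendsto (fun x : ℝ => (x : ℂ) + z) (cocompact ℝ) stripInfty := by
    refine tendsto_inf.2 ⟨tendsto_comap_iff.2 ?_, tendsto_principal.2 ?_⟩
    · convert tendsto_norm_cocompact_atTop (E := ℝ) using 1
      funext x
      simp [hz]
    · exact Eventually.of_forall fun x => by simpa using hz'
  have := hh.comp_tendsto ht
  simpa [Function.comp_def, hz] using this

theorem continuous_restrict {τ : ℝ} {f : ℂ → ℂ} (hf : HolomorphicOff (poles τ) f) :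
    Continuous (restrict f) := by
  simpa [restrict, Function.comp_def] using! continuous_shift hf (z := 0) (by simp)

theorem continuous_diffOp {φ τ : ℝ} {f : ℂ → ℂ} (hf : HolomorphicOff (poles τ) f) :
    Continuous (restrict (diffOp φ τ f)) := by
  have h0 := continuous_restrict hf
  have h1 := continuous_shift hf (z := Complex.I) (by simp)
  have h2 := continuous_shift hf (z := -Complex.I) (by simp)
  change Continuous fun x : ℝ => Complex.I * (1 / 2 - Complex.I * x) * f (x + Complex.I)
      + 2 * (x - τ) * Real.cos φ * restrict f x
      - Complex.I * (1 / 2 + Complex.I * x - 2 * Complex.I * τ) * f (x + -Complex.I)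
  exact ((Continuous.mul (by fun_prop) h1).add (Continuous.mul (by fun_prop) h0)).sub
    (Continuous.mul (by fun_prop) h2)

theorem affine_isBigO (a b : ℂ) :
    (fun x : ℝ => a * x + b) =O[cocompact ℝ] fun x => |x| := by
  refine IsBigO.of_bound (‖a‖ + ‖b‖) ?_
  have h1 : ∀ᶠ x : ℝ in cocompact ℝ, (1 : ℝ) ≤ |x| :=
    (tendsto_norm_cocompact_atTop (E := ℝ)).eventually_ge_atTop 1
  filter_upwards [h1] with x hx
  refine (norm_add_le _ _).trans ?_
  rw [norm_mul, Complex.norm_real, Real.norm_eq_abs, Real.norm_eq_abs, abs_abs, add_mul]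
  gcongr
  exact le_mul_of_one_le_right (norm_nonneg _) hx

theorem affine_mul_isBigO {g : ℝ → ℂ} {ε : ℝ}
    (hg : g =O[cocompact ℝ] fun x => |x| ^ (-(3 / 2) - ε : ℝ)) (a b : ℂ) :
    (fun x : ℝ => (a * x + b) * g x) =O[cocompact ℝ] fun x => |x| ^ (-(1 / 2) - ε : ℝ) := by
  refine ((affine_isBigO a b).mul hg).congr' EventuallyEq.rfl ?_
  have h1 : ∀ᶠ x : ℝ in cocompact ℝ, (1 : ℝ) ≤ |x| :=
    (tendsto_norm_cocompact_atTop (E := ℝ)).eventually_ge_atTop 1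
  filter_upwards [h1] with x hx
  have hx0 : 0 < |x| := by linarith
  have e : (-(1 / 2) - ε : ℝ) = 1 + (-(3 / 2) - ε) := by ring
  rw [e, Real.rpow_add hx0, Real.rpow_one]

theorem memLp_weighted {φ τ : ℝ} {f : ℂ → ℂ} (κ : ℝ) (hf : HolomorphicOff (poles τ) f)
    (hd : Decays fun s => Complex.exp (κ * s) * f s) :
    MemLp (fun x : ℝ => Complex.exp (κ * x) * restrict f x) 2 volume ∧
      MemLp (fun x : ℝ => Complex.exp (κ * x) * restrict (diffOp φ τ f) x) 2 volume := by
  obtain ⟨ε, hε, h⟩ := hd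
  have k0 := decay_shift h (z := 0) (by simp) (by simp)
  have k1 := decay_shift h (z := Complex.I) (by simp) (by simp)
  have k2 := decay_shift h (z := -Complex.I) (by simp) (by simp)
  have hexp : Continuous fun x : ℝ => Complex.exp (κ * x) := by fun_prop
  refine ⟨memLp_of_decay (hexp.mul (continuous_restrict hf)) hε ?_,
    memLp_of_decay (hexp.mul (continuous_diffOp hf)) hε ?_⟩
  · refine (affine_mul_isBigO k0 0 1).congr_left fun x => ?_
    simp [restrict]
  · refine (((affine_mul_isBigO k1 (Complex.exp (-κ * Complex.I))
      (Complex.exp (-κ * Complex.I) * (Complex.I / 2))).add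
      (affine_mul_isBigO k0 (2 * Real.cos φ) (-2 * τ * Real.cos φ))).add
      (affine_mul_isBigO k2 (Complex.exp (κ * Complex.I))
        (-Complex.exp (κ * Complex.I) * (Complex.I / 2 + 2 * τ)))).congr_left fun x => ?_
    have e1 : Complex.exp (κ * (x + Complex.I))
        = Complex.exp (κ * x) * Complex.exp (κ * Complex.I) := by
      rw [← Complex.exp_add]; ring_nf
    have e2 : Complex.exp (κ * (x + -Complex.I))
        = Complex.exp (κ * x) * Complex.exp (-κ * Complex.I) := by
      rw [← Complex.exp_add]; ring_nf
    have e3 : Complex.exp (-κ * Complex.I) * Complex.exp (κ * Complex.I) = 1 := by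
      rw [← Complex.exp_add]; simp
    simp only [restrict, diffOp, LinearMap.coe_mk, AddHom.coe_mk, e1, e2, add_zero, sub_eq_add_neg]
    have I2 := Complex.I_mul_I
    generalize Complex.exp (-κ * Complex.I) = p at *
    generalize Complex.exp (κ * Complex.I) = q at *
    generalize Complex.exp (κ * x) = u at *
    generalize f (x + Complex.I) = f1
    generalize f (x + -Complex.I) = f2
    linear_combination (x + Complex.I / 2) * u * f1 * e3 + (x - Complex.I / 2 - 2 * τ) * u * f2 * e3
      + (u * f1 * x + u * f2 * (x - 2 * τ)) * I2

theorem eq_zero_of_restrict {φ τ : ℝ} {f : ℂ → ℂ} (hf : HolomorphicOff (poles τ) f)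
    (h0 : restrict f = 0) : restrict (diffOp φ τ f) =ᵐ[volume] 0 := by
  have hae : ∀ᵐ x : ℝ, x ≠ 0 ∧ x ≠ 2 * τ := by
    filter_upwards [Measure.ae_ne volume (0 : ℝ), Measure.ae_ne volume (2 * τ)] with x h1 h2
    exact ⟨h1, h2⟩
  filter_upwards [hae] with x ⟨hx, hx'⟩
  obtain ⟨δ, hδ, hd⟩ := hf
  set U : Set ℂ := {s | |s.im| < 1 + δ ∧ |s.re - x| < min |x| |x - 2 * τ|} with hU
  have hsub : U ⊆ {s : ℂ | |s.im| < 1 + δ} \ poles τ := by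
    rintro s ⟨h1, h2⟩
    refine ⟨h1, ?_⟩
    rintro (rfl | rfl)
    · have := lt_of_lt_of_le h2 (min_le_left _ _)
      simp at this
    · have := lt_of_lt_of_le h2 (min_le_right _ _)
      simp [abs_sub_comm] at this
  have hopen : IsOpen U := by
    refine IsOpen.and ?_ ?_
    · exact isOpen_lt (by fun_prop) (by fun_prop)
    · exact isOpen_lt (by fun_prop) (by fun_prop)
  have hconv : Convex ℝ U := by
    have : U = Complex.imLm ⁻¹' (Metric.ball 0 (1 + δ)) ∩
        Complex.reLm ⁻¹' (Metric.ball x (min |x| |x - 2 * τ|)) := by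
      ext s
      simp [hU, Real.dist_eq]
    rw [this]
    exact ((convex_ball _ _).linear_preimage _).inter ((convex_ball _ _).linear_preimage _)
  have hr : 0 < min |x| |x - 2 * τ| := lt_min (abs_pos.2 hx) (abs_pos.2 (sub_ne_zero.2 hx'))
  have hxU : (x : ℂ) ∈ U := ⟨by simp; linarith, by simpa using hr⟩
  have hz : Set.EqOn f 0 U := by
    refine ((hd.mono hsub).analyticOnNhd hopen).eqOn_zero_of_preconnected_of_frequently_eq_zero
      hconv.isPreconnected hxU ?_
    have ht : Tendsto (fun y : ℝ => (y : ℂ)) (𝓝[≠] x) (𝓝[≠] (x : ℂ)) := by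
      refine tendsto_nhdsWithin_of_tendsto_nhds_of_eventually_within _
        ((Complex.continuous_ofReal.tendsto x).mono_left nhdsWithin_le_nhds) ?_
      filter_upwards [self_mem_nhdsWithin] with y hy
      simpa using hy
    exact ht.frequently (Eventually.frequently (Eventually.of_forall fun y => congrFun h0 y))
  have h1 : f (x + Complex.I) = 0 := hz ⟨by simpa using hδ, by simpa using hr⟩
  have h2 : f (x - Complex.I) = 0 := hz ⟨by simpa using hδ, by simpa using hr⟩
  have h3 : f x = 0 := hz hxU
  simp [restrict, diffOp, h1, h2, h3]

theorem ae_expMeasure {p : ℝ → Prop} : (∀ᵐ x ∂expMeasure, p x) ↔ ∀ᵐ x : ℝ, p x := by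
  constructor
  · intro h
    exact (withDensity_absolutelyContinuous' (by fun_prop)
      (Eventually.of_forall fun x => by simp [Real.exp_pos])).ae_le h
  · intro h
    exact (withDensity_absolutelyContinuous _ _).ae_le h

theorem memLp_pair {φ τ : ℝ} {f : (ℂ → ℂ) × (ℂ → ℂ)} (hf : f ∈ pairsOff (poles τ)) :
    (MemLp (restrict f.1) 2 volume ∧ MemLp (restrict f.2) 2 expMeasure) ∧
      MemLp (restrict (diffOp φ τ f.1)) 2 volume ∧
        MemLp (restrict (diffOp φ τ f.2)) 2 expMeasure := by
  obtain ⟨h1, h2, h3, h4⟩ := hf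
  have a := memLp_weighted (φ := φ) 0 h1 (by simpa using h3)
  have b := memLp_weighted (φ := φ) Real.pi h2 h4
  simp only [Complex.ofReal_zero, zero_mul, Complex.exp_zero, one_mul] at a
  exact ⟨⟨a.1, memLp_expMeasure (continuous_restrict h2) b.1⟩, a.2,
    memLp_expMeasure (continuous_diffOp h2) b.2⟩

theorem toLp_eq_zero {μ : Measure ℝ} {g : ℝ → ℂ} (hg : MemLp g 2 μ) :
    hg.toLp g = 0 ↔ g =ᵐ[μ] 0 := by
  rw [Lp.eq_zero_iff_ae_eq_zero]
  exact ⟨fun h => hg.coeFn_toLp.symm.trans h, fun h => hg.coeFn_toLp.trans h⟩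

/-- The element of `L²(ℝ, ds) ⊕ L²(ℝ, e^{2πs} ds)` given by the restrictions of `f₁`, `f₂` to
the real line. -/
def toL2 (τ : ℝ) : pairsOff (poles τ) →ₗ[ℂ] L2Sum where
  toFun f := WithLp.toLp 2 ((memLp_pair (φ := 0) f.2).1.1.toLp _,
    (memLp_pair (φ := 0) f.2).1.2.toLp _)
  map_add' _ _ := rfl
  map_smul' _ _ := rfl

/-- The element of `L²(ℝ, ds) ⊕ L²(ℝ, e^{2πs} ds)` given by the restrictions of `𝓛 f₁`, `𝓛 f₂`
to the real line. -/
def diffToL2 (φ τ : ℝ) : pairsOff (poles τ) →ₗ[ℂ] L2Sum where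
  toFun f := WithLp.toLp 2 ((memLp_pair (φ := φ) f.2).2.1.toLp _,
    (memLp_pair (φ := φ) f.2).2.2.toLp _)
  map_add' f g := by
    simp only [Submodule.coe_add, Prod.fst_add, Prod.snd_add, map_add]
    rfl
  map_smul' c f := by
    simp only [Submodule.coe_smul, Prod.smul_fst, Prod.smul_snd, map_smul]
    rfl

/-- The graph of `𝓛 ⊕ 𝓛` on a domain `D ≤ pairsOff (poles τ)`. -/
def diffGraph (φ τ : ℝ) (D : Submodule ℂ ((ℂ → ℂ) × (ℂ → ℂ))) : Submodule ℂ (L2Sum × L2Sum) :=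
  (D.comap (pairsOff (poles τ)).subtype).map ((toL2 τ).prod (diffToL2 φ τ))

/-- The operator `𝓛 ⊕ 𝓛` in `L²(ℝ, ds) ⊕ L²(ℝ, e^{2πs} ds)` whose domain consists of the (classes
of) restrictions to the real line of the pairs `f ∈ D`, where `D ≤ pairsOff (poles τ)`; it maps
`f` to `(𝓛 f₁, 𝓛 f₂)`. It is well defined by uniqueness of analytic continuation. -/
def diffSum (φ τ : ℝ) (D : Submodule ℂ ((ℂ → ℂ) × (ℂ → ℂ))) : L2Sum →ₗ.[ℂ] L2Sum :=
  (diffGraph φ τ D).toLinearPMap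

/-- The graph is single-valued. -/
theorem diffGraph_singleValued (φ τ : ℝ) (D : Submodule ℂ ((ℂ → ℂ) × (ℂ → ℂ))) :
    ∀ x ∈ diffGraph φ τ D, x.1 = 0 → x.2 = 0 := by
  rintro _ ⟨f, -, rfl⟩ hx
  have hx1 : (memLp_pair (φ := 0) f.2).1.1.toLp _ = 0 := congrArg (fun y : L2Sum => y.fst) hx
  have hx2 : (memLp_pair (φ := 0) f.2).1.2.toLp _ = 0 := congrArg (fun y : L2Sum => y.snd) hx
  rw [toLp_eq_zero] at hx1 hx2
  have z1 : restrict f.1.1 = 0 :=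
    (Continuous.ae_eq_iff_eq volume (continuous_restrict f.2.1) continuous_const).1 hx1
  have z2 : restrict f.1.2 = 0 :=
    (Continuous.ae_eq_iff_eq volume (continuous_restrict f.2.2.1) continuous_const).1
      (ae_expMeasure.1 hx2)
  have y1 := (toLp_eq_zero (memLp_pair (φ := φ) f.2).2.1).2
    (eq_zero_of_restrict f.2.1 z1)
  have y2 := (toLp_eq_zero (memLp_pair (φ := φ) f.2).2.2).2
    (ae_expMeasure.2 (eq_zero_of_restrict f.2.2.1 z2))
  change WithLp.toLp 2 (_, _) = (0 : L2Sum)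
  rw [y1, y2]
  rfl

/-- The operator `𝓛 ⊕ 𝓛` on the domain `D` has the expected graph. -/
theorem mem_graph_diffSum {φ τ : ℝ} {D : Submodule ℂ ((ℂ → ℂ) × (ℂ → ℂ))}
    (hD : D ≤ pairsOff (poles τ)) {F G : L2Sum} : (F, G) ∈ (diffSum φ τ D).graph ↔
      ∃ f ∈ D, (F.fst =ᵐ[volume] restrict f.1 ∧ F.snd =ᵐ[expMeasure] restrict f.2) ∧
        G.fst =ᵐ[volume] restrict (diffOp φ τ f.1) ∧
          G.snd =ᵐ[expMeasure] restrict (diffOp φ τ f.2) := by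
  rw [diffSum, Submodule.toLinearPMap_graph_eq _ (diffGraph_singleValued φ τ D)]
  constructor
  · rintro ⟨f, hf, h⟩
    obtain ⟨rfl, rfl⟩ := Prod.mk.inj h
    have hm := memLp_pair (φ := φ) f.2
    exact ⟨f.1, hf, ⟨hm.1.1.coeFn_toLp, hm.1.2.coeFn_toLp⟩, hm.2.1.coeFn_toLp,
      hm.2.2.coeFn_toLp⟩
  · rintro ⟨f, hf, ⟨h1, h2⟩, h3, h4⟩
    have hm := hD hf
    refine ⟨⟨f, hm⟩, hf, Prod.ext ?_ ?_⟩
    · refine WithLp.ofLp_injective 2 (Prod.ext ?_ ?_)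
      · exact Lp.ext ((MemLp.coeFn_toLp (memLp_pair (φ := 0) hm).1.1).trans h1.symm)
      · exact Lp.ext ((MemLp.coeFn_toLp (memLp_pair (φ := 0) hm).1.2).trans h2.symm)
    · refine WithLp.ofLp_injective 2 (Prod.ext ?_ ?_)
      · exact Lp.ext ((MemLp.coeFn_toLp (memLp_pair (φ := φ) hm).2.1).trans h3.symm)
      · exact Lp.ext ((MemLp.coeFn_toLp (memLp_pair (φ := φ) hm).2.2).trans h4.symm)

end

end DiffSL

open scoped ComplexConjugate InnerProductSpace FourierTransform SchwartzMap ContDiff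

namespace DiffSL

/-! ### Defect spaces and self-adjoint extensions, in terms of graphs -/

section UnboundedOperators

variable {E : Type*} [NormedAddCommGroup E] [InnerProductSpace ℂ E]

/-! The Fourier transform turns the difference operator into a first-order differential operator,
which can be solved explicitly. Write `f(s) = ∫ F(t) e^{2πist} dt`. Multiplication by `s` becomes
`(i/2π) d/dt`, and the shifts `s ± i` become multiplication by `e^{∓2πt}`. The second component is
replaced by `e^{πs} f₂`, which removes the weight from the Hilbert space and only changes the sign
`ε` of the shift terms. On the Fourier side the leading coefficient is, up to a constant factor, `ε
w` with `w = e^{2πt} + e^{-2πt} + 2ε cos φ`, and `w > 0` because `0 < φ < π`.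

Symmetry comes from shifting contours. In `⟨𝓛f, g⟩ - ⟨f, 𝓛g⟩` the integrals over `ℝ` and `ℝ + i`
differ only by residues. The coefficients of `𝓛` vanish exactly where the poles of the two factors
meet, so each double pole becomes simple and contributes the product of the two residues
(`contour_pairing`, `inner_diffToL2_sub`). The boundary form therefore lives on the residues at
`i/2` and `-i/2 + 2τ`; it vanishes on `𝓗`, and the residue conditions make it vanish on `𝓗_σ`.

For the defect vectors on `𝓗_σ`, pairs of transforms of test functions show that each Fourier
component of a defect vector is a weak solution of a first-order equation. It is thus one constant
times an explicit function (`eq_of_weak_solution`), leaving two constants `c₁`, `c₂`. Transforms of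
functions cut off at one end of the line have a single pole, and the two such pairs belonging to
`𝓗_σ` impose one linear relation between `c₁` and `c₂` at each end of the line
(`integral_edge_pairing`). At spectral parameter `±i` these relations fix the ratio of moduli `|c₁|
: |c₂|` at each end. The two ratios differ, since the primitive of `ε/w` increases for `ε = 1` and
decreases for `ε = -1`. Hence `c₁ = c₂ = 0` (`defectSpace_domHσ_eq_bot`), which gives (b).

For (a), `𝓗_σ` exceeds `𝓗` by the two one-pole pairs, and these remain independent modulo the
closure of the graph on `𝓗` because the boundary form detects their residues
(`eq_zero_of_mem_closure`). A symmetric operator that acquires trivial defect spaces after a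
two-dimensional symmetric extension of this kind has defect indices `(2,2)`
(`rank_defectSpace_eq_two`). -/

theorem norm_sq_sub_smul_of_symmetric {x y : E} (h : ⟪y, x⟫_ℂ = ⟪x, y⟫_ℂ) {w : ℂ}
    (hw : conj w = -w) (hw' : ‖w‖ = 1) : ‖y - w • x‖ ^ 2 = ‖y‖ ^ 2 + ‖x‖ ^ 2 := by
  have hre : (⟪y, w • x⟫_ℂ).re = 0 := by
    have hc : conj ⟪y, x⟫_ℂ = ⟪y, x⟫_ℂ := by rw [inner_conj_symm, h]
    have him : (⟪y, x⟫_ℂ).im = 0 := Complex.conj_eq_iff_im.1 hc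
    have hwr : w.re = 0 := by
      have := congrArg Complex.re hw
      simp at this
      linarith
    simp [him, hwr]
  rw [@norm_sub_sq ℂ]
  simp [hre, norm_smul, hw']

theorem symmetric_topologicalClosure {g : Submodule ℂ (E × E)}
    (hg : ∀ p ∈ g, ∀ q ∈ g, ⟪p.2, q.1⟫_ℂ = ⟪p.1, q.2⟫_ℂ) :
    ∀ p ∈ g.topologicalClosure, ∀ q ∈ g.topologicalClosure, ⟪p.2, q.1⟫_ℂ = ⟪p.1, q.2⟫_ℂ := by
  have h1 : ∀ p ∈ g.topologicalClosure, ∀ q ∈ g, ⟪p.2, q.1⟫_ℂ = ⟪p.1, q.2⟫_ℂ := by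
    intro p hp q hq
    have hc : IsClosed {p : E × E | ⟪p.2, q.1⟫_ℂ = ⟪p.1, q.2⟫_ℂ} :=
      isClosed_eq (by fun_prop) (by fun_prop)
    exact closure_minimal (fun p hp => hg p hp q hq) hc hp
  intro p hp q hq
  have hc : IsClosed {q : E × E | ⟪p.2, q.1⟫_ℂ = ⟪p.1, q.2⟫_ℂ} :=
    isClosed_eq (by fun_prop) (by fun_prop)
  exact closure_minimal (fun q hq => h1 p hp q hq) hc hq

variable [CompleteSpace E]

/-- The kernel of `T† - z` is the orthogonal complement of the range of `T - conj z`. Phrasing this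
over the graph avoids any description of the domain of the adjoint. -/
theorem mem_defectSpace_iff {T : E →ₗ.[ℂ] E} (hT : Dense (T.domain : Set E)) {z : ℂ} {y : E} :
    y ∈ defectSpace T z ↔ ∀ p ∈ T.graph, ⟪p.2 - conj z • p.1, y⟫_ℂ = 0 := by
  have key : y ∈ defectSpace T z ↔ (y, z • y) ∈ T†.graph := by
    rw [LinearPMap.mem_graph_iff]
    constructor
    · rintro ⟨x, hx, rfl⟩
      refine ⟨x, rfl, ?_⟩
      have := LinearMap.mem_ker.1 hx
      exact sub_eq_zero.1 this
    · rintro ⟨x, rfl, hx⟩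
      exact ⟨x, LinearMap.mem_ker.2 (sub_eq_zero.2 hx), rfl⟩
  rw [key, LinearPMap.adjoint_graph_eq_graph_adjoint hT, Submodule.mem_adjoint_iff]
  simp only [inner_sub_left, inner_smul_left, inner_smul_right, Complex.conj_conj, Prod.forall]

theorem isClosable_of_isFormalAdjoint {T : E →ₗ.[ℂ] E} (hT : Dense (T.domain : Set E))
    (hs : T.IsFormalAdjoint T) : T.IsClosable :=
  (LinearPMap.adjoint_isClosed hT).isClosable.leIsClosable (hs.le_adjoint hT)

/-- For a symmetric complete graph `g`, the range of `T - w`, `w = ±i`, is closed. -/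
theorem isClosed_map_sub_smul {g : Submodule ℂ (E × E)} (hc : IsClosed (g : Set (E × E)))
    (hg : ∀ p ∈ g, ∀ q ∈ g, ⟪p.2, q.1⟫_ℂ = ⟪p.1, q.2⟫_ℂ) {w : ℂ}
    (hw : conj w = -w) (hw' : ‖w‖ = 1) :
    IsClosed (g.map (LinearMap.snd ℂ E E - w • LinearMap.fst ℂ E E) : Set E) := by
  let f : g →L[ℂ] E := (ContinuousLinearMap.snd ℂ E E - w • ContinuousLinearMap.fst ℂ E E).comp
    g.subtypeL
  have hcomp : CompleteSpace g := hc.completeSpace_coe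
  have hf : AntilipschitzWith 1 f := by
    refine f.antilipschitz_of_bound fun p => ?_
    have h2 : ‖(p : E × E).2 - w • (p : E × E).1‖ ^ 2
        = ‖(p : E × E).2‖ ^ 2 + ‖(p : E × E).1‖ ^ 2 :=
      norm_sq_sub_smul_of_symmetric (hg p p.2 p p.2) hw hw'
    have h3 : ‖f p‖ = ‖(p : E × E).2 - w • (p : E × E).1‖ := rfl
    have h4 : ‖p‖ = max ‖(p : E × E).1‖ ‖(p : E × E).2‖ := rfl
    simp only [NNReal.coe_one, one_mul]
    change ‖p‖ ≤ ‖f p‖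
    rw [h4, h3]
    apply max_le <;> refine le_of_sq_le_sq ?_ (norm_nonneg _) <;> rw [h2] <;>
      nlinarith [sq_nonneg ‖(p : E × E).1‖, sq_nonneg ‖(p : E × E).2‖]
  have := hf.isClosed_range f.uniformContinuous
  convert this using 1
  ext y
  simp [f, Set.range]

/-- Von Neumann's criterion. The range of the closure minus `i` is closed, and its complement is the
defect space at `-i`, so it is everything. An element `(y, u)` of the adjoint graph can then be
matched with some `(a, b)` in the closure having the same image, and `y - a` is a defect vector at
`i`, hence zero. -/
theorem isEssentiallySelfAdjoint_of_defectSpace_eq_bot {T : E →ₗ.[ℂ] E}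
    (hT : Dense (T.domain : Set E)) (hs : T.IsFormalAdjoint T)
    (h1 : defectSpace T Complex.I = ⊥) (h2 : defectSpace T (-Complex.I) = ⊥) :
    IsEssentiallySelfAdjoint T := by
  have hcl := isClosable_of_isFormalAdjoint hT hs
  refine ⟨hT, hcl, ?_⟩
  have hgs : ∀ p ∈ T.graph, ∀ q ∈ T.graph, ⟪p.2, q.1⟫_ℂ = ⟪p.1, q.2⟫_ℂ := by
    intro p hp q hq
    obtain ⟨x, hx, hx'⟩ := (LinearPMap.mem_graph_iff _).1 hp
    obtain ⟨y, hy, hy'⟩ := (LinearPMap.mem_graph_iff _).1 hq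
    rw [← hx, ← hx', ← hy, ← hy']
    exact hs x y
  have hgs' := symmetric_topologicalClosure hgs
  have hgc : T.closure.graph = T.graph.topologicalClosure := hcl.graph_closure_eq_closure_graph.symm
  have hd : Dense (T.closure.domain : Set E) := hT.mono (T.le_closure.1)
  rw [LinearPMap.isSelfAdjoint_def]
  apply LinearPMap.eq_of_eq_graph
  rw [LinearPMap.adjoint_graph_eq_graph_adjoint hd, hgc]
  apply le_antisymm
  · rintro ⟨y, u⟩ hy
    rw [Submodule.mem_adjoint_iff] at hy
    let w : ℂ := Complex.I
    set R := T.graph.topologicalClosure.map (LinearMap.snd ℂ E E - w • LinearMap.fst ℂ E E) with hR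
    have hRc : IsClosed (R : Set E) :=
      isClosed_map_sub_smul T.graph.isClosed_topologicalClosure hgs' (by simp [w]) (by simp [w])
    have hRtop : R = ⊤ := by
      have : R.topologicalClosure = ⊤ := by
        rw [Submodule.topologicalClosure_eq_top_iff, Submodule.eq_bot_iff]
        intro v hv
        have : v ∈ defectSpace T (-Complex.I) := by
          rw [mem_defectSpace_iff hT]
          intro p hp
          refine (Submodule.mem_orthogonal _ _).1 hv _ ⟨p, T.graph.le_topologicalClosure hp, ?_⟩
          simp [w]
        rwa [h2, Submodule.mem_bot] at this
      rwa [hRc.submodule_topologicalClosure_eq] at this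
    obtain ⟨⟨a, b⟩, hab, hab'⟩ : u - w • y ∈ R := hRtop ▸ Submodule.mem_top
    simp only [LinearMap.sub_apply, LinearMap.smul_apply, LinearMap.fst_apply,
      LinearMap.snd_apply] at hab'
    have hya : y - a ∈ defectSpace T Complex.I := by
      rw [mem_defectSpace_iff hT]
      intro p hp
      have e1 := hy p.1 p.2 (T.graph.le_topologicalClosure hp)
      have e2 := hgs' p (T.graph.le_topologicalClosure hp) _ hab
      have e3 : ⟪p.1, u⟫_ℂ - w * ⟪p.1, y⟫_ℂ = ⟪p.1, b⟫_ℂ - w * ⟪p.1, a⟫_ℂ := by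
        rw [← inner_smul_right, ← inner_smul_right, ← inner_sub_right, ← inner_sub_right, hab']
      simp only [inner_sub_left, inner_sub_right, inner_smul_left, Complex.conj_conj]
      simp only at e1 e2
      linear_combination e1 - e2 + e3
    rw [h1, Submodule.mem_bot, sub_eq_zero] at hya
    subst hya
    have : u = b := by
      have := hab'
      simpa using this.symm
    exact this ▸ hab
  · intro q hq
    rw [Submodule.mem_adjoint_iff]
    intro a b hab
    exact sub_eq_zero.2 (hgs' _ hab _ hq)

/-- If a symmetric operator `S` without defect vectors is a two-dimensional extension of `T`, and
the extension is nontrivial modulo the closure of `T`, then the defect numbers of `T` are `2`. -/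
theorem rank_defectSpace_eq_two {T S : E →ₗ.[ℂ] E} (hT : Dense (T.domain : Set E))
    (hS : Dense (S.domain : Set E)) (hTS : T.graph ≤ S.graph)
    (hs : ∀ p ∈ S.graph, ∀ q ∈ S.graph, ⟪p.2, q.1⟫_ℂ = ⟪p.1, q.2⟫_ℂ)
    {x₁ x₂ : E × E} (h₁ : x₁ ∈ S.graph) (h₂ : x₂ ∈ S.graph)
    (hspan : ∀ p ∈ S.graph, ∃ a b : ℂ, p - (a • x₁ + b • x₂) ∈ T.graph)
    (hindep : ∀ a b : ℂ, a • x₁ + b • x₂ ∈ T.graph.topologicalClosure → a = 0 ∧ b = 0)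
    {z : ℂ} (hz : conj z = -z) (hz' : ‖z‖ = 1) (hbot : defectSpace S z = ⊥) :
    Module.rank ℂ (defectSpace T z) = 2 := by
  let ℓ : E × E →ₗ[ℂ] E := LinearMap.snd ℂ E E - conj z • LinearMap.fst ℂ E E
  have hℓ : ∀ p, ℓ p = p.2 - conj z • p.1 := fun _ => rfl
  let Λ : defectSpace T z →ₗ[ℂ] ℂ × ℂ :=
    ((innerₛₗ ℂ (ℓ x₁)).prod (innerₛₗ ℂ (ℓ x₂))).comp (defectSpace T z).subtype
  have hΛ : ∀ g, Λ g = (⟪ℓ x₁, (g : E)⟫_ℂ, ⟪ℓ x₂, (g : E)⟫_ℂ) := fun _ => rfl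
  have hinj : Function.Injective Λ := by
    rw [← LinearMap.ker_eq_bot, Submodule.eq_bot_iff]
    intro g hg
    have hg' := LinearMap.mem_ker.1 hg
    rw [hΛ, Prod.mk_eq_zero] at hg'
    have : (g : E) ∈ defectSpace S z := by
      rw [mem_defectSpace_iff hS]
      intro p hp
      obtain ⟨a, b, hab⟩ := hspan p hp
      have e := (mem_defectSpace_iff hT).1 g.2 _ hab
      rw [← hℓ, map_sub, map_add, map_smul, map_smul, inner_sub_left, inner_add_left,
        inner_smul_left, inner_smul_left, hg'.1, hg'.2, mul_zero, mul_zero, add_zero,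
        sub_zero] at e
      exact e
    rw [hbot, Submodule.mem_bot] at this
    exact Subtype.ext this
  -- If the range were proper, a nonzero functional would kill it. Its coefficients give `x = a x₁ +
  -- b x₂` with `ℓ x` orthogonal to the defect space of `T`, so `ℓ x` lies in the closed range of
  -- `ℓ` on the closure of `T`.
  have hsurj : LinearMap.range Λ = ⊤ := by
    by_contra hne
    obtain ⟨f, hf0, hf⟩ := Submodule.exists_le_ker_of_lt_top _ (lt_top_iff_ne_top.2 hne)
    set a := conj (f (1, 0)) with ha
    set b := conj (f (0, 1)) with hb
    have hfab : ∀ u v, f (u, v) = conj a * u + conj b * v := by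
      intro u v
      have : (u, v) = u • ((1 : ℂ), (0 : ℂ)) + v • ((0 : ℂ), (1 : ℂ)) := by simp
      rw [this, map_add, map_smul, map_smul]
      simp [ha, hb, mul_comm]
    set x := a • x₁ + b • x₂ with hx
    set R := T.graph.topologicalClosure.map ℓ with hR
    have hts : T.graph.topologicalClosure ≤ S.graph.topologicalClosure :=
      Submodule.topologicalClosure_mono hTS
    have hs' := symmetric_topologicalClosure hs
    have hRc : IsClosed (R : Set E) :=
      isClosed_map_sub_smul T.graph.isClosed_topologicalClosure
        (fun p hp q hq => hs' p (hts hp) q (hts hq)) (by simp [hz]) (by simpa using hz')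
    have hxR : ℓ x ∈ R := by
      rw [← hRc.submodule_topologicalClosure_eq, ← Submodule.orthogonal_orthogonal_eq_closure,
        Submodule.mem_orthogonal]
      intro v hv
      have hvN : v ∈ defectSpace T z := by
        rw [mem_defectSpace_iff hT]
        intro p hp
        exact (Submodule.mem_orthogonal _ _).1 hv _ ⟨p, T.graph.le_topologicalClosure hp, rfl⟩
      have e : f (Λ ⟨v, hvN⟩) = 0 := hf ⟨_, rfl⟩
      rw [hΛ, hfab] at e
      rw [← inner_conj_symm, hx, map_add, map_smul, map_smul, inner_add_left, inner_smul_left,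
        inner_smul_left, e, map_zero]
    obtain ⟨p, hp, hpx⟩ := hxR
    have hxS : x ∈ S.graph := add_mem (Submodule.smul_mem _ _ h₁) (Submodule.smul_mem _ _ h₂)
    -- `p` and `x` have the same image under `ℓ`, and `ℓ` is injective on the closure of the
    -- symmetric graph of `S` by the norm identity. So `x` lies in the closure of `T`, against
    -- independence.
    have hd : p - x ∈ S.graph.topologicalClosure :=
      sub_mem (hts hp) (S.graph.le_topologicalClosure hxS)
    have hn := norm_sq_sub_smul_of_symmetric (hs' _ hd _ hd) (w := conj z) (by simp [hz])
      (by simpa using hz')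
    have e0 : (p - x).2 - conj z • (p - x).1 = 0 := by
      rw [← hℓ, map_sub, hpx, sub_self]
    rw [e0, norm_zero] at hn
    have e1 : ‖(p - x).2‖ = 0 := by nlinarith [sq_nonneg ‖(p - x).1‖, sq_nonneg ‖(p - x).2‖]
    have e2 : ‖(p - x).1‖ = 0 := by nlinarith [sq_nonneg ‖(p - x).1‖, sq_nonneg ‖(p - x).2‖]
    have hpx' : p = x := sub_eq_zero.1 (Prod.ext (norm_eq_zero.1 e2) (norm_eq_zero.1 e1))
    obtain ⟨ha0, hb0⟩ := hindep a b (hx ▸ hpx' ▸ hp)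
    apply hf0
    ext <;> simp [hfab, ha0, hb0]
  have e := (LinearEquiv.ofBijective Λ ⟨hinj, LinearMap.range_eq_top.1 hsurj⟩).lift_rank_eq
  rw [rank_prod', Module.rank_self] at e
  apply Cardinal.lift_injective.{0}
  rw [e]
  norm_num

end UnboundedOperators

/-! ### Shifting the contour across a simple pole -/

/-- The filter `|Re s| → ∞` in the closed strip `0 ≤ Im s ≤ 1`. -/
def unitStripInfty : Filter ℂ :=
  comap (fun s : ℂ => |s.re|) atTop ⊓ 𝓟 {s : ℂ | 0 ≤ s.im ∧ s.im ≤ 1}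

theorem tendsto_vertical_integral {Ψ : ℂ → ℂ} (h : Tendsto Ψ unitStripInfty (𝓝 0)) {u : ℝ → ℝ}
    (hu : Tendsto (fun T => |u T|) atTop atTop) :
    Tendsto (fun T : ℝ => ∫ y in (0 : ℝ)..1, Ψ (u T + y * Complex.I)) atTop (𝓝 0) := by
  rw [Metric.tendsto_nhds] at h ⊢
  intro ε hε
  have h' := h (ε / 2) (half_pos hε)
  rw [unitStripInfty, eventually_inf_principal, eventually_comap] at h'
  filter_upwards [hu.eventually h'] with T hT
  rw [dist_zero_right]
  refine lt_of_le_of_lt (intervalIntegral.norm_integral_le_of_norm_le_const (C := ε / 2) ?_) ?_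
  · intro y hy
    rw [Set.uIoc_of_le zero_le_one] at hy
    have := hT (u T + y * Complex.I) (by simp) ⟨by simpa using hy.1.le, by simpa using hy.2⟩
    simpa using this.le
  · simpa using half_lt_self hε

/-- This Poisson kernel is the difference of the principal part of a pole on `Im s = 1/2` along the
two edges of the strip, up to the factor `iR`. Its mass `2π` produces the constant of the residue
theorem. -/
theorem integral_inv_sq_add_quarter (α : ℝ) :
    Integrable (fun x : ℝ => ((x - α) ^ 2 + 1 / 4)⁻¹) ∧
      ∫ x : ℝ, ((x - α) ^ 2 + 1 / 4)⁻¹ = 2 * Real.pi := by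
  have e : (fun x : ℝ => ((x - α) ^ 2 + 1 / 4)⁻¹) =
      fun x : ℝ => 4 * (fun y => (1 + (2 * y) ^ 2)⁻¹) (x - α) := by
    funext x
    rw [← div_eq_mul_inv, inv_eq_one_div, div_eq_div_iff (by positivity) (by positivity)]
    ring
  have hi : Integrable fun y : ℝ => (1 + (2 * y) ^ 2)⁻¹ :=
    integrable_inv_one_add_sq.comp_mul_left' (two_ne_zero)
  rw [e]
  refine ⟨(hi.comp_sub_right α).const_mul 4, ?_⟩
  rw [integral_const_mul, integral_sub_right_eq_self (fun y : ℝ => (1 + (2 * y) ^ 2)⁻¹) α,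
    Measure.integral_comp_mul_left (fun y : ℝ => (1 + y ^ 2)⁻¹) 2, integral_univ_inv_one_add_sq,
    abs_of_pos (by norm_num), smul_eq_mul]
  ring

theorem tendsto_re_unitStripInfty : Tendsto (fun s : ℂ => |s.re|) unitStripInfty atTop :=
  tendsto_comap.mono_left inf_le_left

theorem tendsto_norm_unitStripInfty : Tendsto (fun s : ℂ => ‖s‖) unitStripInfty atTop :=
  tendsto_atTop_mono (fun s => Complex.abs_re_le_norm s) tendsto_re_unitStripInfty

theorem tendsto_div_sub_unitStripInfty (R a : ℂ) :
    Tendsto (fun s : ℂ => R / (s - a)) unitStripInfty (𝓝 0) := by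
  have h : Tendsto (fun s : ℂ => s - a) unitStripInfty (Bornology.cobounded ℂ) := by
    rw [← tendsto_norm_atTop_iff_cobounded]
    refine tendsto_atTop_mono (fun s => ?_)
      (tendsto_atTop_add_const_right _ (-‖a‖) tendsto_norm_unitStripInfty)
    linarith [norm_sub_norm_le s a]
  simpa [div_eq_mul_inv] using (tendsto_inv₀_cobounded.comp h).const_mul R

/-- Removing a simple pole. -/
theorem exists_holomorphic_of_hasSimplePoleResidue {Φ : ℂ → ℂ} {a R : ℂ} {U : Set ℂ}
    (hU : IsOpen U) (hd : DifferentiableOn ℂ Φ (U \ {a})) (hr : HasSimplePoleResidue Φ a R) :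
    ∃ Ψ : ℂ → ℂ, DifferentiableOn ℂ Ψ U ∧ ∀ s, s ≠ a → Ψ s = Φ s - R / (s - a) := by
  obtain ⟨g, hg, he⟩ := hr
  classical
  refine ⟨Function.update (fun s => Φ s - R / (s - a)) a (g a), fun s hs => ?_, fun s hs => ?_⟩
  · apply DifferentiableAt.differentiableWithinAt
    by_cases hsa : s = a
    · subst hsa
      refine hg.differentiableAt.congr_of_eventuallyEq ?_
      rw [eventually_nhdsWithin_iff] at he
      filter_upwards [he] with t ht
      by_cases hts : t = s
      · simp [hts]
      · simp [Function.update_of_ne hts, ht hts]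
    · have hn : ∀ᶠ t in 𝓝 s, t ≠ a := isOpen_ne.mem_nhds hsa
      have h1 : DifferentiableAt ℂ (fun t => Φ t - R / (t - a)) s := by
        refine (hd.differentiableAt ((hU.sdiff isClosed_singleton).mem_nhds ⟨hs, hsa⟩)).sub ?_
        exact (differentiableAt_const _).div (by fun_prop) (sub_ne_zero.2 hsa)
      refine h1.congr_of_eventuallyEq ?_
      filter_upwards [hn] with t ht
      simp [Function.update_of_ne ht]
  · simp [Function.update_of_ne hs]

/-- The residue theorem for the strip `0 ≤ Im s ≤ 1` and one simple pole on its middle line. -/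
theorem integral_sub_integral_shift {Φ : ℂ → ℂ} {a R : ℂ} {δ : ℝ} (hδ : 0 < δ)
    (ha : a.im = 1 / 2)
    (hd : DifferentiableOn ℂ Φ ({s : ℂ | -δ < s.im ∧ s.im < 1 + δ} \ {a}))
    (hr : HasSimplePoleResidue Φ a R) (hlim : Tendsto Φ unitStripInfty (𝓝 0))
    (h0 : Integrable fun x : ℝ => Φ x) (h1 : Integrable fun x : ℝ => Φ (x + Complex.I)) :
    (∫ x : ℝ, Φ x) - ∫ x : ℝ, Φ (x + Complex.I) = 2 * Real.pi * Complex.I * R := by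
  have hU : IsOpen {s : ℂ | -δ < s.im ∧ s.im < 1 + δ} :=
    IsOpen.and (isOpen_lt (by fun_prop) (by fun_prop)) (isOpen_lt (by fun_prop) (by fun_prop))
  obtain ⟨Ψ, hΨ, hΨΦ⟩ := exists_holomorphic_of_hasSimplePoleResidue hU hd hr
  have hx0 : ∀ x : ℝ, (x : ℂ) ≠ a := fun x hx => by
    have := congrArg Complex.im hx
    rw [ha] at this
    norm_num at this
  have hx1 : ∀ x : ℝ, (x : ℂ) + Complex.I ≠ a := fun x hx => by
    have := congrArg Complex.im hx
    rw [ha] at this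
    norm_num at this
  have hΨlim : Tendsto Ψ unitStripInfty (𝓝 0) := by
    have h := hlim.sub (tendsto_div_sub_unitStripInfty R a)
    rw [sub_zero] at h
    refine h.congr' ?_
    filter_upwards [tendsto_re_unitStripInfty.eventually_gt_atTop |a.re|] with s hs
    exact (hΨΦ s fun h => by simp [h] at hs).symm
  -- Each principal part separately is not absolutely integrable on its edge. Their difference is,
  -- since the product of the denominators is real and quadratic when `a` lies on the middle line.
  have hk : ∀ x : ℝ, R / (x - a) - R / (x + Complex.I - a) =
      R * Complex.I * (((x - a.re) ^ 2 + 1 / 4)⁻¹ : ℝ) := by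
    intro x
    have n0 := sub_ne_zero.2 (hx0 x)
    have n1 := sub_ne_zero.2 (hx1 x)
    have hprod : ((x : ℂ) - a) * (x + Complex.I - a) = (((x - a.re) ^ 2 + 1 / 4 : ℝ) : ℂ) := by
      have ha' : a = a.re + 1 / 2 * Complex.I := by
        conv_lhs => rw [← Complex.re_add_im a, ha]
        norm_num
      push_cast
      linear_combination (-1 / 4 : ℂ) * Complex.I_mul_I
        - (2 * x + Complex.I - a - a.re - 1 / 2 * Complex.I) * ha'
    push_cast at hprod ⊢
    rw [← hprod]
    field_simp
    ring
  obtain ⟨hki, hkv⟩ := integral_inv_sq_add_quarter a.re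
  -- Cauchy's theorem is applied to `Ψ`, from which the pole has been removed. The principal part
  -- re-enters only through the explicit kernel.
  have hrect : ∀ T : ℝ, (∫ x in (-T)..T, (Φ x - Φ (x + Complex.I)
      - R * Complex.I * (((x - a.re) ^ 2 + 1 / 4)⁻¹ : ℝ)))
      + Complex.I * (∫ y in (0 : ℝ)..1, Ψ ((T : ℝ) + y * Complex.I))
      - Complex.I * (∫ y in (0 : ℝ)..1, Ψ (((-T : ℝ) : ℂ) + y * Complex.I)) = 0 := by
    intro T
    have h := Complex.integral_boundary_rect_eq_zero_of_differentiableOn Ψ ((-T : ℝ) : ℂ)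
      ((T : ℂ) + Complex.I) (hΨ.mono ?_)
    · simp only [Complex.ofReal_re, Complex.ofReal_im, Complex.add_re, Complex.add_im, Complex.I_re,
        Complex.I_im, add_zero, zero_add, Complex.ofReal_zero, Complex.ofReal_one, zero_mul,
        one_mul, smul_eq_mul] at h
      rw [← h]
      congr 2
      have c0 : Continuous fun x : ℝ => Ψ x :=
        hΨ.continuousOn.comp_continuous (by fun_prop) fun x => ⟨by simpa, by simp; linarith⟩
      have c1 : Continuous fun x : ℝ => Ψ (x + Complex.I) :=
        hΨ.continuousOn.comp_continuous (by fun_prop) fun x => ⟨by simp; linarith, by simpa⟩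
      rw [← intervalIntegral.integral_sub (c0.intervalIntegrable _ _) (c1.intervalIntegrable _ _)]
      congr 1
      funext x
      rw [hΨΦ _ (hx0 x), hΨΦ _ (hx1 x), ← hk]
      ring
    · intro s hs
      rw [Complex.mem_reProdIm] at hs
      have := hs.2
      simp only [Complex.ofReal_im, Complex.add_im, Complex.I_im, zero_add,
        Set.uIcc_of_le (zero_le_one' ℝ)] at this
      exact ⟨by linarith [this.1], by linarith [this.2]⟩
  have hkI : Integrable fun x : ℝ => R * Complex.I * (((x - a.re) ^ 2 + 1 / 4)⁻¹ : ℝ) :=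
    hki.ofReal.const_mul _
  have hint : Integrable fun x : ℝ => Φ x - Φ (x + Complex.I)
      - R * Complex.I * (((x - a.re) ^ 2 + 1 / 4)⁻¹ : ℝ) :=
    (h0.sub h1).sub hkI
  have hl := ((intervalIntegral_tendsto_integral hint tendsto_neg_atTop_atBot tendsto_id).add
    ((tendsto_vertical_integral hΨlim (u := fun T => T)
      tendsto_abs_atTop_atTop).const_mul Complex.I)).sub
    ((tendsto_vertical_integral hΨlim (u := fun T => -T)
      (by simpa using tendsto_abs_atTop_atTop)).const_mul Complex.I)
  have hz := tendsto_nhds_unique (hl.congr hrect) tendsto_const_nhds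
  have h01 : Integrable fun x : ℝ => Φ x - Φ (x + Complex.I) := h0.sub h1
  rw [integral_sub h01 hkI, integral_sub h0 h1,
    integral_const_mul, integral_complex_ofReal, hkv] at hz
  push_cast at hz
  linear_combination hz

/-! ### The boundary form of the difference operator -/

theorem integrable_conj_mul {μ : Measure ℝ} {u v : ℝ → ℂ} (hu : MemLp u 2 μ) (hv : MemLp v 2 μ) :
    Integrable (fun x => conj (u x) * v x) μ :=
  MemLp.integrable_mul (p := 2) (q := 2) hu.star hv

theorem memLp_affine_mul_shift {τ : ℝ} {f : ℂ → ℂ} (hf : HolomorphicOff (poles τ) f)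
    (hd : Decays f) {z : ℂ} (hz : z = 0 ∨ z = Complex.I ∨ z = -Complex.I) (a b : ℂ) :
    MemLp (fun x : ℝ => (a * x + b) * f (x + z)) 2 volume := by
  obtain ⟨ε, hε, h⟩ := hd
  have hre : z.re = 0 := by rcases hz with rfl | rfl | rfl <;> simp
  have him : z.im = 0 ∨ z.im = 1 ∨ z.im = -1 := by rcases hz with rfl | rfl | rfl <;> simp
  have him' : |z.im| ≤ 1 := by rcases him with h | h | h <;> simp [h]
  exact memLp_of_decay (Continuous.mul (by fun_prop) (continuous_shift hf him)) hε
    (affine_mul_isBigO (decay_shift h hre him') a b)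

theorem memLp_shift {τ : ℝ} {f : ℂ → ℂ} (hf : HolomorphicOff (poles τ) f)
    (hd : Decays f) {z : ℂ} (hz : z = 0 ∨ z = Complex.I ∨ z = -Complex.I) :
    MemLp (fun x : ℝ => f (x + z)) 2 volume := by
  simpa using memLp_affine_mul_shift hf hd hz 0 1

theorem Decays.tendsto_zero {f : ℂ → ℂ} (hd : Decays f) : Tendsto f stripInfty (𝓝 0) := by
  obtain ⟨ε, hε, h⟩ := hd
  refine h.trans_tendsto ?_
  have e : (-(3 / 2) - ε : ℝ) = -(3 / 2 + ε) := by ring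
  rw [e]
  exact (tendsto_rpow_neg_atTop (by linarith)).comp (tendsto_comap.mono_left inf_le_left)

theorem Decays.tendsto_affine_mul_zero {f : ℂ → ℂ} (hd : Decays f) (c : ℂ) :
    Tendsto (fun s => (s + c) * f s) stripInfty (𝓝 0) := by
  obtain ⟨ε, hε, h⟩ := hd
  have hre : Tendsto (fun s : ℂ => |s.re|) stripInfty atTop := tendsto_comap.mono_left inf_le_left
  have h1 : (fun s : ℂ => s + c) =O[stripInfty] fun s => |s.re| ^ (1 : ℝ) := by
    refine IsBigO.of_bound (2 + ‖c‖) ?_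
    have hs' : ∀ᶠ s : ℂ in stripInfty, |s.im| ≤ 1 :=
      eventually_inf_principal.2 (Eventually.of_forall fun s hs => hs)
    filter_upwards [hre.eventually_ge_atTop 1, hs'] with s hs hs'
    rw [Real.rpow_one, Real.norm_of_nonneg (abs_nonneg _)]
    calc ‖s + c‖ ≤ |s.re| + |s.im| + ‖c‖ :=
          (norm_add_le _ _).trans (by gcongr; exact Complex.norm_le_abs_re_add_abs_im s)
      _ ≤ (2 + ‖c‖) * |s.re| := by nlinarith [norm_nonneg c]
  refine (h1.mul h).trans_tendsto ?_
  have ht : Tendsto (fun s : ℂ => |s.re| ^ (-(1 / 2 + ε) : ℝ)) stripInfty (𝓝 0) :=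
    (tendsto_rpow_neg_atTop (by linarith)).comp hre
  refine ht.congr' ?_
  filter_upwards [hre.eventually_gt_atTop 0] with s hs
  rw [← Real.rpow_add hs]
  congr 1
  ring

theorem HasSimplePoleResidue.comp_add {f : ℂ → ℂ} {p r : ℂ} (h : HasSimplePoleResidue f p r)
    (c : ℂ) : HasSimplePoleResidue (fun s => f (s + c)) (p - c) r := by
  obtain ⟨g, hg, he⟩ := h
  refine ⟨fun s => g (s + c), ?_, ?_⟩
  · refine AnalyticAt.fun_comp (g := g) ?_ (by fun_prop)
    simpa using hg
  · have ht : Tendsto (fun s : ℂ => s + c) (𝓝[≠] (p - c)) (𝓝[≠] p) := by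
      refine tendsto_nhdsWithin_of_tendsto_nhds_of_eventually_within _ ?_ ?_
      · have : Tendsto (fun s : ℂ => s + c) (𝓝 (p - c)) (𝓝 (p - c + c)) :=
          Continuous.tendsto (by fun_prop) _
        rw [sub_add_cancel] at this
        exact this.mono_left nhdsWithin_le_nhds
      · filter_upwards [self_mem_nhdsWithin] with s hs h
        exact hs (eq_sub_of_add_eq h)
    filter_upwards [ht.eventually he] with s hs
    rw [hs]
    ring

theorem HasSimplePoleResidue.conj_comp_conj {f : ℂ → ℂ} {p r : ℂ}
    (h : HasSimplePoleResidue f p r) :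
    HasSimplePoleResidue (fun s => conj (f (conj s))) (conj p) (conj r) := by
  obtain ⟨g, hg, he⟩ := h
  refine ⟨fun s => conj (g (conj s)), ?_, ?_⟩
  · rw [Complex.analyticAt_iff_eventually_differentiableAt] at hg ⊢
    have ht : Tendsto (fun s : ℂ => conj s) (𝓝 (conj p)) (𝓝 p) := by
      simpa using (Complex.continuous_conj.tendsto (conj p))
    filter_upwards [ht.eventually hg] with s hs
    simpa [Function.comp_def] using hs.conj_conj
  · have ht : Tendsto (fun s : ℂ => conj s) (𝓝[≠] (conj p)) (𝓝[≠] p) := by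
      refine tendsto_nhdsWithin_of_tendsto_nhds_of_eventually_within _ ?_ ?_
      · simpa using (Complex.continuous_conj.tendsto (conj p)).mono_left nhdsWithin_le_nhds
      · filter_upwards [self_mem_nhdsWithin] with s hs h
        exact hs (by rw [← h]; simp)
    filter_upwards [ht.eventually he] with s hs
    rw [hs]
    simp

/-- The zero of the coefficient at `p` lowers the double pole of the product to a simple one. -/
theorem HasSimplePoleResidue.sub_mul_mul {f g : ℂ → ℂ} {p r q : ℂ}
    (hf : HasSimplePoleResidue f p r) (hg : HasSimplePoleResidue g p q) :
    HasSimplePoleResidue (fun s => (s - p) * f s * g s) p (r * q) := by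
  obtain ⟨u, hu, h⟩ := hf
  obtain ⟨v, hv, k⟩ := hg
  refine ⟨fun s => r * v s + q * u s + (s - p) * u s * v s, by fun_prop, ?_⟩
  filter_upwards [h, k, self_mem_nhdsWithin] with s h k hs
  have : s - p ≠ 0 := sub_ne_zero.2 hs
  rw [h, k]
  field_simp
  ring

theorem tendsto_conj_add_stripInfty {c : ℂ} (hc : c = Complex.I ∨ c = 0) :
    Tendsto (fun s : ℂ => conj s + c) unitStripInfty stripInfty := by
  refine tendsto_inf.2 ⟨tendsto_comap_iff.2 ?_, tendsto_principal.2 ?_⟩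
  · refine tendsto_re_unitStripInfty.congr fun s => ?_
    rcases hc with rfl | rfl <;> simp
  · refine eventually_inf_principal.2 (Eventually.of_forall fun s hs => ?_)
    rcases hc with rfl | rfl <;> simp only [Set.mem_ofPred_eq, Complex.add_im, Complex.conj_im,
      Complex.I_im, Complex.zero_im, abs_le] <;> constructor <;> linarith [hs.1, hs.2]

theorem tendsto_add_stripInfty {c : ℂ} (hc : c = Complex.I ∨ c = 0) :
    Tendsto (fun s : ℂ => s + (c - Complex.I)) unitStripInfty stripInfty := by
  refine tendsto_inf.2 ⟨tendsto_comap_iff.2 ?_, tendsto_principal.2 ?_⟩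
  · refine tendsto_re_unitStripInfty.congr fun s => ?_
    rcases hc with rfl | rfl <;> simp
  · refine eventually_inf_principal.2 (Eventually.of_forall fun s hs => ?_)
    rcases hc with rfl | rfl <;> simp only [Set.mem_ofPred_eq, Complex.add_im, Complex.sub_im,
      Complex.I_im, Complex.zero_im, abs_le] <;> constructor <;> linarith [hs.1, hs.2]

/-- The residue theorem for `Φ(t) = (t - a) conj(f(conj t + c)) g(t + c - i)`. Reflection sends the
pole of `f` to `conj(p - c)`, translation sends that of `g` to `p - c + i`, and for both admissible
choices of `(c, p)` these are the same point `a` on `Im s = 1/2`, where the coefficient `t - a`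
vanishes. The two choices handle the upward and the downward shift in `𝓛`. -/
theorem contour_pairing {τ : ℝ} {f g : ℂ → ℂ} (hf : HolomorphicOff (poles τ) f)
    (hg : HolomorphicOff (poles τ) g) (df : Decays f) (dg : Decays g) {c p r q : ℂ}
    (hcp : (c = Complex.I ∧ p = Complex.I / 2) ∨ (c = 0 ∧ p = -Complex.I / 2 + 2 * τ))
    (hr : HasSimplePoleResidue f p r) (hq : HasSimplePoleResidue g p q) :
    (∫ x : ℝ, (x - (p - c + Complex.I)) * conj (f (x + c)) * g (x + (c - Complex.I)))
      - ∫ x : ℝ, (x - (p - c)) * conj (f (x + (c - Complex.I))) * g (x + c)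
      = 2 * Real.pi * Complex.I * (conj r * q) := by
  have hc : c = Complex.I ∨ c = 0 := hcp.imp And.left And.left
  have hc0 : c = 0 ∨ c = Complex.I ∨ c = -Complex.I := by tauto
  have hc1 : c - Complex.I = 0 ∨ c - Complex.I = Complex.I ∨ c - Complex.I = -Complex.I := by
    rcases hc with rfl | rfl <;> simp
  set a := p - c + Complex.I with ha
  have hpc : conj (p - c) = a := by
    rcases hcp with ⟨rfl, rfl⟩ | ⟨rfl, rfl⟩
    · simp [ha, Complex.conj_ofNat]; ring
    · simp [ha, Complex.conj_ofNat]; ring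
  have hacI : p - (c - Complex.I) = a := by rw [ha]; ring
  set Φ : ℂ → ℂ := fun t => (t - a) * conj (f (conj t + c)) * g (t + (c - Complex.I)) with hΦ
  have hres : HasSimplePoleResidue Φ a (conj r * q) := by
    have h1 := (hr.comp_add c).conj_comp_conj
    have h2 := hq.comp_add (c - Complex.I)
    rw [hpc] at h1
    rw [hacI] at h2
    exact h1.sub_mul_mul h2
  have hlim : Tendsto Φ unitStripInfty (𝓝 0) := by
    have h1 := (Complex.continuous_conj.tendsto 0).comp
      (df.tendsto_zero.comp (tendsto_conj_add_stripInfty hc))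
    have h2 := (dg.tendsto_affine_mul_zero (-p)).comp (tendsto_add_stripInfty hc)
    have h3 := h1.mul h2
    rw [mul_zero] at h3
    refine h3.congr fun s => ?_
    simp only [Function.comp_apply, hΦ, ← hacI]
    ring
  have hshift : ∀ x : ℝ, Φ (x + Complex.I)
      = (x - (p - c)) * conj (f (x + (c - Complex.I))) * g (x + c) := by
    intro x
    have e1 : conj ((x : ℂ) + Complex.I) + c = x + (c - Complex.I) := by simp; ring
    have e2 : (x : ℂ) + Complex.I + (c - Complex.I) = x + c := by ring
    simp only [hΦ, e1, e2, ha]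
    ring
  have hreal : ∀ x : ℝ, Φ x
      = (x - a) * conj (f (x + c)) * g (x + (c - Complex.I)) := by
    intro x
    simp [hΦ]
  have i0 : Integrable fun x : ℝ => Φ x := by
    refine (integrable_conj_mul (memLp_shift hf df hc0)
      (memLp_affine_mul_shift hg dg hc1 1 (-a))).congr (Eventually.of_forall fun x => ?_)
    simp only [hreal]
    ring
  have i1 : Integrable fun x : ℝ => Φ (x + Complex.I) := by
    refine (integrable_conj_mul (memLp_shift hf df hc1)
      (memLp_affine_mul_shift hg dg hc0 1 (-(p - c)))).congr (Eventually.of_forall fun x => ?_)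
    simp only [hshift]
    ring
  have haim : a.im = 1 / 2 := by
    rcases hcp with ⟨rfl, rfl⟩ | ⟨rfl, rfl⟩ <;> simp [ha] <;> norm_num
  obtain ⟨δ₁, hδ₁, hf⟩ := hf
  obtain ⟨δ₂, hδ₂, hg⟩ := hg
  -- The arguments of `f` and `g` range over a `δ`-neighbourhood of a unit strip containing the pole
  -- `p`. The bound `1/2` keeps the other pole outside it.
  set δ := min (min δ₁ δ₂) (1 / 2) with hδ
  have hδ0 : 0 < δ := lt_min (lt_min hδ₁ hδ₂) (by norm_num)
  have hδ1 : δ ≤ δ₁ := (min_le_left _ _).trans (min_le_left _ _)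
  have hδ2 : δ ≤ δ₂ := (min_le_left _ _).trans (min_le_right _ _)
  have hδ3 : δ ≤ 1 / 2 := min_le_right _ _
  have hstrip : ∀ {δ' : ℝ}, IsOpen ({s : ℂ | |s.im| < 1 + δ'} \ poles τ) := fun {δ'} =>
    (isOpen_lt (f := fun s : ℂ => |s.im|) (by fun_prop) (by fun_prop)).sdiff
      (((Set.finite_singleton _).insert _).isClosed)
  have hmem : ∀ {u : ℂ} {δ' : ℝ}, δ ≤ δ' → u ≠ p →
      (c = Complex.I ∧ -δ < u.im ∧ u.im < 1 + δ ∨ c = 0 ∧ -1 - δ < u.im ∧ u.im < δ) →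
      u ∈ {s : ℂ | |s.im| < 1 + δ'} \ poles τ := by
    intro u δ' hδ' hup hu
    refine ⟨?_, ?_⟩
    · rw [Set.mem_ofPred_eq, abs_lt]
      rcases hu with ⟨-, h1, h2⟩ | ⟨-, h1, h2⟩ <;> constructor <;> linarith
    · rintro (rfl | rfl)
      · rcases hcp with ⟨hc', rfl⟩ | ⟨hc', rfl⟩
        · exact hup rfl
        · rcases hu with ⟨h, -⟩ | ⟨-, h1, h2⟩
          · rw [h] at hc'
            exact Complex.I_ne_zero hc'
          · simp at h2
            linarith
      · rcases hcp with ⟨hc', rfl⟩ | ⟨hc', rfl⟩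
        · rcases hu with ⟨-, h1, h2⟩ | ⟨h, -⟩
          · simp at h1
            norm_num at h1
            linarith
          · rw [h] at hc'
            exact Complex.I_ne_zero hc'.symm
        · exact hup rfl
  have hd : DifferentiableOn ℂ Φ ({s : ℂ | -δ < s.im ∧ s.im < 1 + δ} \ {a}) := by
    rintro s ⟨⟨hs1, hs2⟩, hsa⟩
    have hsa : s ≠ a := hsa
    apply DifferentiableAt.differentiableWithinAt
    have m1 : conj s + c ∈ {s : ℂ | |s.im| < 1 + δ₁} \ poles τ := by
      refine hmem hδ1 (fun h => hsa ?_) ?_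
      · rw [← hpc, ← h]
        simp
      · rcases hc with rfl | rfl
        · refine Or.inl ⟨rfl, ?_, ?_⟩ <;> simp <;> linarith
        · refine Or.inr ⟨rfl, ?_, ?_⟩ <;> simp <;> linarith
    have m2 : s + (c - Complex.I) ∈ {s : ℂ | |s.im| < 1 + δ₂} \ poles τ := by
      refine hmem hδ2 (fun h => hsa ?_) ?_
      · rw [← hacI, ← h]
        ring
      · rcases hc with rfl | rfl
        · refine Or.inl ⟨rfl, ?_, ?_⟩ <;> simp <;> linarith
        · refine Or.inr ⟨rfl, ?_, ?_⟩ <;> simp <;> linarith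
    have d1 : DifferentiableAt ℂ (fun t => conj (f (conj t + c))) s := by
      have : DifferentiableAt ℂ (fun t => f (t + c)) (conj s) := by
        have := hf.differentiableAt (hstrip.mem_nhds m1)
        exact DifferentiableAt.comp (g := f) (conj s) this (by fun_prop)
      simpa [Function.comp_def] using this.conj_conj
    have d2 : DifferentiableAt ℂ (fun t => g (t + (c - Complex.I))) s :=
      DifferentiableAt.comp (g := g) s (hg.differentiableAt (hstrip.mem_nhds m2)) (by fun_prop)
    exact ((by fun_prop : DifferentiableAt ℂ (fun t => t - a) s).mul d1).mul d2
  have h := integral_sub_integral_shift hδ0 haim hd hres hlim i0 i1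
  simp only [hshift, hreal] at h
  exact h

/-- The difference expression for `ε = 1`; for `ε = -1` it is its conjugate by `e^{πs}`. -/
noncomputable def modOp (ε φ τ : ℝ) (h : ℂ → ℂ) : ℂ → ℂ := fun s =>
  ε * (s + Complex.I / 2) * h (s + Complex.I) + 2 * (s - τ) * Real.cos φ * h s
    + ε * (s - 2 * τ - Complex.I / 2) * h (s - Complex.I)

theorem diffOp_eq_modOp (φ τ : ℝ) (f : ℂ → ℂ) : diffOp φ τ f = modOp 1 φ τ f := by
  funext s
  simp only [diffOp, modOp, LinearMap.coe_mk, AddHom.coe_mk, Complex.ofReal_one]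
  linear_combination (-s * f (s + Complex.I) + (-s + 2 * τ) * f (s - Complex.I)) *
    Complex.I_mul_I

/-- Both shifts multiply `e^{πs}` by `-1`, so conjugation flips the sign of the two shift terms and
leaves the middle one alone. -/
theorem exp_mul_diffOp (φ τ : ℝ) (f : ℂ → ℂ) (s : ℂ) :
    Complex.exp (Real.pi * s) * diffOp φ τ f s =
      modOp (-1) φ τ (fun s => Complex.exp (Real.pi * s) * f s) s := by
  have e1 : Complex.exp (Real.pi * (s + Complex.I)) = -Complex.exp (Real.pi * s) := by
    rw [mul_add, Complex.exp_add, Complex.exp_pi_mul_I]; ring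
  have e2 : Complex.exp (Real.pi * (s - Complex.I)) = -Complex.exp (Real.pi * s) := by
    rw [mul_sub, Complex.exp_sub, Complex.exp_pi_mul_I]; ring
  rw [diffOp_eq_modOp]
  simp only [modOp, e1, e2]
  push_cast
  ring

theorem memLp_modOp (ε φ : ℝ) {τ : ℝ} {f : ℂ → ℂ} (hf : HolomorphicOff (poles τ) f)
    (df : Decays f) : MemLp (fun x : ℝ => modOp ε φ τ f x) 2 volume := by
  have h := ((memLp_affine_mul_shift hf df (z := Complex.I) (by simp) ε (ε * (Complex.I / 2))).add
    (memLp_affine_mul_shift hf df (z := 0) (by simp) (2 * Real.cos φ) (-2 * τ * Real.cos φ))).add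
    (memLp_affine_mul_shift hf df (z := -Complex.I) (by simp) ε (ε * (-2 * τ - Complex.I / 2)))
  convert h using 1
  funext x
  simp only [modOp, Pi.add_apply, add_zero, ← sub_eq_add_neg]
  ring

/-- Green's formula for the difference operator: the boundary form is a sum over the poles. -/
theorem integral_modOp_sub (ε φ : ℝ) {τ : ℝ} {f g : ℂ → ℂ} (hf : HolomorphicOff (poles τ) f)
    (hg : HolomorphicOff (poles τ) g) (df : Decays f) (dg : Decays g) {r q r' q' : ℂ}
    (hr : HasSimplePoleResidue f (Complex.I / 2) r) (hq : HasSimplePoleResidue g (Complex.I / 2) q)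
    (hr' : HasSimplePoleResidue f (-Complex.I / 2 + 2 * τ) r')
    (hq' : HasSimplePoleResidue g (-Complex.I / 2 + 2 * τ) q') :
    (∫ x : ℝ, conj (modOp ε φ τ f x) * g x) - ∫ x : ℝ, conj (f x) * modOp ε φ τ g x
      = 2 * Real.pi * Complex.I * ε * (conj r * q - conj r' * q') := by
  have h1 := contour_pairing hf hg df dg (Or.inl ⟨rfl, rfl⟩) hr hq
  have h2 := contour_pairing hf hg df dg (Or.inr ⟨rfl, rfl⟩) hr' hq'
  have k1 : Integrable fun x : ℝ =>
      conj (f (x + Complex.I)) * ((1 * x + -(Complex.I / 2)) * g x) := by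
    simpa using integrable_conj_mul (memLp_shift hf df (z := Complex.I) (by simp))
      (memLp_affine_mul_shift hg dg (z := 0) (by simp) 1 (-(Complex.I / 2)))
  have k2 : Integrable fun x : ℝ =>
      conj (f x) * ((1 * x + Complex.I / 2) * g (x + Complex.I)) := by
    simpa using integrable_conj_mul (memLp_shift hf df (z := 0) (by simp))
      (memLp_affine_mul_shift hg dg (z := Complex.I) (by simp) 1 (Complex.I / 2))
  have k3 : Integrable fun x : ℝ =>
      conj (f x) * ((1 * x + -(Complex.I / 2 + 2 * τ)) * g (x + -Complex.I)) := by
    simpa using integrable_conj_mul (memLp_shift hf df (z := 0) (by simp))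
      (memLp_affine_mul_shift hg dg (z := -Complex.I) (by simp) 1 (-(Complex.I / 2 + 2 * τ)))
  have k4 : Integrable fun x : ℝ =>
      conj (f (x + -Complex.I)) * ((1 * x + (Complex.I / 2 - 2 * τ)) * g x) := by
    simpa using integrable_conj_mul (memLp_shift hf df (z := -Complex.I) (by simp))
      (memLp_affine_mul_shift hg dg (z := 0) (by simp) 1 (Complex.I / 2 - 2 * τ))
  have kf : Integrable fun x : ℝ => conj (modOp ε φ τ f x) * g x := by
    simpa using integrable_conj_mul (memLp_modOp ε φ hf df) (memLp_shift hg dg (z := 0) (by simp))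
  have kg : Integrable fun x : ℝ => conj (f x) * modOp ε φ τ g x := by
    simpa using integrable_conj_mul (memLp_shift hf df (z := 0) (by simp)) (memLp_modOp ε φ hg dg)
  have key : ∀ x : ℝ, conj (modOp ε φ τ f x) * g x - conj (f x) * modOp ε φ τ g x =
      ε * (conj (f (x + Complex.I)) * ((1 * x + -(Complex.I / 2)) * g x)
        - conj (f x) * ((1 * x + Complex.I / 2) * g (x + Complex.I)))
      - ε * (conj (f x) * ((1 * x + -(Complex.I / 2 + 2 * τ)) * g (x + -Complex.I))
        - conj (f (x + -Complex.I)) * ((1 * x + (Complex.I / 2 - 2 * τ)) * g x)) := by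
    intro x
    simp only [modOp, map_add, map_mul, map_sub, Complex.conj_ofReal, Complex.conj_I, map_div₀,
      Complex.conj_ofNat, ← sub_eq_add_neg]
    ring
  rw [← integral_sub kf kg]
  simp only [key]
  have k12 : Integrable fun x : ℝ => ε * (conj (f (x + Complex.I)) * ((1 * x + -(Complex.I / 2))
      * g x) - conj (f x) * ((1 * x + Complex.I / 2) * g (x + Complex.I))) :=
    (k1.sub k2).const_mul _
  have k34 : Integrable fun x : ℝ => ε * (conj (f x) * ((1 * x + -(Complex.I / 2 + 2 * τ))
      * g (x + -Complex.I)) - conj (f (x + -Complex.I)) * ((1 * x + (Complex.I / 2 - 2 * τ))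
      * g x)) := (k3.sub k4).const_mul _
  rw [integral_sub k12 k34, integral_const_mul,
    integral_const_mul, integral_sub k1 k2, integral_sub k3 k4]
  have e1 : ∀ x : ℝ, (x - (Complex.I / 2 - Complex.I + Complex.I)) * conj (f (x + Complex.I))
      * g (x + (Complex.I - Complex.I))
      = conj (f (x + Complex.I)) * ((1 * x + -(Complex.I / 2)) * g x) := fun x => by
    rw [sub_self, add_zero]; ring
  have e2 : ∀ x : ℝ, (x - (Complex.I / 2 - Complex.I)) * conj (f (x + (Complex.I - Complex.I)))
      * g (x + Complex.I)
      = conj (f x) * ((1 * x + Complex.I / 2) * g (x + Complex.I)) := fun x => by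
    rw [sub_self, add_zero]; ring
  have e3 : ∀ x : ℝ, (x - (-Complex.I / 2 + 2 * τ - 0 + Complex.I)) * conj (f (x + 0))
      * g (x + (0 - Complex.I))
      = conj (f x) * ((1 * x + -(Complex.I / 2 + 2 * τ)) * g (x + -Complex.I)) := fun x => by
    rw [zero_sub, add_zero]; ring
  have e4 : ∀ x : ℝ, (x - (-Complex.I / 2 + 2 * τ - 0)) * conj (f (x + (0 - Complex.I)))
      * g (x + 0)
      = conj (f (x + -Complex.I)) * ((1 * x + (Complex.I / 2 - 2 * τ)) * g x) := fun x => by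
    rw [zero_sub, add_zero]; ring
  simp only [e1, e2] at h1
  simp only [e3, e4] at h2
  rw [h1, h2]
  ring

/-! ### Fourier transforms of square integrable functions -/

/-- The Fourier–Laplace transform `∫ F(t) e^{2πist} dt`, for complex `s`. -/
noncomputable def fourierLaplace (F : ℝ → ℂ) (s : ℂ) : ℂ :=
  ∫ t : ℝ, F t * Complex.exp (2 * Real.pi * Complex.I * s * t)

theorem fourierLaplace_ofReal (F : ℝ → ℂ) (x : ℝ) : fourierLaplace F x = 𝓕⁻ F x := by
  rw [Real.fourierInv_eq']
  refine integral_congr_ae (Eventually.of_forall fun t => ?_)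
  simp only [smul_eq_mul, RCLike.inner_apply, conj_trivial]
  rw [mul_comm]
  congr 2
  push_cast
  ring

/-- The pointwise integral transform and the transform extended to `L²` by Plancherel are compared
as tempered distributions. Both pair with a Schwartz function by moving the transform onto it, and
`L²` embeds injectively into distributions. -/
theorem toLp_fourierInv {F k : ℝ → ℂ} (h1 : Integrable F) (h2 : MemLp F 2 volume)
    (hk : MemLp k 2 volume) (hkF : ∀ x : ℝ, k x = fourierLaplace F x) :
    hk.toLp k = 𝓕⁻ (h2.toLp F) := by
  have hinj : Function.Injective (Lp.toTemperedDistributionCLM (E := ℝ) ℂ volume 2) :=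
    LinearMap.ker_eq_bot.1 (Lp.ker_toTemperedDistributionCLM_eq_bot)
  apply hinj
  rw [Lp.toTemperedDistributionCLM_apply, Lp.toTemperedDistributionCLM_apply,
    ← Lp.fourierInv_toTemperedDistribution_eq]
  ext g
  rw [TemperedDistribution.fourierInv_apply, Lp.toTemperedDistribution_apply,
    Lp.toTemperedDistribution_apply]
  have e1 : ∫ x, g x • (hk.toLp k) x = ∫ x, (𝓕⁻ F x) • g x := by
    refine integral_congr_ae ?_
    filter_upwards [hk.coeFn_toLp] with x hx
    rw [hx, hkF, fourierLaplace_ofReal, smul_eq_mul, smul_eq_mul, mul_comm]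
  have e2 : ∫ x, (𝓕⁻ g) x • (h2.toLp F) x = ∫ x, F x • (𝓕⁻ (g : ℝ → ℂ)) x := by
    refine integral_congr_ae ?_
    filter_upwards [h2.coeFn_toLp] with x hx
    rw [hx, SchwartzMap.fourierInv_coe, smul_eq_mul, smul_eq_mul, mul_comm]
  rw [e1, e2]
  have := VectorFourier.integral_fourierIntegral_smul_eq_flip (L := -innerₗ ℝ) (f := F) (g := g)
    (μ := volume) (ν := volume)
    Real.continuous_fourierChar (by
      simp only [LinearMap.neg_apply]
      exact continuous_inner.neg) h1 g.integrable
  have hflip : (-innerₗ ℝ).flip = -innerₗ ℝ := by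
    ext
    simp
  rw [hflip] at this
  exact this

theorem integral_conj_mul_eq_inner {u : ℝ → ℂ} (hu : MemLp u 2 volume)
    (y : Lp ℂ 2 (volume : Measure ℝ)) : ∫ x, conj (u x) * y x = ⟪hu.toLp u, y⟫_ℂ := by
  rw [L2.inner_def]
  refine integral_congr_ae ?_
  filter_upwards [hu.coeFn_toLp] with x hx
  rw [hx, RCLike.inner_apply, mul_comm]

/-- Plancherel's formula for a function in `L¹ ∩ L²` and a function in `L²`. -/
theorem integral_conj_mul_fourier {F k : ℝ → ℂ} (h1 : Integrable F) (h2 : MemLp F 2 volume)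
    (hk : MemLp k 2 volume) (hkF : ∀ x : ℝ, k x = fourierLaplace F x)
    (y : Lp ℂ 2 (volume : Measure ℝ)) :
    ∫ x, conj (k x) * y x = ∫ t, conj (F t) * (𝓕 y : Lp ℂ 2 (volume : Measure ℝ)) t := by
  rw [integral_conj_mul_eq_inner hk, integral_conj_mul_eq_inner h2, toLp_fourierInv h1 h2 hk hkF,
    ← Lp.inner_fourier_eq, FourierTransform.fourier_fourierInv_eq]

/-! ### The inner product of `L²(ℝ, ds) ⊕ L²(ℝ, e^{2πs} ds)` -/

theorem memLp_exp_mul {u : ℝ → ℂ} (hu : MemLp u 2 expMeasure) :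
    MemLp (fun x : ℝ => Complex.exp (Real.pi * x) * u x) 2 volume := by
  have hm : AEStronglyMeasurable u volume :=
    hu.1.mono_ac (withDensity_absolutelyContinuous' (by fun_prop)
      (Eventually.of_forall fun x => by simp [Real.exp_pos]))
  have h := (memLp_two_iff_integrable_sq_norm hu.1).1 hu
  rw [expMeasure, integrable_withDensity_iff_integrable_smul' (by fun_prop) (by simp)] at h
  rw [memLp_two_iff_integrable_sq_norm (by
    exact (Continuous.aestronglyMeasurable (by fun_prop)).mul hm)]
  refine h.congr (Eventually.of_forall fun x => ?_)
  have : ‖Complex.exp (Real.pi * x)‖ = Real.exp (Real.pi * x) := by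
    rw [Complex.norm_exp]; simp
  simp only [norm_mul, this]
  rw [ENNReal.toReal_ofReal (Real.exp_pos _).le, mul_pow, ← Real.exp_nat_mul, smul_eq_mul]
  push_cast
  ring_nf

theorem integral_conj_mul_expMeasure (u v : ℝ → ℂ) :
    ∫ x, conj (u x) * v x ∂expMeasure =
      ∫ x : ℝ, conj (Complex.exp (Real.pi * x) * u x) * (Complex.exp (Real.pi * x) * v x) := by
  rw [expMeasure, integral_withDensity_eq_integral_toReal_smul (by fun_prop) (by simp)]
  refine integral_congr_ae (Eventually.of_forall fun x => ?_)
  simp only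
  rw [ENNReal.toReal_ofReal (Real.exp_pos _).le, map_mul, ← Complex.exp_conj, Complex.real_smul,
    show (2 * Real.pi * x : ℝ) = Real.pi * x + Real.pi * x by ring, Real.exp_add]
  push_cast
  simp only [map_mul, Complex.conj_ofReal]
  ring

/-- The component `e^{πs} f₂` of an element of the Hilbert space, as an element of `L²(ℝ, ds)`. -/
noncomputable def expSnd (y : L2Sum) : Lp ℂ 2 (volume : Measure ℝ) :=
  (memLp_exp_mul (Lp.memLp y.snd)).toLp _

/-- Multiplication by `e^{πs}` is an isometry from the weighted space onto `L²(ℝ, ds)`. From here on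
only unweighted integrals occur. -/
theorem inner_L2Sum {x y : L2Sum} {u v : ℝ → ℂ} (hu : x.fst =ᵐ[volume] u)
    (hv : x.snd =ᵐ[expMeasure] v) :
    ⟪x, y⟫_ℂ = (∫ t : ℝ, conj (u t) * y.fst t)
      + ∫ t : ℝ, conj (Complex.exp (Real.pi * t) * v t) * expSnd y t := by
  rw [WithLp.prod_inner_apply]
  congr 1
  · rw [L2.inner_def]
    refine integral_congr_ae ?_
    filter_upwards [hu] with t ht
    rw [RCLike.inner_apply, mul_comm]
    exact congrArg (fun z => conj z * _) ht
  · have e : ∫ t : ℝ, conj (Complex.exp (Real.pi * t) * v t) * expSnd y t =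
        ∫ t : ℝ, conj (Complex.exp (Real.pi * t) * v t) * (Complex.exp (Real.pi * t) * y.snd t) := by
      refine integral_congr_ae ?_
      filter_upwards [(memLp_exp_mul (Lp.memLp y.snd)).coeFn_toLp] with t ht
      rw [← ht]
      rfl
    rw [e, ← integral_conj_mul_expMeasure, L2.inner_def]
    refine integral_congr_ae ?_
    filter_upwards [hv] with t ht
    rw [RCLike.inner_apply, mul_comm]
    exact congrArg (fun z => conj z * _) ht

theorem eq_zero_of_expSnd {y : L2Sum} (h1 : y.fst = 0) (h2 : expSnd y = 0) : y = 0 := by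
  have h3 : y.snd = 0 := by
    rw [expSnd, toLp_eq_zero] at h2
    rw [Lp.eq_zero_iff_ae_eq_zero]
    have : ∀ᵐ x : ℝ, y.snd x = 0 := by
      filter_upwards [h2] with x hx
      simpa using hx
    exact ae_expMeasure.2 this
  exact WithLp.ofLp_injective 2 (Prod.ext h1 h3)

/-! ### Green's formula in the Hilbert space -/

theorem HolomorphicOff.mul_entire {P : Set ℂ} {f u : ℂ → ℂ} (hf : HolomorphicOff P f)
    (hu : Differentiable ℂ u) : HolomorphicOff P (fun s => u s * f s) := by
  obtain ⟨δ, hδ, hd⟩ := hf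
  exact ⟨δ, hδ, hu.differentiableOn.mul hd⟩

/-- Splitting `u(s) = u(p) + (s - p) dslope u p s` leaves the principal part with coefficient `u(p)
r`; the second term cancels the pole. -/
theorem HasSimplePoleResidue.mul_analytic {f u : ℂ → ℂ} {p r : ℂ}
    (h : HasSimplePoleResidue f p r) (hu : AnalyticAt ℂ u p) :
    HasSimplePoleResidue (fun s => u s * f s) p (u p * r) := by
  obtain ⟨g, hg, he⟩ := h
  obtain ⟨P, hP⟩ := hu
  have hs : AnalyticAt ℂ (dslope u p) p := hP.has_fpower_series_dslope_fslope.analyticAt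
  have hu : AnalyticAt ℂ u p := hP.analyticAt
  refine ⟨fun s => r * dslope u p s + u s * g s, by fun_prop, ?_⟩
  filter_upwards [he, self_mem_nhdsWithin] with s hs hsp
  have hsp' : s - p ≠ 0 := sub_ne_zero.2 hsp
  rw [hs, dslope_of_ne _ hsp, slope_def_field]
  field_simp
  ring

theorem HolomorphicOff.hasSimplePoleResidue_zero {f : ℂ → ℂ} (hf : HolomorphicOff ∅ f) {p : ℂ}
    (hp : |p.im| < 1) : HasSimplePoleResidue f p 0 := by
  obtain ⟨δ, hδ, hd⟩ := hf
  refine ⟨f, ?_, by simp⟩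
  refine hd.analyticAt (IsOpen.mem_nhds ?_ ?_)
  · rw [Set.sdiff_empty]
    exact isOpen_lt (f := fun s : ℂ => |s.im|) (by fun_prop) (by fun_prop)
  · rw [Set.sdiff_empty, Set.mem_ofPred_eq]
    linarith

theorem graph_diffSum (φ τ : ℝ) (D : Submodule ℂ ((ℂ → ℂ) × (ℂ → ℂ))) :
    (diffSum φ τ D).graph = diffGraph φ τ D :=
  Submodule.toLinearPMap_graph_eq _ (diffGraph_singleValued φ τ D)

/-- The function `e^{πs} f₂(s)` is of the same type as `f₁`. -/
noncomputable def expMul (f : ℂ → ℂ) : ℂ → ℂ := fun s => Complex.exp (Real.pi * s) * f s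

theorem holomorphicOff_expMul {P : Set ℂ} {f : ℂ → ℂ} (hf : HolomorphicOff P f) :
    HolomorphicOff P (expMul f) :=
  hf.mul_entire (by fun_prop)

theorem HasSimplePoleResidue.expMul {f : ℂ → ℂ} {p r : ℂ} (h : HasSimplePoleResidue f p r) :
    HasSimplePoleResidue (expMul f) p (Complex.exp (Real.pi * p) * r) :=
  h.mul_analytic (u := fun s => Complex.exp (Real.pi * s)) (by fun_prop)

section Green

variable {φ τ : ℝ}

theorem inner_toL2 (f : pairsOff (poles τ)) (y : L2Sum) :
    ⟪toL2 τ f, y⟫_ℂ = (∫ t : ℝ, conj (f.1.1 t) * y.fst t)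
      + ∫ t : ℝ, conj (expMul f.1.2 t) * expSnd y t :=
  inner_L2Sum (u := restrict f.1.1) (v := restrict f.1.2)
    (memLp_pair (φ := 0) f.2).1.1.coeFn_toLp (memLp_pair (φ := 0) f.2).1.2.coeFn_toLp

theorem inner_diffToL2 (f : pairsOff (poles τ)) (y : L2Sum) :
    ⟪diffToL2 φ τ f, y⟫_ℂ = (∫ t : ℝ, conj (modOp 1 φ τ f.1.1 t) * y.fst t)
      + ∫ t : ℝ, conj (modOp (-1) φ τ (expMul f.1.2) t) * expSnd y t := by
  rw [inner_L2Sum (x := diffToL2 φ τ f) (u := restrict (diffOp φ τ f.1.1)) (v := restrict (diffOp φ τ f.1.2))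
    (memLp_pair (φ := φ) f.2).2.1.coeFn_toLp (memLp_pair (φ := φ) f.2).2.2.coeFn_toLp]
  simp only [restrict, exp_mul_diffOp]
  simp only [diffOp_eq_modOp]
  rfl

theorem toL2_fst (f : pairsOff (poles τ)) : (toL2 τ f).fst =ᵐ[volume] fun t : ℝ => f.1.1 t :=
  (memLp_pair (φ := 0) f.2).1.1.coeFn_toLp

theorem diffToL2_fst (f : pairsOff (poles τ)) :
    (diffToL2 φ τ f).fst =ᵐ[volume] fun t : ℝ => modOp 1 φ τ f.1.1 t := by
  rw [← diffOp_eq_modOp]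
  exact (memLp_pair (φ := φ) f.2).2.1.coeFn_toLp

theorem expSnd_toL2 (f : pairsOff (poles τ)) :
    expSnd (toL2 τ f) =ᵐ[volume] fun t : ℝ => expMul f.1.2 t := by
  refine (MemLp.coeFn_toLp _).trans ?_
  filter_upwards [ae_expMeasure.1 (memLp_pair (φ := 0) f.2).1.2.coeFn_toLp] with t ht
  exact congrArg (fun z => Complex.exp (Real.pi * t) * z) ht

theorem expSnd_diffToL2 (f : pairsOff (poles τ)) :
    expSnd (diffToL2 φ τ f) =ᵐ[volume] fun t : ℝ => modOp (-1) φ τ (expMul f.1.2) t := by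
  refine (MemLp.coeFn_toLp _).trans ?_
  filter_upwards [ae_expMeasure.1 (memLp_pair (φ := φ) f.2).2.2.coeFn_toLp] with t ht
  have e : modOp (-1) φ τ (expMul f.1.2) t = _ := (exp_mul_diffOp φ τ f.1.2 t).symm
  rw [e]
  exact congrArg (fun z => Complex.exp (Real.pi * t) * z) ht

/-- Green's formula for `𝓛 ⊕ 𝓛`. -/
theorem inner_diffToL2_sub (f g : pairsOff (poles τ)) {r₁ r₂ r₁' r₂' q₁ q₂ q₁' q₂' : ℂ}
    (hr₁ : HasSimplePoleResidue f.1.1 (Complex.I / 2) r₁)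
    (hr₂ : HasSimplePoleResidue f.1.2 (Complex.I / 2) r₂)
    (hr₁' : HasSimplePoleResidue f.1.1 (-Complex.I / 2 + 2 * τ) r₁')
    (hr₂' : HasSimplePoleResidue f.1.2 (-Complex.I / 2 + 2 * τ) r₂')
    (hq₁ : HasSimplePoleResidue g.1.1 (Complex.I / 2) q₁)
    (hq₂ : HasSimplePoleResidue g.1.2 (Complex.I / 2) q₂)
    (hq₁' : HasSimplePoleResidue g.1.1 (-Complex.I / 2 + 2 * τ) q₁')
    (hq₂' : HasSimplePoleResidue g.1.2 (-Complex.I / 2 + 2 * τ) q₂') :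
    ⟪diffToL2 φ τ f, toL2 τ g⟫_ℂ - ⟪toL2 τ f, diffToL2 φ τ g⟫_ℂ =
      2 * Real.pi * Complex.I * ((conj r₁ * q₁ - conj r₂ * q₂)
        - (conj r₁' * q₁' - Complex.exp (4 * Real.pi * τ) * (conj r₂' * q₂'))) := by
  have G1 := integral_modOp_sub 1 φ f.2.1 g.2.1 f.2.2.2.1 g.2.2.2.1 hr₁ hq₁ hr₁' hq₁'
  have G2 := integral_modOp_sub (-1) φ (holomorphicOff_expMul f.2.2.1)
    (holomorphicOff_expMul g.2.2.1) f.2.2.2.2 g.2.2.2.2 hr₂.expMul hq₂.expMul hr₂'.expMul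
    hq₂'.expMul
  have e1 : (∫ t : ℝ, conj (modOp 1 φ τ f.1.1 t) * (toL2 τ g).fst t)
      = ∫ t : ℝ, conj (modOp 1 φ τ f.1.1 t) * g.1.1 t := by
    refine integral_congr_ae ?_
    filter_upwards [toL2_fst g] with t ht
    exact congrArg _ ht
  have e2 : (∫ t : ℝ, conj (modOp (-1) φ τ (expMul f.1.2) t) * expSnd (toL2 τ g) t)
      = ∫ t : ℝ, conj (modOp (-1) φ τ (expMul f.1.2) t) * expMul g.1.2 t := by
    refine integral_congr_ae ?_
    filter_upwards [expSnd_toL2 g] with t ht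
    rw [ht]
  have e3 : (∫ t : ℝ, conj (f.1.1 t) * (diffToL2 φ τ g).fst t)
      = ∫ t : ℝ, conj (f.1.1 t) * modOp 1 φ τ g.1.1 t := by
    refine integral_congr_ae ?_
    filter_upwards [diffToL2_fst g] with t ht
    exact congrArg _ ht
  have e4 : (∫ t : ℝ, conj (expMul f.1.2 t) * expSnd (diffToL2 φ τ g) t)
      = ∫ t : ℝ, conj (expMul f.1.2 t) * modOp (-1) φ τ (expMul g.1.2) t := by
    refine integral_congr_ae ?_
    filter_upwards [expSnd_diffToL2 g] with t ht
    rw [ht]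
  -- The residues of `e^{πs} f₂` carry the factor `e^{πp}`, and only `|e^{πp}|²` enters the boundary
  -- form. It equals `1` at `i/2` and `e^{4πτ}` at `-i/2 + 2τ`.
  have x1 : conj (Complex.exp (Real.pi * (Complex.I / 2))) * Complex.exp (Real.pi * (Complex.I / 2))
      = 1 := by
    rw [← Complex.exp_conj, ← Complex.exp_add]
    simp [Complex.conj_ofNat, neg_div]
  have x2 : conj (Complex.exp (Real.pi * (-Complex.I / 2 + 2 * τ)))
      * Complex.exp (Real.pi * (-Complex.I / 2 + 2 * τ)) = Complex.exp (4 * Real.pi * τ) := by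
    rw [← Complex.exp_conj, ← Complex.exp_add]
    congr 1
    simp only [map_mul, map_add, map_div₀, map_neg, Complex.conj_ofReal, Complex.conj_I,
      Complex.conj_ofNat]
    ring
  rw [inner_diffToL2, inner_toL2, e1, e2, e3, e4]
  simp only [map_mul] at G2
  push_cast at G1 G2
  linear_combination G1 + G2 - 2 * Real.pi * Complex.I * (conj r₂ * q₂) * x1
    + 2 * Real.pi * Complex.I * (conj r₂' * q₂') * x2

theorem abs_im_lt_of_mem_poles {τ : ℝ} {p : ℂ} (hp : p ∈ poles τ) : |p.im| < 1 := by
  rcases hp with rfl | rfl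
  · simp; norm_num
  · simp [abs_lt]; norm_num

theorem domH_le_domHσ (τ σ : ℝ) : domH ≤ domHσ τ σ := fun f hf => by
  refine ⟨domH_le τ hf, ⟨0, 0, ?_, ?_, rfl⟩, ⟨0, 0, ?_, ?_, by simp⟩⟩
  · exact hf.1.hasSimplePoleResidue_zero (abs_im_lt_of_mem_poles (τ := τ) (.inl rfl))
  · exact hf.2.1.hasSimplePoleResidue_zero (abs_im_lt_of_mem_poles (τ := τ) (.inl rfl))
  · exact hf.1.hasSimplePoleResidue_zero (abs_im_lt_of_mem_poles (τ := τ) (.inr rfl))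
  · exact hf.2.1.hasSimplePoleResidue_zero (abs_im_lt_of_mem_poles (τ := τ) (.inr rfl))

/-- The residue relations cancel the boundary form at each pole separately: equal residues at `i/2`,
and at the other pole `|e^{2π(τ+iσ)}|² = e^{4πτ}`, which matches the weight there. This uses that
`σ` is real. -/
theorem graph_symmetric (σ : ℝ) : ∀ p ∈ (diffSum φ τ (domHσ τ σ)).graph,
    ∀ q ∈ (diffSum φ τ (domHσ τ σ)).graph, ⟪p.2, q.1⟫_ℂ = ⟪p.1, q.2⟫_ℂ := by
  rw [graph_diffSum]
  rintro _ ⟨f, hf, rfl⟩ _ ⟨g, hg, rfl⟩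
  obtain ⟨-, ⟨r₁, r₂, h1, h2, rfl⟩, ⟨r₁', r₂', h1', h2', rfl⟩⟩ := hf
  obtain ⟨-, ⟨q₁, q₂, k1, k2, rfl⟩, ⟨q₁', q₂', k1', k2', rfl⟩⟩ := hg
  have h := inner_diffToL2_sub (φ := φ) f g h1 h2 h1' h2' k1 k2 k1' k2'
  have x : conj (Complex.exp (2 * Real.pi * (τ + Complex.I * σ)))
      * Complex.exp (2 * Real.pi * (τ + Complex.I * σ)) = Complex.exp (4 * Real.pi * τ) := by
    rw [← Complex.exp_conj, ← Complex.exp_add]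
    congr 1
    simp only [map_mul, map_add, Complex.conj_ofReal, Complex.conj_I, Complex.conj_ofNat]
    ring
  refine sub_eq_zero.1 (h.trans ?_)
  simp only [map_mul, map_neg]
  linear_combination -2 * Real.pi * Complex.I * (conj r₂' * q₂') * x

theorem graph_domH_le (σ : ℝ) :
    (diffSum φ τ domH).graph ≤ (diffSum φ τ (domHσ τ σ)).graph := by
  rw [graph_diffSum, graph_diffSum]
  exact Submodule.map_mono (Submodule.comap_mono (domH_le_domHσ τ σ))

theorem isFormalAdjoint_of_graph {T : L2Sum →ₗ.[ℂ] L2Sum}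
    (h : ∀ p ∈ T.graph, ∀ q ∈ T.graph, ⟪p.2, q.1⟫_ℂ = ⟪p.1, q.2⟫_ℂ) : T.IsFormalAdjoint T :=
  fun x y => h _ (T.mem_graph x) _ (T.mem_graph y)

/-- Limits of elements of the graph on `𝓗` satisfy Green's formula without boundary terms. -/
theorem inner_eq_of_mem_closure {p : L2Sum × L2Sum}
    (hp : p ∈ (diffSum φ τ domH).graph.topologicalClosure) (g : pairsOff (poles τ))
    {q₁ q₂ q₁' q₂' : ℂ} (hq₁ : HasSimplePoleResidue g.1.1 (Complex.I / 2) q₁)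
    (hq₂ : HasSimplePoleResidue g.1.2 (Complex.I / 2) q₂)
    (hq₁' : HasSimplePoleResidue g.1.1 (-Complex.I / 2 + 2 * τ) q₁')
    (hq₂' : HasSimplePoleResidue g.1.2 (-Complex.I / 2 + 2 * τ) q₂') :
    ⟪p.2, toL2 τ g⟫_ℂ = ⟪p.1, diffToL2 φ τ g⟫_ℂ := by
  have hc : IsClosed {p : L2Sum × L2Sum | ⟪p.2, toL2 τ g⟫_ℂ = ⟪p.1, diffToL2 φ τ g⟫_ℂ} :=
    isClosed_eq (by fun_prop) (by fun_prop)
  refine closure_minimal ?_ hc hp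
  rw [graph_diffSum]
  rintro _ ⟨f, hf, rfl⟩
  have hf : f.1 ∈ domH := hf
  have h := inner_diffToL2_sub (φ := φ) f g
    (hf.1.hasSimplePoleResidue_zero (abs_im_lt_of_mem_poles (τ := τ) (.inl rfl)))
    (hf.2.1.hasSimplePoleResidue_zero (abs_im_lt_of_mem_poles (τ := τ) (.inl rfl)))
    (hf.1.hasSimplePoleResidue_zero (abs_im_lt_of_mem_poles (τ := τ) (.inr rfl)))
    (hf.2.1.hasSimplePoleResidue_zero (abs_im_lt_of_mem_poles (τ := τ) (.inr rfl))) hq₁ hq₂ hq₁' hq₂'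
  refine sub_eq_zero.1 (h.trans ?_)
  simp

end Green

/-! ### Fourier–Laplace transforms of test functions -/

/-- Smooth compactly supported functions on the line. -/
structure IsTest (ψ : ℝ → ℂ) : Prop where
  contDiff : ContDiff ℝ ∞ ψ
  hasCompactSupport : HasCompactSupport ψ

namespace IsTest

variable {ψ : ℝ → ℂ}

theorem isTest_deriv (h : IsTest ψ) : IsTest (deriv ψ) :=
  ⟨(contDiff_infty_iff_deriv.1 h.contDiff).2, h.hasCompactSupport.deriv⟩

theorem hasDerivAt (h : IsTest ψ) (t : ℝ) : HasDerivAt ψ (deriv ψ t) t :=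
  (h.contDiff.differentiable (by simp) t).hasDerivAt

theorem mul_left (h : IsTest ψ) {u : ℝ → ℂ} (hu : ContDiff ℝ ∞ u) :
    IsTest (fun t => u t * ψ t) :=
  ⟨hu.mul h.contDiff, h.hasCompactSupport.mul_left⟩

theorem integrable_mul (h : IsTest ψ) {u : ℝ → ℂ} (hu : Continuous u) :
    Integrable (fun t => ψ t * u t) :=
  (h.contDiff.continuous.mul hu).integrable_of_hasCompactSupport h.hasCompactSupport.mul_right

theorem integrable (h : IsTest ψ) : Integrable ψ :=
  h.contDiff.continuous.integrable_of_hasCompactSupport h.hasCompactSupport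

theorem memLp (h : IsTest ψ) : MemLp ψ 2 volume :=
  h.contDiff.continuous.memLp_of_hasCompactSupport h.hasCompactSupport

theorem integrable_kernel (h : IsTest ψ) (s : ℂ) :
    Integrable (fun t : ℝ => ψ t * Complex.exp (2 * Real.pi * Complex.I * s * t)) :=
  h.integrable_mul (by fun_prop)

theorem differentiable_fourierLaplace (h : IsTest ψ) : Differentiable ℂ (fourierLaplace ψ) := by
  intro s₀
  -- On the unit ball `|Im s| ≤ ‖s₀‖ + 1`, which bounds the exponential uniformly in `s`; compact
  -- support of `ψ` makes the bound integrable.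
  have hb : ∀ s ∈ Metric.ball s₀ 1, ∀ t : ℝ,
      ‖ψ t * (Complex.exp (2 * Real.pi * Complex.I * s * t) * (2 * Real.pi * Complex.I * t))‖ ≤
        ‖ψ t * ((Real.exp (2 * Real.pi * (‖s₀‖ + 1) * |t|) * (2 * Real.pi * |t|) : ℝ) : ℂ)‖ := by
    intro s hs t
    rw [norm_mul (ψ t), norm_mul (ψ t)]
    gcongr ‖ψ t‖ * ?_
    rw [Complex.norm_real, Real.norm_of_nonneg (by positivity), norm_mul, Complex.norm_exp]
    have hn : ‖s‖ ≤ ‖s₀‖ + 1 := by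
      have h1 := mem_ball_iff_norm.1 hs
      have h2 := norm_sub_norm_le s s₀
      linarith
    have him : |s.im| ≤ ‖s₀‖ + 1 := (Complex.abs_im_le_norm s).trans hn
    gcongr
    · have e : (2 * Real.pi * Complex.I * s * t).re = 2 * Real.pi * (-s.im * t) := by
        simp
        ring
      rw [e, mul_assoc (2 * Real.pi)]
      refine mul_le_mul_of_nonneg_left ?_ (by positivity)
      calc -s.im * t ≤ |-s.im * t| := le_abs_self _
        _ = |s.im| * |t| := by rw [abs_mul, abs_neg]
        _ ≤ _ := by gcongr
    · simp [abs_of_pos Real.pi_pos]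
  refine (hasDerivAt_integral_of_dominated_loc_of_deriv_le (Metric.ball_mem_nhds s₀ one_pos)
    (F' := fun s t => ψ t * (Complex.exp (2 * Real.pi * Complex.I * s * t)
      * (2 * Real.pi * Complex.I * t)))
    (Eventually.of_forall fun s => (h.integrable_kernel s).aestronglyMeasurable)
    (h.integrable_kernel s₀) (h.integrable_mul (by fun_prop)).aestronglyMeasurable
    (Eventually.of_forall fun t s hs => hb s hs t) (h.integrable_mul (by fun_prop)).norm
    (Eventually.of_forall fun t s _ => ?_)).2.differentiableAt
  refine HasDerivAt.const_mul _ (HasDerivAt.cexp ?_)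
  have := ((hasDerivAt_id s).const_mul (2 * Real.pi * Complex.I)).mul_const (t : ℂ)
  simpa using this

theorem fourierLaplace_deriv (h : IsTest ψ) (s : ℂ) :
    fourierLaplace (deriv ψ) s = -(2 * Real.pi * Complex.I * s) * fourierLaplace ψ s := by
  have hd : ∀ t : ℝ, HasDerivAt (fun t : ℝ => ψ t * Complex.exp (2 * Real.pi * Complex.I * s * t))
      (deriv ψ t * Complex.exp (2 * Real.pi * Complex.I * s * t)
        + (2 * Real.pi * Complex.I * s)
          * (ψ t * Complex.exp (2 * Real.pi * Complex.I * s * t))) t := by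
    intro t
    have h1 : HasDerivAt (fun t : ℝ => Complex.exp (2 * Real.pi * Complex.I * s * t))
        (Complex.exp (2 * Real.pi * Complex.I * s * t) * (2 * Real.pi * Complex.I * s)) t := by
      refine HasDerivAt.cexp ?_
      simpa using (Complex.ofRealCLM.hasDerivAt (x := t)).const_mul (2 * Real.pi * Complex.I * s)
    exact ((h.hasDerivAt t).mul h1).congr_deriv (by ring)
  have i1 := h.isTest_deriv.integrable_kernel s
  have i2 := (h.integrable_kernel s).const_mul (2 * Real.pi * Complex.I * s)
  have := integral_eq_zero_of_hasDerivAt_of_integrable hd (i1.add i2) (h.integrable_kernel s)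
  rw [integral_add i1 i2, integral_const_mul] at this
  rw [fourierLaplace, fourierLaplace]
  linear_combination this

theorem norm_fourierLaplace_le (h : IsTest ψ) {s : ℂ} (hs : |s.im| ≤ 1) :
    ‖fourierLaplace ψ s‖ ≤ ∫ t : ℝ, ‖ψ t * ((Real.exp (2 * Real.pi * |t|) : ℝ) : ℂ)‖ := by
  refine norm_integral_le_of_norm_le (h.integrable_mul (by fun_prop)).norm
    (Eventually.of_forall fun t => ?_)
  rw [norm_mul, norm_mul]
  gcongr
  rw [Complex.norm_real, Real.norm_of_nonneg (by positivity), Complex.norm_exp]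
  gcongr
  have e : (2 * Real.pi * Complex.I * s * t).re = 2 * Real.pi * (-s.im * t) := by
    simp
    ring
  rw [e]
  gcongr
  calc -s.im * t ≤ |-s.im * t| := le_abs_self _
    _ = |s.im| * |t| := by rw [abs_mul, abs_neg]
    _ ≤ 1 * |t| := by gcongr
    _ = |t| := one_mul _

theorem decays_fourierLaplace (h : IsTest ψ) : Decays (fourierLaplace ψ) := by
  refine ⟨1 / 2, by norm_num, ?_⟩
  have e : (-(3 / 2) - 1 / 2 : ℝ) = -(2 : ℕ) := by norm_num
  rw [e]
  set C := ∫ t : ℝ, ‖deriv (deriv ψ) t * ((Real.exp (2 * Real.pi * |t|) : ℝ) : ℂ)‖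
    with hC
  refine IsBigO.of_bound C ?_
  have hre : ∀ᶠ s : ℂ in stripInfty, 1 ≤ |s.re| :=
    (tendsto_comap.mono_left inf_le_left).eventually_ge_atTop 1
  have him : ∀ᶠ s : ℂ in stripInfty, |s.im| ≤ 1 :=
    eventually_inf_principal.2 (Eventually.of_forall fun s hs => hs)
  filter_upwards [hre, him] with s h1 h2
  have hb := h.isTest_deriv.isTest_deriv.norm_fourierLaplace_le h2
  rw [h.isTest_deriv.fourierLaplace_deriv, h.fourierLaplace_deriv, ← mul_assoc, norm_mul, ← hC] at hb
  have hs0 : 0 < |s.re| := by linarith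
  have hsn : |s.re| ^ 2 ≤ ‖-(2 * Real.pi * Complex.I * s) * -(2 * Real.pi * Complex.I * s)‖ := by
    have : ‖-(2 * Real.pi * Complex.I * s) * -(2 * Real.pi * Complex.I * s)‖
        = (2 * Real.pi * ‖s‖) ^ 2 := by
      rw [norm_mul, norm_neg]
      simp [abs_of_pos Real.pi_pos]
      ring
    rw [this]
    gcongr
    have h3 := Complex.abs_re_le_norm s
    nlinarith [Real.pi_gt_three, norm_nonneg s]
  rw [Real.rpow_neg hs0.le, Real.rpow_natCast, norm_inv, norm_pow, Real.norm_of_nonneg hs0.le,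
    ← div_eq_mul_inv, le_div_iff₀ (by positivity)]
  have := mul_le_mul_of_nonneg_right hsn (norm_nonneg (fourierLaplace ψ s))
  linarith

end IsTest

/-! ### Transform pairs and the action of shifts -/

theorem fourierLaplace_exp_mul (F : ℝ → ℂ) (a s : ℂ) :
    fourierLaplace (fun t => Complex.exp (2 * Real.pi * a * t) * F t) s =
      fourierLaplace F (s - Complex.I * a) := by
  refine integral_congr_ae (Eventually.of_forall fun t => ?_)
  simp only
  rw [mul_comm (Complex.exp _) (F t), mul_assoc, ← Complex.exp_add]
  congr 2
  linear_combination (2 * Real.pi * a * t) * Complex.I_mul_I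

/-- `f` is, on the real line, the Fourier transform of `F`, and `𝓛 f` that of `G`. -/
structure IsTransformPair (ε φ τ : ℝ) (f : ℂ → ℂ) (F G : ℝ → ℂ) : Prop where
  holomorphic : HolomorphicOff (poles τ) f
  decays : Decays f
  integrable_left : Integrable F
  memLp_left : MemLp F 2 volume
  integrable_right : Integrable G
  memLp_right : MemLp G 2 volume
  apply_eq : ∀ x : ℝ, f x = fourierLaplace F x
  modOp_eq : ∀ x : ℝ, modOp ε φ τ f x = fourierLaplace G x

theorem fourierLaplace_const_mul (a : ℂ) (F : ℝ → ℂ) (s : ℂ) :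
    fourierLaplace (fun t => a * F t) s = a * fourierLaplace F s := by
  simp only [fourierLaplace, mul_assoc]
  rw [integral_const_mul]

theorem integrable_fourierLaplace {F : ℝ → ℂ} (h : Integrable F) (x : ℝ) :
    Integrable fun t : ℝ => F t * Complex.exp (2 * Real.pi * Complex.I * x * t) := by
  refine h.mul_bdd (c := 1) (Continuous.aestronglyMeasurable (by fun_prop))
    (Eventually.of_forall fun t => ?_)
  rw [Complex.norm_exp]
  simp

theorem IsTransformPair.const_mul {ε φ τ : ℝ} {f : ℂ → ℂ} {F G : ℝ → ℂ}
    (h : IsTransformPair ε φ τ f F G) (a : ℂ) :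
    IsTransformPair ε φ τ (fun s => a * f s) (fun t => a * F t) (fun t => a * G t) where
  holomorphic := h.holomorphic.smul a
  decays := h.decays.smul a
  integrable_left := h.integrable_left.const_mul a
  memLp_left := h.memLp_left.const_mul a
  integrable_right := h.integrable_right.const_mul a
  memLp_right := h.memLp_right.const_mul a
  apply_eq x := by rw [h.apply_eq, fourierLaplace_const_mul]
  modOp_eq x := by
    rw [fourierLaplace_const_mul, ← h.modOp_eq]
    simp only [modOp]
    ring

/-- Plancherel's formula for `𝓛 f - ζ f`. -/
theorem IsTransformPair.integral_eq {ε φ τ : ℝ} {f : ℂ → ℂ} {F G : ℝ → ℂ}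
    (h : IsTransformPair ε φ τ f F G) (ζ : ℂ) (y : Lp ℂ 2 (volume : Measure ℝ)) :
    (∫ x : ℝ, conj (modOp ε φ τ f x) * y x) - conj ζ * ∫ x : ℝ, conj (f x) * y x =
      ∫ t, conj (G t - ζ * F t) * (𝓕 y : Lp ℂ 2 (volume : Measure ℝ)) t := by
  have m0 : MemLp (fun x : ℝ => f x) 2 volume := by
    simpa using memLp_shift h.holomorphic h.decays (z := 0) (by simp)
  rw [integral_conj_mul_fourier h.integrable_left h.memLp_left m0 h.apply_eq,
    integral_conj_mul_fourier h.integrable_right h.memLp_right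
      (memLp_modOp ε φ h.holomorphic h.decays) h.modOp_eq]
  rw [← integral_const_mul, ← integral_sub]
  · refine integral_congr_ae (Eventually.of_forall fun t => ?_)
    simp only [map_sub, map_mul]
    ring
  · exact integrable_conj_mul h.memLp_right (Lp.memLp _)
  · exact (integrable_conj_mul h.memLp_left (Lp.memLp _)).const_mul _

/-! ### The pairs of functions with given transforms -/

/-- The pair `(h₁, e^{-πs} h₂)`. -/
noncomputable def mkPair (h₁ h₂ : ℂ → ℂ) : (ℂ → ℂ) × (ℂ → ℂ) :=
  (h₁, fun s => Complex.exp (-Real.pi * s) * h₂ s)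

theorem expMul_mkPair (h₁ h₂ : ℂ → ℂ) : expMul (mkPair h₁ h₂).2 = h₂ := by
  funext s
  simp only [expMul, mkPair]
  rw [← mul_assoc, ← Complex.exp_add]
  simp

theorem mkPair_mem {P : Set ℂ} {h₁ h₂ : ℂ → ℂ} (k₁ : HolomorphicOff P h₁)
    (k₂ : HolomorphicOff P h₂) (d₁ : Decays h₁) (d₂ : Decays h₂) :
    mkPair h₁ h₂ ∈ pairsOff P := by
  refine ⟨k₁, k₂.mul_entire (u := fun s => Complex.exp (-Real.pi * s)) (by fun_prop), d₁, ?_⟩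
  have := expMul_mkPair h₁ h₂
  unfold expMul at this
  rwa [this]

theorem IsTransformPair.mkPair_mem {ε ε' φ τ : ℝ} {h₁ h₂ : ℂ → ℂ} {F₁ G₁ F₂ G₂ : ℝ → ℂ}
    (k₁ : IsTransformPair ε φ τ h₁ F₁ G₁) (k₂ : IsTransformPair ε' φ τ h₂ F₂ G₂) :
    mkPair h₁ h₂ ∈ pairsOff (poles τ) :=
  DiffSL.mkPair_mem k₁.holomorphic k₂.holomorphic k₁.decays k₂.decays

theorem inner_mkPair {φ τ : ℝ} {h₁ h₂ : ℂ → ℂ} {F₁ G₁ F₂ G₂ : ℝ → ℂ}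
    (k₁ : IsTransformPair 1 φ τ h₁ F₁ G₁) (k₂ : IsTransformPair (-1) φ τ h₂ F₂ G₂) (ζ : ℂ)
    (y : L2Sum) :
    ⟪diffToL2 φ τ ⟨_, k₁.mkPair_mem k₂⟩ - ζ • toL2 τ ⟨_, k₁.mkPair_mem k₂⟩, y⟫_ℂ =
      (∫ t, conj (G₁ t - ζ * F₁ t) * (𝓕 y.fst : Lp ℂ 2 (volume : Measure ℝ)) t)
      + ∫ t, conj (G₂ t - ζ * F₂ t) * (𝓕 (expSnd y) : Lp ℂ 2 (volume : Measure ℝ)) t := by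
  rw [inner_sub_left, inner_smul_left, inner_diffToL2, inner_toL2, ← k₁.integral_eq,
    ← k₂.integral_eq]
  simp only [expMul_mkPair]
  simp only [mkPair]
  ring

/-! ### The differential operator on the Fourier side -/

/-- The first order differential operator corresponding to the difference operator. -/
noncomputable def dualOp (ε φ τ : ℝ) (F : ℝ → ℂ) (t : ℝ) : ℂ :=
  Complex.I / (2 * Real.pi) * (2 * Real.cos φ + ε * (Complex.exp (2 * Real.pi * t)
      + Complex.exp (-2 * Real.pi * t))) * deriv F t
    + Complex.I * ε / 2 * (Complex.exp (2 * Real.pi * t) - Complex.exp (-2 * Real.pi * t)) * F t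
    - 2 * τ * (Real.cos φ + ε * Complex.exp (2 * Real.pi * t)) * F t

theorem fourierLaplace_add {F G : ℝ → ℂ} (hF : Integrable F) (hG : Integrable G) (x : ℝ) :
    fourierLaplace (fun t => F t + G t) x = fourierLaplace F x + fourierLaplace G x := by
  simp only [fourierLaplace, add_mul]
  exact integral_add (integrable_fourierLaplace hF x) (integrable_fourierLaplace hG x)

theorem IsTest.add {F G : ℝ → ℂ} (hF : IsTest F) (hG : IsTest G) : IsTest (fun t => F t + G t) :=
  ⟨hF.contDiff.add hG.contDiff, hF.hasCompactSupport.add hG.hasCompactSupport⟩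

theorem contDiff_cexp_mul (a : ℂ) : ContDiff ℝ ∞ fun t : ℝ => Complex.exp (a * t) :=
  (contDiff_const.mul Complex.ofRealCLM.contDiff).cexp

theorem IsTest.exp_mul {F : ℝ → ℂ} (hF : IsTest F) (a : ℂ) :
    IsTest (fun t => Complex.exp (a * t) * F t) :=
  hF.mul_left (contDiff_cexp_mul a)

theorem IsTest.const_mul {F : ℝ → ℂ} (hF : IsTest F) (a : ℂ) : IsTest (fun t => a * F t) :=
  hF.mul_left contDiff_const

/-- Multiplication by `2 cos φ + ε (e^{2πt} + e^{-2πt})` for test functions. -/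
theorem fourierLaplace_weight_mul (ε φ : ℝ) {F : ℝ → ℂ} (hF : IsTest F) (x : ℝ) :
    fourierLaplace (fun t => (2 * Real.cos φ + ε * (Complex.exp (2 * Real.pi * t)
      + Complex.exp (-2 * Real.pi * t))) * F t) x
      = 2 * Real.cos φ * fourierLaplace F x + ε * (fourierLaplace F (x - Complex.I)
        + fourierLaplace F (x + Complex.I)) := by
  have e : (fun t : ℝ => (2 * Real.cos φ + ε * (Complex.exp (2 * Real.pi * t)
      + Complex.exp (-2 * Real.pi * t))) * F t) =
      fun t : ℝ => 2 * Real.cos φ * F t + (ε * (Complex.exp (2 * Real.pi * 1 * t) * F t)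
        + ε * (Complex.exp (2 * Real.pi * (-1) * t) * F t)) := by
    funext t
    rw [mul_one, show (2 * Real.pi * (-1) : ℂ) = -2 * Real.pi by ring]
    ring
  have h1 := (hF.exp_mul (2 * Real.pi * 1)).const_mul ε
  have h2 := (hF.exp_mul (2 * Real.pi * (-1))).const_mul ε
  rw [e, fourierLaplace_add (hF.const_mul _).integrable (h1.add h2).integrable,
    fourierLaplace_add h1.integrable h2.integrable, fourierLaplace_const_mul,
    fourierLaplace_const_mul, fourierLaplace_const_mul, fourierLaplace_exp_mul,
    fourierLaplace_exp_mul]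
  ring_nf

/-- The derivative acts before the exponential factor, so `e^{-2πt} F'` corresponds to
multiplication by `s + i` at the shifted point. Writing `s + i/2 = (s + i) - i/2` and `s - 2τ - i/2
= (s - i) + i/2 - 2τ` separates the derivative from the zero-order terms of `dualOp`. -/
theorem IsTest.isTransformPair {F : ℝ → ℂ} (hF : IsTest F) (ε φ τ : ℝ) :
    IsTransformPair ε φ τ (fourierLaplace F) F (dualOp ε φ τ F) := by
  have e : dualOp ε φ τ F = fun t : ℝ =>
      Complex.I / (2 * Real.pi) * ((2 * Real.cos φ + ε * (Complex.exp (2 * Real.pi * t)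
        + Complex.exp (-2 * Real.pi * t))) * deriv F t)
      + ((Complex.I * ε / 2 - 2 * τ * ε) * (Complex.exp (2 * Real.pi * 1 * t) * F t)
        + (-(Complex.I * ε / 2) * (Complex.exp (2 * Real.pi * (-1) * t) * F t)
          + -(2 * τ * Real.cos φ) * F t)) := by
    funext t
    rw [mul_one, show (2 * Real.pi * (-1) : ℂ) = -2 * Real.pi by ring, dualOp]
    ring
  have h0 : IsTest fun t : ℝ => Complex.I / (2 * Real.pi) * ((2 * Real.cos φ
      + ε * (Complex.exp (2 * Real.pi * t) + Complex.exp (-2 * Real.pi * t))) * deriv F t) :=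
    (hF.isTest_deriv.mul_left (contDiff_const.add (contDiff_const.mul
      ((contDiff_cexp_mul _).add (contDiff_cexp_mul _))))).const_mul _
  have h1 := (hF.exp_mul (2 * Real.pi * 1)).const_mul (Complex.I * ε / 2 - 2 * τ * ε)
  have h2 := (hF.exp_mul (2 * Real.pi * (-1))).const_mul (-(Complex.I * ε / 2))
  have h3 := hF.const_mul (-(2 * τ * Real.cos φ))
  have hG : IsTest (dualOp ε φ τ F) := by
    rw [e]
    exact h0.add (h1.add (h2.add h3))
  refine ⟨⟨1, one_pos, hF.differentiable_fourierLaplace.differentiableOn⟩,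
    hF.decays_fourierLaplace, hF.integrable, hF.memLp, hG.integrable, hG.memLp, fun _ => rfl,
    fun x => ?_⟩
  rw [e, fourierLaplace_add h0.integrable (h1.add (h2.add h3)).integrable,
    fourierLaplace_add h1.integrable (h2.add h3).integrable,
    fourierLaplace_add h2.integrable h3.integrable, fourierLaplace_const_mul,
    fourierLaplace_const_mul, fourierLaplace_const_mul, fourierLaplace_const_mul,
    fourierLaplace_exp_mul, fourierLaplace_exp_mul, fourierLaplace_weight_mul _ _ hF.isTest_deriv,
    hF.fourierLaplace_deriv, hF.fourierLaplace_deriv, hF.fourierLaplace_deriv, modOp,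
    show (x : ℂ) - Complex.I * 1 = x - Complex.I by ring,
    show (x : ℂ) - Complex.I * (-1) = x + Complex.I by ring]
  have hpi : (Real.pi : ℂ) ≠ 0 := by exact_mod_cast Real.pi_ne_zero
  field_simp
  ring_nf
  have I3 : Complex.I ^ 3 = -Complex.I := by rw [pow_succ, Complex.I_sq, neg_one_mul]
  simp only [Complex.I_sq, I3]
  ring

/-! ### Functions whose transforms have a pole -/

/-- A smooth function equal to `1` for `η t ≤ 0` and to `0` for `η t ≥ 1`. -/
noncomputable def cutoff (η t : ℝ) : ℂ := (Real.smoothTransition (1 - η * t) : ℝ)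

theorem contDiff_cutoff (η : ℝ) : ContDiff ℝ ∞ (cutoff η) :=
  Complex.ofRealCLM.contDiff.comp (Real.smoothTransition.contDiff.comp
    (contDiff_const.sub (contDiff_const.mul contDiff_id)))

theorem cutoff_eq_one {η t : ℝ} (h : η * t ≤ 0) : cutoff η t = 1 := by
  rw [cutoff, Real.smoothTransition.one_of_one_le (by linarith), Complex.ofReal_one]

theorem cutoff_eq_zero {η t : ℝ} (h : 1 ≤ η * t) : cutoff η t = 0 := by
  rw [cutoff, Real.smoothTransition.zero_of_nonpos (by linarith), Complex.ofReal_zero]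

theorem norm_cutoff_le (η t : ℝ) : ‖cutoff η t‖ ≤ 1 := by
  rw [cutoff, Complex.norm_real, Real.norm_of_nonneg (Real.smoothTransition.nonneg _)]
  exact Real.smoothTransition.le_one _

theorem hasDerivAt_cutoff (η t : ℝ) : HasDerivAt (cutoff η) (deriv (cutoff η) t) t :=
  ((contDiff_cutoff η).differentiable (by simp) t).hasDerivAt

theorem isTest_deriv_cutoff {η : ℝ} (hη : η = 1 ∨ η = -1) : IsTest (deriv (cutoff η)) := by
  refine ⟨(contDiff_infty_iff_deriv.1 (contDiff_cutoff η)).2,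
    HasCompactSupport.intro (isCompact_Icc (a := -1) (b := 1)) fun t ht => ?_⟩
  have hc : Continuous fun t : ℝ => η * t := by fun_prop
  have h : η * t < 0 ∨ 1 < η * t := by
    rw [Set.mem_Icc, not_and_or, not_le, not_le] at ht
    rcases hη with rfl | rfl <;> rcases ht with ht | ht
    · left; linarith
    · right; linarith
    · right; linarith
    · left; linarith
  rcases h with h | h
  · have e : cutoff η =ᶠ[𝓝 t] fun _ => 1 := by
      filter_upwards [(isOpen_Iio.preimage hc).mem_nhds h] with u hu
      exact cutoff_eq_one (le_of_lt hu)
    rw [e.deriv_eq, deriv_const]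
  · have e : cutoff η =ᶠ[𝓝 t] fun _ => 0 := by
      filter_upwards [(isOpen_Ioi.preimage hc).mem_nhds h] with u hu
      exact cutoff_eq_zero (le_of_lt hu)
    rw [e.deriv_eq, deriv_const]

theorem tendsto_of_eventually_zero_or {η : ℝ} {l l' : Filter ℝ} {f : ℝ → ℂ} {a b : ℂ}
    (hη : (η = 1 ∧ l = atBot ∧ l' = atTop) ∨ (η = -1 ∧ l = atTop ∧ l' = atBot))
    (h0 : ∀ t, η * t ≤ 0 → f t = a) (h1 : ∀ t, 1 ≤ η * t → f t = b) :
    Tendsto f l (𝓝 a) ∧ Tendsto f l' (𝓝 b) := by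
  rcases hη with ⟨rfl, rfl, rfl⟩ | ⟨rfl, rfl, rfl⟩
  · refine ⟨tendsto_const_nhds.congr' ?_, tendsto_const_nhds.congr' ?_⟩
    · filter_upwards [eventually_le_atBot 0] with t ht
      exact (h0 t (by linarith)).symm
    · filter_upwards [eventually_ge_atTop 1] with t ht
      exact (h1 t (by linarith)).symm
  · refine ⟨tendsto_const_nhds.congr' ?_, tendsto_const_nhds.congr' ?_⟩
    · filter_upwards [eventually_ge_atTop 0] with t ht
      exact (h0 t (by linarith)).symm
    · filter_upwards [eventually_le_atBot (-1)] with t ht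
      exact (h1 t (by linarith)).symm

theorem integral_deriv_cutoff {η : ℝ} (hη : η = 1 ∨ η = -1) : ∫ t, deriv (cutoff η) t = -η := by
  rcases hη with rfl | rfl
  · have h := tendsto_of_eventually_zero_or (f := cutoff 1) (Or.inl ⟨rfl, rfl, rfl⟩)
      (fun t => cutoff_eq_one) (fun t => cutoff_eq_zero)
    rw [integral_of_hasDerivAt_of_tendsto (hasDerivAt_cutoff 1)
      (isTest_deriv_cutoff (.inl rfl)).integrable h.1 h.2]
    simp
  · have h := tendsto_of_eventually_zero_or (f := cutoff (-1)) (Or.inr ⟨rfl, rfl, rfl⟩)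
      (fun t => cutoff_eq_one) (fun t => cutoff_eq_zero)
    rw [integral_of_hasDerivAt_of_tendsto (hasDerivAt_cutoff (-1))
      (isTest_deriv_cutoff (.inr rfl)).integrable h.2 h.1]
    simp

/-- The pole `i/2` for `η = 1` and `-i/2 + 2τ` for `η = -1`. -/
noncomputable def edgePole (η τ : ℝ) : ℂ := η * Complex.I / 2 + (1 - η) * τ

theorem edgePole_one (τ : ℝ) : edgePole 1 τ = Complex.I / 2 := by simp [edgePole]

theorem edgePole_neg_one (τ : ℝ) : edgePole (-1) τ = -Complex.I / 2 + 2 * τ := by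
  rw [edgePole]
  push_cast
  ring

theorem edgePole_mem {η : ℝ} (hη : η = 1 ∨ η = -1) (τ : ℝ) : edgePole η τ ∈ poles τ := by
  rcases hη with rfl | rfl
  · exact .inl (edgePole_one τ)
  · exact .inr (edgePole_neg_one τ)

theorem edgePole_im (η τ : ℝ) : (edgePole η τ).im = η / 2 := by
  simp [edgePole]

/-- A function on the line whose transform has a simple pole at `edgePole η τ`. -/
noncomputable def edgeFun (η τ t : ℝ) : ℂ :=
  cutoff η t * Complex.exp (-(2 * Real.pi * Complex.I * edgePole η τ) * t)

/-- The compactly supported right-hand side in `F' + 2πi p F = edgeSrc` for `F = edgeFun η τ` and `p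
= edgePole η τ`. Dividing its entire transform by `s - p` produces the pole. -/
noncomputable def edgeSrc (η τ t : ℝ) : ℂ :=
  Complex.exp (-(2 * Real.pi * Complex.I * edgePole η τ) * t) * deriv (cutoff η) t

/-- The transform of `edgeFun η τ`. -/
noncomputable def edgeTransform (η τ : ℝ) (s : ℂ) : ℂ :=
  Complex.I / (2 * Real.pi) * (fourierLaplace (edgeSrc η τ) s / (s - edgePole η τ))

theorem isTest_edgeSrc {η : ℝ} (hη : η = 1 ∨ η = -1) (τ : ℝ) : IsTest (edgeSrc η τ) :=
  (isTest_deriv_cutoff hη).exp_mul _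

theorem contDiff_edgeFun (η τ : ℝ) : ContDiff ℝ ∞ (edgeFun η τ) :=
  (contDiff_cutoff η).mul (contDiff_cexp_mul _)

theorem hasDerivAt_cexp_mul (a : ℂ) (t : ℝ) :
    HasDerivAt (fun t : ℝ => Complex.exp (a * t)) (a * Complex.exp (a * t)) t := by
  have h : HasDerivAt (fun t : ℝ => Complex.exp (a * t)) (Complex.exp (a * t) * a) t := by
    refine HasDerivAt.cexp ?_
    simpa using (Complex.ofRealCLM.hasDerivAt (x := t)).const_mul a
  exact h.congr_deriv (mul_comm _ _)

theorem hasDerivAt_edgeFun (η τ t : ℝ) : HasDerivAt (edgeFun η τ)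
    (edgeSrc η τ t - 2 * Real.pi * Complex.I * edgePole η τ * edgeFun η τ t) t := by
  refine ((hasDerivAt_cutoff η t).mul
    (hasDerivAt_cexp_mul (-(2 * Real.pi * Complex.I * edgePole η τ)) t)).congr_deriv ?_
  rw [edgeSrc, edgeFun]
  ring

theorem exp_neg_pi_mul_le {u : ℝ} (hu : 0 ≤ u) : Real.exp (-(Real.pi * u)) ≤ (1 + u ^ 2)⁻¹ := by
  rw [Real.exp_neg]
  have h1 : 1 + u ≤ Real.exp u := by linarith [Real.add_one_le_exp u]
  have h2 : Real.exp (u + u) ≤ Real.exp (Real.pi * u) := by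
    gcongr
    nlinarith [Real.pi_gt_three]
  rw [Real.exp_add] at h2
  gcongr
  nlinarith [Real.exp_pos u]

/-- Where the cutoff is `1`, that is for `ηt ≤ 0`, the modulus of `edgeFun` is `e^{πηt}`, and
multiplying by `e^{2πηmt}` with `m ≥ 0` only improves the decay. The opposite exponential
`e^{-2πηt}` would destroy integrability; `dualOp_edgeFun` shows that it does not occur with
`edgeFun`. -/
theorem norm_exp_mul_edgeFun_le {η : ℝ} (hη : η = 1 ∨ η = -1) (τ t : ℝ) {m : ℝ} (hm : 0 ≤ m)
    (hm' : m ≤ 1) : ‖Complex.exp (2 * Real.pi * (η * m : ℝ) * t) * edgeFun η τ t‖ ≤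
      Real.exp (4 * Real.pi) * (1 + t ^ 2)⁻¹ := by
  have hexp : ‖Complex.exp (2 * Real.pi * (η * m : ℝ) * t)‖
      * ‖Complex.exp (-(2 * Real.pi * Complex.I * edgePole η τ) * t)‖
      = Real.exp (Real.pi * (1 + 2 * m) * (η * t)) := by
    rw [Complex.norm_exp, Complex.norm_exp, ← Real.exp_add]
    congr 1
    have e1 : (2 * Real.pi * (η * m : ℝ) * t : ℂ) = ((2 * Real.pi * (η * m) * t : ℝ) : ℂ) := by
      push_cast; ring
    have e2 : (-(2 * Real.pi * Complex.I * edgePole η τ) * t).re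
        = 2 * Real.pi * (edgePole η τ).im * t := by simp
    rw [e1, e2, Complex.ofReal_re, edgePole_im]
    ring
  have ht2 : (η * t) ^ 2 = t ^ 2 := by rcases hη with rfl | rfl <;> ring
  rw [edgeFun, norm_mul, norm_mul, mul_left_comm, hexp]
  have hpi := Real.pi_pos
  rcases le_total 1 (η * t) with h | h
  · rw [cutoff_eq_zero h, norm_zero, zero_mul]
    positivity
  · refine (mul_le_of_le_one_left (Real.exp_pos _).le (norm_cutoff_le η t)).trans ?_
    rcases le_total (η * t) 0 with h0 | h0
    · have h1 := exp_neg_pi_mul_le (u := -(η * t)) (by linarith)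
      rw [neg_sq, ht2] at h1
      calc Real.exp (Real.pi * (1 + 2 * m) * (η * t)) ≤ Real.exp (-(Real.pi * -(η * t))) := by
            gcongr
            nlinarith [mul_nonneg hpi.le hm, mul_nonneg (mul_nonneg hpi.le hm) (neg_nonneg.2 h0)]
        _ ≤ 1 * (1 + t ^ 2)⁻¹ := by rwa [one_mul]
        _ ≤ _ := by gcongr; exact Real.one_le_exp (by positivity)
    -- On the transition interval the exponential is at most `e^{3π}`. One further factor `e^π ≥ 2`
    -- pays for `(1 + t²)⁻¹ ≥ 1/2`, whence the constant `e^{4π}`.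
    · have ht1 : t ^ 2 ≤ 1 := by rw [← ht2]; exact pow_le_one₀ h0 h
      have h2 : (2 : ℝ)⁻¹ ≤ (1 + t ^ 2)⁻¹ := by gcongr; linarith
      have h3 : Real.exp (Real.pi * (1 + 2 * m) * (η * t)) ≤ Real.exp (3 * Real.pi) := by
        refine Real.exp_le_exp.2 ?_
        calc Real.pi * (1 + 2 * m) * (η * t) ≤ Real.pi * (1 + 2 * m) * 1 := by gcongr
          _ ≤ 3 * Real.pi := by nlinarith
      have h4 : (2 : ℝ) ≤ Real.exp Real.pi := by
        linarith [Real.add_one_le_exp Real.pi, Real.pi_gt_three]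
      have h5 : Real.exp (4 * Real.pi) = Real.exp (3 * Real.pi) * Real.exp Real.pi := by
        rw [← Real.exp_add]; ring_nf
      rw [h5]
      calc _ ≤ Real.exp (3 * Real.pi) * (2 * 2⁻¹) := by linarith
        _ ≤ Real.exp (3 * Real.pi) * (Real.exp Real.pi * (1 + t ^ 2)⁻¹) := by gcongr
        _ = _ := by ring

theorem integrable_and_memLp_of_le {F : ℝ → ℂ} (hF : Continuous F) {C : ℝ}
    (h : ∀ t, ‖F t‖ ≤ C * (1 + t ^ 2)⁻¹) : Integrable F ∧ MemLp F 2 volume := by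
  refine ⟨(integrable_inv_one_add_sq.const_mul C).mono' hF.aestronglyMeasurable
    (Eventually.of_forall h), ?_⟩
  rw [memLp_two_iff_integrable_sq_norm hF.aestronglyMeasurable]
  refine (integrable_inv_one_add_sq.const_mul (C ^ 2)).mono'
    (hF.norm.pow 2).aestronglyMeasurable (Eventually.of_forall fun t => ?_)
  rw [norm_pow, norm_norm]
  have h1 : (1 + t ^ 2)⁻¹ ≤ 1 := inv_le_one_of_one_le₀ (by nlinarith [sq_nonneg t])
  have h2 : 0 ≤ (1 + t ^ 2)⁻¹ := by positivity
  calc ‖F t‖ ^ 2 ≤ (C * (1 + t ^ 2)⁻¹) ^ 2 := by gcongr; exact h t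
    _ = C ^ 2 * ((1 + t ^ 2)⁻¹ * (1 + t ^ 2)⁻¹) := by ring
    _ ≤ C ^ 2 * ((1 + t ^ 2)⁻¹ * 1) := by gcongr
    _ = _ := by rw [mul_one]

theorem exp_mul_edgeFun_integrable {η : ℝ} (hη : η = 1 ∨ η = -1) (τ : ℝ) {m : ℝ} (hm : 0 ≤ m)
    (hm' : m ≤ 1) :
    Integrable (fun t : ℝ => Complex.exp (2 * Real.pi * (η * m : ℝ) * t) * edgeFun η τ t) ∧
    MemLp (fun t : ℝ => Complex.exp (2 * Real.pi * (η * m : ℝ) * t) * edgeFun η τ t) 2 volume :=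
  integrable_and_memLp_of_le
    (Continuous.mul (by fun_prop) (contDiff_edgeFun η τ).continuous)
    fun t => norm_exp_mul_edgeFun_le hη τ t hm hm'

/-- Integration by parts in the first-order equation of `edgeFun`. Integrability of the integrand
suffices, so the boundary terms need no separate treatment. -/
theorem fourierLaplace_edgeFun {η : ℝ} (hη : η = 1 ∨ η = -1) (τ : ℝ) {s : ℂ}
    (hs : s ≠ edgePole η τ)
    (hi : Integrable fun t : ℝ => edgeFun η τ t * Complex.exp (2 * Real.pi * Complex.I * s * t)) :
    fourierLaplace (edgeFun η τ) s = edgeTransform η τ s := by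
  have hd : ∀ t : ℝ, HasDerivAt
      (fun t : ℝ => edgeFun η τ t * Complex.exp (2 * Real.pi * Complex.I * s * t))
      (edgeSrc η τ t * Complex.exp (2 * Real.pi * Complex.I * s * t)
        + 2 * Real.pi * Complex.I * (s - edgePole η τ)
          * (edgeFun η τ t * Complex.exp (2 * Real.pi * Complex.I * s * t))) t := fun t =>
    ((hasDerivAt_edgeFun η τ t).mul (hasDerivAt_cexp_mul _ t)).congr_deriv (by ring)
  have i1 := (isTest_edgeSrc hη τ).integrable_kernel s
  have i2 := hi.const_mul (2 * Real.pi * Complex.I * (s - edgePole η τ))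
  have h := integral_eq_zero_of_hasDerivAt_of_integrable hd (i1.add i2) hi
  rw [integral_add i1 i2, integral_const_mul] at h
  have hsp : s - edgePole η τ ≠ 0 := sub_ne_zero.2 hs
  have hpi : (Real.pi : ℂ) ≠ 0 := by exact_mod_cast Real.pi_ne_zero
  change fourierLaplace (edgeSrc η τ) s
    + 2 * Real.pi * Complex.I * (s - edgePole η τ) * fourierLaplace (edgeFun η τ) s = 0 at h
  rw [edgeTransform]
  field_simp
  linear_combination -Complex.I * h
    + 2 * Real.pi * (s - edgePole η τ) * fourierLaplace (edgeFun η τ) s * Complex.I_mul_I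

theorem fourierLaplace_exp_mul_edgeFun {η : ℝ} (hη : η = 1 ∨ η = -1) (τ x : ℝ) {m : ℝ}
    (hm : m = 0 ∨ m = 1) :
    fourierLaplace (fun t : ℝ => Complex.exp (2 * Real.pi * (η * m : ℝ) * t) * edgeFun η τ t) x
      = edgeTransform η τ (x - Complex.I * (η * m : ℝ)) := by
  rw [fourierLaplace_exp_mul]
  apply fourierLaplace_edgeFun hη
  · intro h
    have := congrArg Complex.im h
    rw [edgePole_im] at this
    rcases hη with rfl | rfl <;> rcases hm with rfl | rfl <;> norm_num at this
  · refine (integrable_fourierLaplace (exp_mul_edgeFun_integrable hη τ (m := m)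
      (by rcases hm with rfl | rfl <;> norm_num)
      (by rcases hm with rfl | rfl <;> norm_num)).1 x).congr (Eventually.of_forall fun t => ?_)
    simp only
    rw [mul_comm (Complex.exp _) (edgeFun η τ t), mul_assoc, ← Complex.exp_add]
    congr 2
    linear_combination (2 * Real.pi * (η * m : ℝ) * t) * Complex.I_mul_I

/-- The pole is placed so that the coefficient of the growing factor `e^{-2πηt}` cancels: `ε(p -
i/2) = 0` for `η = 1`, and `ε(p + i/2 - 2τ) = 0` for `η = -1`. What remains is integrable and square
integrable, although the individual terms of `dualOp` need not be. -/
theorem dualOp_edgeFun {η : ℝ} (hη : η = 1 ∨ η = -1) (ε φ τ t : ℝ) :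
    dualOp ε φ τ (edgeFun η τ) t =
      Complex.I / (2 * Real.pi) * ((2 * Real.cos φ + ε * (Complex.exp (2 * Real.pi * t)
        + Complex.exp (-2 * Real.pi * t))) * edgeSrc η τ t)
      + (η * (Complex.I - 2 * τ) * Real.cos φ
          * (Complex.exp (2 * Real.pi * (η * 0 : ℝ) * t) * edgeFun η τ t)
        + η * (Complex.I - 2 * τ) * ε
          * (Complex.exp (2 * Real.pi * (η * 1 : ℝ) * t) * edgeFun η τ t)) := by
  rw [dualOp, (hasDerivAt_edgeFun η τ t).deriv]
  have hpi : (Real.pi : ℂ) ≠ 0 := by exact_mod_cast Real.pi_ne_zero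
  rcases hη with rfl | rfl
  · simp only [edgePole_one, mul_zero, Complex.ofReal_zero, zero_mul, Complex.exp_zero, mul_one,
      Complex.ofReal_one, one_mul]
    field_simp
    ring_nf
    have I3 : Complex.I ^ 3 = -Complex.I := by rw [pow_succ, Complex.I_sq, neg_one_mul]
    simp only [I3]
    ring
  · simp only [edgePole_neg_one, mul_zero, Complex.ofReal_zero, zero_mul, Complex.exp_zero, mul_one,
      Complex.ofReal_neg, Complex.ofReal_one, one_mul,
      show (2 * Real.pi * (-1) : ℂ) = -2 * Real.pi by ring]
    field_simp
    ring_nf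
    have I3 : Complex.I ^ 3 = -Complex.I := by rw [pow_succ, Complex.I_sq, neg_one_mul]
    simp only [Complex.I_sq, I3]
    ring

theorem isBigO_edgeTransform {η : ℝ} (hη : η = 1 ∨ η = -1) (τ : ℝ) :
    Decays (edgeTransform η τ) := by
  obtain ⟨ε, hε, h⟩ := (isTest_edgeSrc hη τ).decays_fourierLaplace
  refine ⟨ε, hε, (IsBigO.trans ?_ h).const_mul_left _⟩
  refine IsBigO.of_bound 1 ?_
  have hre : ∀ᶠ s : ℂ in stripInfty, 1 + |(edgePole η τ).re| ≤ |s.re| :=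
    (tendsto_comap.mono_left inf_le_left).eventually_ge_atTop _
  filter_upwards [hre] with s hs
  rw [norm_div, one_mul]
  refine div_le_self (norm_nonneg _) ?_
  have h1 := Complex.abs_re_le_norm (s - edgePole η τ)
  have h2 := abs_sub_abs_le_abs_sub s.re (edgePole η τ).re
  rw [Complex.sub_re] at h1
  linarith

theorem isTransformPair_edge {η : ℝ} (hη : η = 1 ∨ η = -1) (ε φ τ : ℝ) :
    IsTransformPair ε φ τ (edgeTransform η τ) (edgeFun η τ) (dualOp ε φ τ (edgeFun η τ)) := by
  have hsrc := isTest_edgeSrc hη τ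
  have m0 := exp_mul_edgeFun_integrable hη τ (m := 0) le_rfl zero_le_one
  have m1 := exp_mul_edgeFun_integrable hη τ (m := 1) zero_le_one le_rfl
  have h0 : IsTest fun t : ℝ => Complex.I / (2 * Real.pi) * ((2 * Real.cos φ
      + ε * (Complex.exp (2 * Real.pi * t) + Complex.exp (-2 * Real.pi * t))) * edgeSrc η τ t) :=
    (hsrc.mul_left (contDiff_const.add (contDiff_const.mul
      ((contDiff_cexp_mul _).add (contDiff_cexp_mul _))))).const_mul _
  have c0 := m0.1.const_mul (η * (Complex.I - 2 * τ) * Real.cos φ)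
  have c1 := m1.1.const_mul (η * (Complex.I - 2 * τ) * ε)
  have d0 := m0.2.const_mul (η * (Complex.I - 2 * τ) * Real.cos φ)
  have d1 := m1.2.const_mul (η * (Complex.I - 2 * τ) * ε)
  have c01 : Integrable fun t : ℝ => η * (Complex.I - 2 * τ) * Real.cos φ
      * (Complex.exp (2 * Real.pi * (η * 0 : ℝ) * t) * edgeFun η τ t)
      + η * (Complex.I - 2 * τ) * ε
      * (Complex.exp (2 * Real.pi * (η * 1 : ℝ) * t) * edgeFun η τ t) := c0.add c1
  have e := funext (dualOp_edgeFun hη ε φ τ)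
  have e0 : (fun t : ℝ => Complex.exp (2 * Real.pi * (η * 0 : ℝ) * t) * edgeFun η τ t)
      = edgeFun η τ := by
    funext t
    simp
  refine ⟨⟨1, one_pos, fun s hs => ?_⟩, isBigO_edgeTransform hη τ, e0 ▸ m0.1, e0 ▸ m0.2,
    e ▸ h0.integrable.add (c0.add c1), e ▸ h0.memLp.add (d0.add d1), fun x => ?_, fun x => ?_⟩
  · have hsp : s - edgePole η τ ≠ 0 := sub_ne_zero.2 fun h => hs.2 (h ▸ edgePole_mem hη τ)
    have hsub : DifferentiableAt ℂ (fun s => s - edgePole η τ) s := by fun_prop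
    exact ((hsrc.differentiable_fourierLaplace.differentiableAt.fun_div hsub hsp).const_mul
      _).differentiableWithinAt
  · have := fourierLaplace_exp_mul_edgeFun hη τ x (m := 0) (.inl rfl)
    rw [e0] at this
    rw [this]
    simp
  · rw [e, fourierLaplace_add h0.integrable c01, fourierLaplace_add c0 c1,
      fourierLaplace_const_mul, fourierLaplace_const_mul, fourierLaplace_const_mul,
      fourierLaplace_weight_mul _ _ hsrc, fourierLaplace_exp_mul_edgeFun hη τ x (.inl rfl),
      fourierLaplace_exp_mul_edgeFun hη τ x (.inr rfl)]
    have hpi : (Real.pi : ℂ) ≠ 0 := by exact_mod_cast Real.pi_ne_zero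
    -- Both sides are compared on the three lines `Im s = 0, ±1`, which avoid the poles. There the
    -- transform of the source is `s - p` times that of `edgeFun`, and the identity becomes linear
    -- in the three values.
    have key : ∀ s : ℂ, (s.im = 0 ∨ s.im = 1 ∨ s.im = -1) →
        Complex.I / (2 * Real.pi) * fourierLaplace (edgeSrc η τ) s
          = (s - edgePole η τ) * edgeTransform η τ s := by
      intro s hs
      have hsp : s - edgePole η τ ≠ 0 := sub_ne_zero.2 fun h =>
        notMem_poles hs (h ▸ edgePole_mem hη τ)
      rw [edgeTransform]
      field_simp
    have k0 := key x (by simp)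
    have k1 := key (x + Complex.I) (by simp)
    have k2 := key (x - Complex.I) (by simp)
    rw [modOp]
    rcases hη with rfl | rfl
    · simp only [edgePole_one, mul_zero, Complex.ofReal_zero, sub_zero, mul_one,
        Complex.ofReal_one] at k0 k1 k2 ⊢
      linear_combination -2 * Real.cos φ * k0 - ε * k1 - ε * k2
    · simp only [edgePole_neg_one, mul_zero, Complex.ofReal_zero, sub_zero, mul_one,
        Complex.ofReal_neg, Complex.ofReal_one, mul_neg, sub_neg_eq_add] at k0 k1 k2 ⊢
      linear_combination -2 * Real.cos φ * k0 - ε * k1 - ε * k2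

/-- At the pole the exponentials in the transform of `edgeSrc` cancel, and its value is the integral
of the derivative of the cutoff, namely `-η`. -/
theorem hasSimplePoleResidue_edge {η : ℝ} (hη : η = 1 ∨ η = -1) (τ : ℝ) :
    HasSimplePoleResidue (edgeTransform η τ) (edgePole η τ) (-η * Complex.I / (2 * Real.pi)) := by
  have h1 : HasSimplePoleResidue (fun s => 1 / (s - edgePole η τ)) (edgePole η τ) 1 :=
    ⟨0, analyticAt_const, by simp⟩
  have ha : AnalyticAt ℂ (fun s => Complex.I / (2 * Real.pi) * fourierLaplace (edgeSrc η τ) s)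
      (edgePole η τ) :=
    analyticAt_const.mul ((isTest_edgeSrc hη τ).differentiable_fourierLaplace.analyticAt _)
  convert h1.mul_analytic ha using 1
  · funext s
    rw [edgeTransform]
    ring
  · have e : fourierLaplace (edgeSrc η τ) (edgePole η τ) = -η := by
      rw [← integral_deriv_cutoff hη, fourierLaplace]
      refine integral_congr_ae (Eventually.of_forall fun t => ?_)
      simp only [edgeSrc]
      rw [mul_right_comm, ← Complex.exp_add]
      simp
    rw [e]
    ring

theorem hasSimplePoleResidue_edge_zero {η : ℝ} (hη : η = 1 ∨ η = -1) (τ : ℝ) {p : ℂ}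
    (hp : p ≠ edgePole η τ) : HasSimplePoleResidue (edgeTransform η τ) p 0 := by
  refine ⟨edgeTransform η τ, ?_, by simp⟩
  exact analyticAt_const.mul (((isTest_edgeSrc hη τ).differentiable_fourierLaplace.analyticAt _).div
    (by fun_prop) (sub_ne_zero.2 hp))

/-! ### Weak solutions -/

/-- A test function of zero mean has a primitive which is a test function. -/
theorem IsTest.exists_primitive {u : ℝ → ℂ} (hu : IsTest u) (h0 : ∫ t, u t = 0) :
    ∃ v, IsTest v ∧ deriv v = u := by
  obtain ⟨R, hR⟩ := hu.hasCompactSupport.isCompact.isBounded.subset_closedBall 0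
  have hz : ∀ t, R < |t| → u t = 0 := fun t ht => by
    by_contra h
    have := hR (subset_tsupport u h)
    rw [mem_closedBall_zero_iff, Real.norm_eq_abs] at this
    linarith
  have hc := hu.contDiff.continuous
  have hd : ∀ t, HasDerivAt (fun t => ∫ x in (-|R|)..t, u x) (u t) t := fun t =>
    intervalIntegral.integral_hasDerivAt_right (hc.intervalIntegrable _ _)
      hc.stronglyMeasurable.stronglyMeasurableAtFilter hc.continuousAt
  have hderiv : deriv (fun t => ∫ x in (-|R|)..t, u x) = u := funext fun t => (hd t).deriv
  refine ⟨fun t => ∫ x in (-|R|)..t, u x, ⟨?_, ?_⟩, hderiv⟩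
  · rw [contDiff_infty_iff_deriv, hderiv]
    exact ⟨fun t => (hd t).differentiableAt, hu.contDiff⟩
  · refine HasCompactSupport.intro (isCompact_Icc (a := -|R|) (b := |R|)) fun t ht => ?_
    rw [Set.mem_Icc, not_and_or, not_le, not_le] at ht
    rcases ht with ht | ht
    · rw [intervalIntegral.integral_symm, neg_eq_zero]
      refine (intervalIntegral.integral_congr (g := fun _ => 0) fun x hx => ?_).trans (by simp)
      rw [Set.uIcc_of_le ht.le] at hx
      rcases eq_or_lt_of_le hx.2 with h | h
      -- The support bound gives vanishing only for `|t| > R`; at the endpoint it follows from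
      -- continuity.
      · have hzero : ∀ᶠ y in 𝓝[<] (-|R|), u y = 0 := by
          filter_upwards [self_mem_nhdsWithin] with y hy
          have hy : y < -|R| := hy
          refine hz y ?_
          have := neg_le_abs y
          linarith [le_abs_self R]
        have := tendsto_nhds_unique_of_eventuallyEq
          ((hc.tendsto (-|R|)).mono_left nhdsWithin_le_nhds) tendsto_const_nhds hzero
        simpa [h] using this
      · refine hz x ?_
        have := neg_le_abs x
        linarith [le_abs_self R]
    · rw [← h0, intervalIntegral.integral_eq_integral_of_support_subset]
      intro x hx
      have hx' : |x| ≤ R := by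
        by_contra h
        exact hx (hz x (not_le.1 h))
      by_contra hxx
      rw [Set.mem_Ioc, not_and_or, not_lt, not_le] at hxx
      have hRx := abs_le.1 hx'
      have hR0 : 0 ≤ R := (abs_nonneg x).trans hx'
      rw [abs_of_nonneg hR0] at hxx ht
      rcases hxx with h | h
      · have hxR : x = -R := le_antisymm h hRx.1
        have hzero : ∀ᶠ y in 𝓝[<] (-R), u y = 0 := by
          filter_upwards [self_mem_nhdsWithin] with y hy
          have hy : y < -R := hy
          refine hz y ?_
          have := neg_le_abs y
          linarith
        have := tendsto_nhds_unique_of_eventuallyEq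
          ((hc.tendsto (-R)).mono_left nhdsWithin_le_nhds) tendsto_const_nhds hzero
        exact hx (hxR ▸ this)
      · linarith [hRx.2]

/-- The du Bois-Reymond lemma. -/
theorem ae_eq_const_of_integral_deriv_eq_zero {g : ℝ → ℂ} (hg : LocallyIntegrable g)
    (h : ∀ v, IsTest v → ∫ t, conj (deriv v t) * g t = 0) : ∃ c : ℂ, ∀ᵐ t, g t = c := by
  -- A test function of integral `1`. Subtracting `m ρ` from a function of integral `m` leaves zero
  -- mean, hence a derivative of a test function; the constant sought is the pairing of `g` with
  -- `ρ`.
  set ρ : ℝ → ℂ := fun t => -1 * deriv (cutoff 1) t with hρ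
  have hρt : IsTest ρ := (isTest_deriv_cutoff (.inl rfl)).const_mul (-1)
  have hρ1 : ∫ t, ρ t = 1 := by
    rw [hρ, integral_const_mul, integral_deriv_cutoff (.inl rfl)]
    simp
  have hint : ∀ {u : ℝ → ℂ}, IsTest u → Integrable fun t => conj (u t) * g t := by
    intro u hu
    have := hg.integrable_smul_left_of_hasCompactSupport (g := fun t => conj (u t))
      (Complex.continuous_conj.comp hu.contDiff.continuous)
      (hu.hasCompactSupport.comp_left (map_zero _))
    simpa using this
  refine ⟨∫ t, conj (ρ t) * g t, ?_⟩
  refine ae_eq_of_integral_contDiff_smul_eq hg (locallyIntegrable_const _) fun ψ hψ hψc => ?_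
  have hψt : IsTest (fun t => (ψ t : ℂ)) :=
    ⟨Complex.ofRealCLM.contDiff.comp hψ, hψc.comp_left Complex.ofReal_zero⟩
  set m : ℂ := ∫ t, (ψ t : ℂ) with hm
  have hu : IsTest fun t => (ψ t : ℂ) + -m * ρ t := hψt.add (hρt.const_mul (-m))
  have hu0 : ∫ t, ((ψ t : ℂ) + -m * ρ t) = 0 := by
    rw [integral_add hψt.integrable (hρt.const_mul (-m)).integrable, integral_const_mul, hρ1]
    simp [hm]
  obtain ⟨v, hv, hvu⟩ := hu.exists_primitive hu0
  have key := h v hv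
  rw [hvu] at key
  have e : ∀ t, conj ((ψ t : ℂ) + -m * ρ t) * g t
      = conj (ψ t : ℂ) * g t - conj m * (conj (ρ t) * g t) := by
    intro t
    simp only [map_add, map_mul, map_neg]
    ring
  simp only [e] at key
  rw [integral_sub (hint hψt) ((hint hρt).const_mul _), integral_const_mul, sub_eq_zero] at key
  have hmr : conj m = ∫ t, (ψ t : ℂ) := by
    rw [hm, integral_complex_ofReal, Complex.conj_ofReal]
  simp only [Complex.conj_ofReal] at key
  simp only [Complex.real_smul]
  rw [key, hmr, integral_mul_const]

/-! ### Solutions of the first order equation -/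

section Gauge

/-- The absolute value of the leading coefficient, `e^{2πt} + e^{-2πt} + 2 ε cos φ`. -/
noncomputable def weight (ε φ t : ℝ) : ℝ :=
  Real.exp (2 * Real.pi * t) + Real.exp (-2 * Real.pi * t) + 2 * ε * Real.cos φ

/-- A primitive of the reciprocal of the leading coefficient. -/
noncomputable def primitive (ε φ t : ℝ) : ℝ :=
  ε / (2 * Real.pi * Real.sin φ) *
    Real.arctan ((Real.exp (2 * Real.pi * t) + ε * Real.cos φ) / Real.sin φ)

/-- A nonvanishing solution of `dualOp F = ζ F`. -/
noncomputable def gauge (ε φ τ : ℝ) (ζ : ℂ) (t : ℝ) : ℂ :=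
  Complex.exp (-(1 / 2 + Complex.I * τ) * (Real.log (weight ε φ t) : ℝ)
    - 2 * Real.pi * Complex.I * τ * t - 2 * Real.pi * Complex.I * ζ * (primitive ε φ t : ℝ))

variable {ε φ τ : ℝ} {ζ : ℂ}

theorem exp_neg_two_pi (t : ℝ) : Real.exp (-2 * Real.pi * t) = (Real.exp (2 * Real.pi * t))⁻¹ := by
  rw [← Real.exp_neg]; ring_nf

theorem quadratic_pos (hφ₀ : 0 < φ) (hφ : φ < Real.pi) (x : ℝ) :
    0 < Real.sin φ ^ 2 + (x + ε * Real.cos φ) ^ 2 := by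
  have := Real.sin_pos_of_pos_of_lt_pi hφ₀ hφ
  positivity

/-- Completing the square in `x = e^{2πt}`. Positivity comes from `sin φ ≠ 0`, and the same form
makes `ε/w` integrable by an arctangent. -/
theorem weight_eq (hε : ε = 1 ∨ ε = -1) (t : ℝ) : weight ε φ t = (Real.exp (2 * Real.pi * t))⁻¹
    * (Real.sin φ ^ 2 + (Real.exp (2 * Real.pi * t) + ε * Real.cos φ) ^ 2) := by
  have hx := Real.exp_pos (2 * Real.pi * t)
  have he : ε ^ 2 = 1 := by rcases hε with rfl | rfl <;> norm_num
  rw [weight, exp_neg_two_pi]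
  field_simp
  linear_combination - Real.sin_sq_add_cos_sq φ - Real.cos φ ^ 2 * he

theorem weight_pos (hε : ε = 1 ∨ ε = -1) (hφ₀ : 0 < φ) (hφ : φ < Real.pi) (t : ℝ) :
    0 < weight ε φ t := by
  rw [weight_eq hε]
  exact mul_pos (inv_pos.2 (Real.exp_pos _)) (quadratic_pos hφ₀ hφ _)

theorem hasDerivAt_exp_mul (a t : ℝ) :
    HasDerivAt (fun t : ℝ => Real.exp (a * t)) (a * Real.exp (a * t)) t := by
  have h : HasDerivAt (fun t : ℝ => Real.exp (a * t)) (Real.exp (a * t) * a) t := by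
    refine HasDerivAt.exp ?_
    simpa using (hasDerivAt_id t).const_mul a
  exact h.congr_deriv (mul_comm _ _)

theorem hasDerivAt_weight (t : ℝ) : HasDerivAt (weight ε φ)
    (2 * Real.pi * (Real.exp (2 * Real.pi * t) - Real.exp (-2 * Real.pi * t))) t :=
  (((hasDerivAt_exp_mul (2 * Real.pi) t).add (hasDerivAt_exp_mul (-2 * Real.pi) t)).add_const
    (2 * ε * Real.cos φ)).congr_deriv (by ring)

theorem hasDerivAt_primitive (hε : ε = 1 ∨ ε = -1) (hφ₀ : 0 < φ) (hφ : φ < Real.pi) (t : ℝ) :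
    HasDerivAt (primitive ε φ) (ε / weight ε φ t) t := by
  have hs := Real.sin_pos_of_pos_of_lt_pi hφ₀ hφ
  have hpi := Real.pi_pos
  have hx := Real.exp_pos (2 * Real.pi * t)
  have hq := quadratic_pos (ε := ε) hφ₀ hφ (Real.exp (2 * Real.pi * t))
  refine (((((hasDerivAt_exp_mul (2 * Real.pi) t).add_const (ε * Real.cos φ)).div_const
    (Real.sin φ)).arctan).const_mul (ε / (2 * Real.pi * Real.sin φ))).congr_deriv ?_
  rw [weight_eq hε]
  have h1 : 1 + ((Real.exp (2 * Real.pi * t) + ε * Real.cos φ) / Real.sin φ) ^ 2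
      = (Real.sin φ ^ 2 + (Real.exp (2 * Real.pi * t) + ε * Real.cos φ) ^ 2) / Real.sin φ ^ 2 := by
    field_simp
  rw [h1]
  field_simp

theorem contDiff_exp_mul (a : ℝ) : ContDiff ℝ ∞ fun t : ℝ => Real.exp (a * t) :=
  (contDiff_const.mul contDiff_id).exp

theorem contDiff_weight : ContDiff ℝ ∞ (weight ε φ) :=
  ((contDiff_exp_mul _).add (contDiff_exp_mul _)).add contDiff_const

theorem contDiff_gauge (hε : ε = 1 ∨ ε = -1) (hφ₀ : 0 < φ) (hφ : φ < Real.pi) :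
    ContDiff ℝ ∞ (gauge ε φ τ ζ) := by
  have h1 : ContDiff ℝ ∞ fun t : ℝ => Real.log (weight ε φ t) :=
    contDiff_weight.log fun t => (weight_pos hε hφ₀ hφ t).ne'
  have h2 : ContDiff ℝ ∞ (primitive ε φ) :=
    contDiff_const.mul (((contDiff_exp_mul _).add contDiff_const).div_const _).arctan
  exact (((contDiff_const.mul (Complex.ofRealCLM.contDiff.comp h1)).sub
    (contDiff_const.mul Complex.ofRealCLM.contDiff)).sub
    (contDiff_const.mul (Complex.ofRealCLM.contDiff.comp h2))).cexp

theorem gauge_ne_zero (t : ℝ) : gauge ε φ τ ζ t ≠ 0 := Complex.exp_ne_zero _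

theorem hasDerivAt_gauge (hε : ε = 1 ∨ ε = -1) (hφ₀ : 0 < φ) (hφ : φ < Real.pi) (t : ℝ) :
    HasDerivAt (gauge ε φ τ ζ) ((-(1 / 2 + Complex.I * τ)
      * ((2 * Real.pi * (Real.exp (2 * Real.pi * t) - Real.exp (-2 * Real.pi * t))
        / weight ε φ t : ℝ) : ℂ) - 2 * Real.pi * Complex.I * τ
      - 2 * Real.pi * Complex.I * ζ * ((ε / weight ε φ t : ℝ) : ℂ)) * gauge ε φ τ ζ t) t := by
  have h1 := ((hasDerivAt_weight (ε := ε) (φ := φ) t).log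
    (weight_pos hε hφ₀ hφ t).ne').ofReal_comp.const_mul (-(1 / 2 + Complex.I * τ))
  have h2 := (Complex.ofRealCLM.hasDerivAt (x := t)).const_mul (2 * Real.pi * Complex.I * τ)
  have h3 := (hasDerivAt_primitive hε hφ₀ hφ t).ofReal_comp.const_mul (2 * Real.pi * Complex.I * ζ)
  refine (((h1.sub h2).sub h3).cexp).congr_deriv ?_
  simp only [gauge, Complex.ofRealCLM_apply, Complex.ofReal_one, mul_one]
  exact mul_comm _ _

/-- The gauge transformation reduces `dualOp - ζ` to a differentiation. -/
theorem dualOp_gauge_mul (hε : ε = 1 ∨ ε = -1) (hφ₀ : 0 < φ) (hφ : φ < Real.pi) {v : ℝ → ℂ}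
    (hv : Differentiable ℝ v) (t : ℝ) :
    dualOp ε φ τ (fun t => gauge ε φ τ ζ t * v t) t - ζ * (gauge ε φ τ ζ t * v t) =
      Complex.I / (2 * Real.pi) * (ε * weight ε φ t * gauge ε φ τ ζ t) * deriv v t := by
  have hd := (hasDerivAt_gauge (τ := τ) (ζ := ζ) hε hφ₀ hφ t).mul (hv t).hasDerivAt
  have hderiv : deriv (fun t => gauge ε φ τ ζ t * v t) t = _ := hd.deriv
  have hw : (weight ε φ t : ℂ) ≠ 0 := by exact_mod_cast (weight_pos hε hφ₀ hφ t).ne'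
  have hw2 : (weight ε φ t : ℂ) = Complex.exp (2 * Real.pi * t) + Complex.exp (-2 * Real.pi * t)
      + 2 * ε * Real.cos φ := by
    rw [weight]; push_cast; ring_nf
  have he : (ε : ℂ) ^ 2 = 1 := by rcases hε with rfl | rfl <;> norm_num
  have hlead : 2 * Real.cos φ + ε * (Complex.exp (2 * Real.pi * t)
      + Complex.exp (-2 * Real.pi * t)) = ε * weight ε φ t := by
    rw [hw2]
    linear_combination -2 * Real.cos φ * he
  -- Eliminating `cos φ` in favour of `w` lets the remaining identity be checked with `w` and the
  -- two exponentials as independent variables, using only `ε² = 1` and `i² = -1`.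
  have hc : (2 * Real.cos φ : ℂ) = ε * weight ε φ t - ε * (Complex.exp (2 * Real.pi * t)
      + Complex.exp (-2 * Real.pi * t)) := by
    linear_combination hlead
  have hpi : (Real.pi : ℂ) ≠ 0 := by exact_mod_cast Real.pi_ne_zero
  have hsplit : (2 * τ * (Real.cos φ + ε * Complex.exp (2 * Real.pi * t)) : ℂ)
      = τ * (ε * weight ε φ t - ε * (Complex.exp (2 * Real.pi * t)
      + Complex.exp (-2 * Real.pi * t)) + 2 * ε * Complex.exp (2 * Real.pi * t)) := by
    rw [← hc]; ring
  rw [dualOp, hderiv, hlead, hsplit]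
  push_cast
  generalize Complex.exp (2 * Real.pi * t) = X
  generalize Complex.exp (-2 * Real.pi * t) = Y
  generalize gauge ε φ τ ζ t = m at *
  generalize (weight ε φ t : ℂ) = w at *
  field_simp
  ring_nf
  simp only [Complex.I_sq, he]
  ring

end Gauge

/-! ### Square-integrable weak solutions and their boundary values -/

section WeakSolutions

variable {ε φ τ : ℝ} {ζ : ℂ}

theorem leadingCoeff_ne_zero (hε : ε = 1 ∨ ε = -1) (hφ₀ : 0 < φ) (hφ : φ < Real.pi) (t : ℝ) :
    (ε * weight ε φ t * gauge ε φ τ ζ t : ℂ) ≠ 0 := by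
  have hw : (weight ε φ t : ℂ) ≠ 0 := by exact_mod_cast (weight_pos hε hφ₀ hφ t).ne'
  have he : (ε : ℂ) ≠ 0 := by rcases hε with rfl | rfl <;> norm_num
  exact mul_ne_zero (mul_ne_zero he hw) (gauge_ne_zero t)

/-- Testing with `F = gauge · v` for arbitrary test functions `v` turns the equation into the
vanishing of the distributional derivative of `conj(ε w gauge) y`. This is a constant by the du
Bois-Reymond lemma. -/
theorem eq_of_weak_solution (hε : ε = 1 ∨ ε = -1) (hφ₀ : 0 < φ) (hφ : φ < Real.pi)
    (y : Lp ℂ 2 (volume : Measure ℝ))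
    (h : ∀ F, IsTest F → ∫ t, conj (dualOp ε φ τ F t - ζ * F t) * y t = 0) :
    ∃ c : ℂ, ∀ᵐ t : ℝ, conj (ε * weight ε φ t * gauge ε φ τ ζ t) * y t = c := by
  have hM := contDiff_gauge (τ := τ) (ζ := ζ) hε hφ₀ hφ
  have hcont : Continuous fun t : ℝ => conj (ε * weight ε φ t * gauge ε φ τ ζ t : ℂ) :=
    Complex.continuous_conj.comp ((continuous_const.mul
      (Complex.continuous_ofReal.comp contDiff_weight.continuous)).mul hM.continuous)
  have hloc : LocallyIntegrable fun t : ℝ => conj (ε * weight ε φ t * gauge ε φ τ ζ t : ℂ) * y t :=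
    ((Lp.memLp y).locallyIntegrable (by norm_num)).continuous_mul hcont
  refine ae_eq_const_of_integral_deriv_eq_zero hloc fun v hv => ?_
  have hF := h _ (hv.mul_left hM)
  have e : ∀ t : ℝ, conj (dualOp ε φ τ (fun t => gauge ε φ τ ζ t * v t) t
      - ζ * (gauge ε φ τ ζ t * v t)) * y t = conj (Complex.I / (2 * Real.pi)) *
      (conj (deriv v t) * (conj (ε * weight ε φ t * gauge ε φ τ ζ t : ℂ) * y t)) := fun t => by
    rw [dualOp_gauge_mul hε hφ₀ hφ (hv.contDiff.differentiable (by simp))]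
    simp only [map_mul]
    ring
  simp only [e] at hF
  rw [integral_const_mul] at hF
  refine (mul_eq_zero.1 hF).resolve_left ?_
  simp [Real.pi_ne_zero]

/-- The end of the line at which `edgeFun η τ` does not vanish. -/
noncomputable def edgeFilter (η : ℝ) : Filter ℝ := if η = 1 then atBot else atTop

/-- The limit of `primitive ε φ` at this end. -/
noncomputable def primitiveEnd (ε φ η : ℝ) : ℝ := ε / (2 * Real.pi * Real.sin φ) *
  if η = 1 then Real.arctan (ε * Real.cos φ / Real.sin φ) else Real.pi / 2

theorem tendsto_exp_two_pi_atBot {a : ℝ} (ha : 0 < a) :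
    Tendsto (fun t : ℝ => Real.exp (a * t)) atBot (𝓝 0) :=
  Real.tendsto_exp_atBot.comp (tendsto_id.const_mul_atBot ha)

theorem tendsto_exp_two_pi_atTop {a : ℝ} (ha : a < 0) :
    Tendsto (fun t : ℝ => Real.exp (a * t)) atTop (𝓝 0) :=
  Real.tendsto_exp_atBot.comp (tendsto_id.const_mul_atTop_of_neg ha)

theorem tendsto_primitive (hφ₀ : 0 < φ) (hφ : φ < Real.pi) (ε : ℝ) {η : ℝ}
    (hη : η = 1 ∨ η = -1) :
    Tendsto (primitive ε φ) (edgeFilter η) (𝓝 (primitiveEnd ε φ η)) := by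
  have hs := Real.sin_pos_of_pos_of_lt_pi hφ₀ hφ
  have hpi := Real.pi_pos
  refine Tendsto.const_mul _ ?_
  rcases hη with rfl | rfl
  · simp only [edgeFilter, if_true]
    refine (Real.continuous_arctan.tendsto _).comp (Tendsto.div_const ?_ _)
    have := (tendsto_exp_two_pi_atBot (a := 2 * Real.pi) (by positivity)).add_const
      (ε * Real.cos φ)
    rwa [zero_add] at this
  · have hne : (-1 : ℝ) ≠ 1 := by norm_num
    simp only [edgeFilter, if_neg hne]
    refine (Real.tendsto_arctan_atTop.mono_right nhdsWithin_le_nhds).comp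
      (Tendsto.atTop_div_const hs (tendsto_atTop_add_const_right _ _ ?_))
    exact Real.tendsto_exp_atTop.comp (tendsto_id.const_mul_atTop (by positivity))

/-- At the end selected by `η` one exponential dominates, so `w e^{2πηt} → 1`. -/
theorem tendsto_log_weight (hε : ε = 1 ∨ ε = -1) (hφ₀ : 0 < φ) (hφ : φ < Real.pi) {η : ℝ}
    (hη : η = 1 ∨ η = -1) :
    Tendsto (fun t => Real.log (weight ε φ t) + 2 * Real.pi * η * t) (edgeFilter η) (𝓝 0) := by
  have hpi := Real.pi_pos
  have key : Tendsto (fun t => weight ε φ t * Real.exp (2 * Real.pi * η * t)) (edgeFilter η)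
      (𝓝 1) := by
    rcases hη with rfl | rfl
    · simp only [edgeFilter, if_true]
      have h := ((tendsto_exp_two_pi_atBot (a := 4 * Real.pi) (by positivity)).add_const 1).add
        ((tendsto_exp_two_pi_atBot (a := 2 * Real.pi) (by positivity)).const_mul
          (2 * ε * Real.cos φ))
      rw [zero_add, mul_zero, add_zero] at h
      refine h.congr fun t => ?_
      rw [weight, add_mul, add_mul, ← Real.exp_add, ← Real.exp_add]
      ring_nf
      simp
      ring
    · have hne : (-1 : ℝ) ≠ 1 := by norm_num
      simp only [edgeFilter, if_neg hne]
      have h := ((tendsto_exp_two_pi_atTop (a := -4 * Real.pi) (by linarith)).const_add 1).add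
        ((tendsto_exp_two_pi_atTop (a := -2 * Real.pi) (by linarith)).const_mul
          (2 * ε * Real.cos φ))
      rw [add_zero, mul_zero, add_zero] at h
      refine h.congr fun t => ?_
      rw [weight, add_mul, add_mul, ← Real.exp_add, ← Real.exp_add]
      ring_nf
      simp
      ring
  have := (Real.continuousAt_log one_ne_zero).tendsto.comp key
  rw [Real.log_one] at this
  refine this.congr fun t => ?_
  rw [Function.comp_apply, Real.log_mul (weight_pos hε hφ₀ hφ t).ne' (Real.exp_pos _).ne',
    Real.log_exp]

/-- The coefficient of `edgeFun` with respect to the gauge tends to a nonzero limit. -/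
theorem tendsto_edgeFun_div_gauge (hε : ε = 1 ∨ ε = -1) (hφ₀ : 0 < φ) (hφ : φ < Real.pi) {η : ℝ}
    (hη : η = 1 ∨ η = -1) :
    Tendsto (fun t => edgeFun η τ t / gauge ε φ τ ζ t) (edgeFilter η)
      (𝓝 (Complex.exp (2 * Real.pi * Complex.I * ζ * (primitiveEnd ε φ η : ℝ)))) := by
  have h1 := (Complex.continuous_ofReal.tendsto _).comp (tendsto_log_weight hε hφ₀ hφ hη)
  have h2 := (Complex.continuous_ofReal.tendsto _).comp (tendsto_primitive hφ₀ hφ ε hη)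
  have h3 := (Complex.continuous_exp.tendsto _).comp ((h1.const_mul (1 / 2 + Complex.I * τ)).add
    (h2.const_mul (2 * Real.pi * Complex.I * ζ)))
  rw [Complex.ofReal_zero, mul_zero, zero_add] at h3
  refine h3.congr' ?_
  have hev : ∀ᶠ t in edgeFilter η, η * t ≤ 0 := by
    rcases hη with rfl | rfl
    · simp only [edgeFilter, if_true]
      filter_upwards [eventually_le_atBot 0] with t ht
      linarith
    · have hne : (-1 : ℝ) ≠ 1 := by norm_num
      simp only [edgeFilter, if_neg hne]
      filter_upwards [eventually_ge_atTop 0] with t ht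
      linarith
  filter_upwards [hev] with t ht
  simp only [Function.comp_apply]
  -- Where the cutoff is `1` the two exponents differ by `(1/2 + iτ)(log w + 2πηt)` plus the
  -- primitive term. Thus the exponent of `edgeFun` has exactly the asymptotics of the gauge at this
  -- end.
  rw [edgeFun, cutoff_eq_one ht, one_mul, gauge, ← Complex.exp_sub]
  congr 1
  rw [edgePole]
  push_cast
  linear_combination (2 * Real.pi * η * t / 2) * Complex.I_mul_I

/-- With `v = edgeFun / gauge`, the integrand becomes `c` times the conjugate of a constant multiple
of `v'`. The integral is a boundary value: `v` vanishes near one end and has the limit from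
`tendsto_edgeFun_div_gauge` at the other. -/
theorem integral_edge_pairing (hε : ε = 1 ∨ ε = -1) (hφ₀ : 0 < φ) (hφ : φ < Real.pi) {η : ℝ}
    (hη : η = 1 ∨ η = -1) (y : Lp ℂ 2 (volume : Measure ℝ)) {c : ℂ}
    (hy : ∀ᵐ t : ℝ, conj (ε * weight ε φ t * gauge ε φ τ ζ t) * y t = c) :
    ∫ t, conj (dualOp ε φ τ (edgeFun η τ) t - ζ * edgeFun η τ t) * y t =
      conj (-η * Complex.I / (2 * Real.pi)
        * Complex.exp (2 * Real.pi * Complex.I * ζ * (primitiveEnd ε φ η : ℝ))) * c := by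
  set v : ℝ → ℂ := fun t => edgeFun η τ t / gauge ε φ τ ζ t with hv
  have hvd : Differentiable ℝ v := fun t =>
    ((contDiff_edgeFun η τ).differentiable (by simp) t).fun_div
      ((contDiff_gauge hε hφ₀ hφ).differentiable (by simp) t) (gauge_ne_zero t)
  have hFv : (fun t => gauge ε φ τ ζ t * v t) = edgeFun η τ := by
    funext t
    rw [hv]
    field_simp [gauge_ne_zero (ε := ε) (φ := φ) (τ := τ) (ζ := ζ) t]
  have hG : ∀ t, dualOp ε φ τ (edgeFun η τ) t - ζ * edgeFun η τ t =
      Complex.I / (2 * Real.pi) * (ε * weight ε φ t * gauge ε φ τ ζ t) * deriv v t := by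
    intro t
    have := dualOp_gauge_mul (τ := τ) (ζ := ζ) hε hφ₀ hφ hvd t
    rw [hFv, congrFun hFv t] at this
    exact this
  have hae : ∀ᵐ t : ℝ, conj (dualOp ε φ τ (edgeFun η τ) t - ζ * edgeFun η τ t) * y t =
      conj (Complex.I / (2 * Real.pi) * deriv v t) * c := by
    filter_upwards [hy] with t ht
    rw [hG, ← ht]
    simp only [map_mul]
    ring
  rw [integral_congr_ae hae, integral_mul_const]
  -- For `c ≠ 0`, integrability of `v'` is recovered from that of the pairing by dividing by `c`.
  rcases eq_or_ne c 0 with rfl | hc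
  · simp
  congr 1
  have hpair := isTransformPair_edge hη ε φ τ
  have hint : Integrable fun t => conj (dualOp ε φ τ (edgeFun η τ) t - ζ * edgeFun η τ t) * y t :=
    integrable_conj_mul (hpair.memLp_right.sub (hpair.memLp_left.const_mul ζ)) (Lp.memLp y)
  have hint2 := (hint.congr hae).mul_const c⁻¹
  have hint3 : Integrable (deriv v) := by
    have h4 : Integrable fun t => conj (conj (Complex.I / (2 * Real.pi) * deriv v t)) := by
      refine Integrable.congr (f := fun t => conj (conj (Complex.I / (2 * Real.pi) * deriv v t)
        * c * c⁻¹)) ?_ (Eventually.of_forall fun t => ?_)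
      · exact Complex.conjCLE.toContinuousLinearMap.integrable_comp hint2
      · simp only [mul_assoc, mul_inv_cancel₀ hc, mul_one]
    have h5 := h4.const_mul (Complex.I / (2 * Real.pi))⁻¹
    refine h5.congr (Eventually.of_forall fun t => ?_)
    have hpi : (Real.pi : ℂ) ≠ 0 := by exact_mod_cast Real.pi_ne_zero
    simp only [Complex.conj_conj]
    field_simp
  have hlim := tendsto_edgeFun_div_gauge (τ := τ) (ζ := ζ) hε hφ₀ hφ hη
  have hzero : ∀ t, 1 ≤ η * t → v t = 0 := fun t ht => by
    rw [hv]
    simp only [edgeFun, cutoff_eq_zero ht, zero_mul, zero_div]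
  have hval : ∫ t, deriv v t = -η * Complex.exp (2 * Real.pi * Complex.I * ζ
      * (primitiveEnd ε φ η : ℝ)) := by
    rcases hη with rfl | rfl
    · simp only [edgeFilter, if_true] at hlim
      have h0 : Tendsto v atTop (𝓝 0) := by
        refine tendsto_const_nhds.congr' ?_
        filter_upwards [eventually_ge_atTop 1] with t ht
        exact (hzero t (by linarith)).symm
      rw [integral_of_hasDerivAt_of_tendsto (fun t => (hvd t).hasDerivAt) hint3 hlim h0]
      push_cast
      ring
    · have hne : (-1 : ℝ) ≠ 1 := by norm_num
      simp only [edgeFilter, if_neg hne] at hlim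
      have h0 : Tendsto v atBot (𝓝 0) := by
        refine tendsto_const_nhds.congr' ?_
        filter_upwards [eventually_le_atBot (-1)] with t ht
        exact (hzero t (by linarith)).symm
      rw [integral_of_hasDerivAt_of_tendsto (fun t => (hvd t).hasDerivAt) hint3 h0 hlim]
      push_cast
      ring
  rw [integral_conj, integral_const_mul, hval]
  congr 1
  ring

end WeakSolutions

/-! ### Density of the domains -/

theorem ae_eq_zero_of_integral_test {w : ℝ → ℂ} (hw : LocallyIntegrable w)
    (h : ∀ F, IsTest F → ∫ t, conj (F t) * w t = 0) : ∀ᵐ t, w t = 0 := by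
  refine ae_eq_zero_of_integral_contDiff_smul_eq_zero hw fun g hg hc => ?_
  have := h (fun t => (g t : ℂ)) ⟨Complex.ofRealCLM.contDiff.comp hg,
    hc.comp_left (g := fun x : ℝ => (x : ℂ)) Complex.ofReal_zero⟩
  simpa using this

theorem eq_zero_of_fourier_ae_eq_zero {y : Lp ℂ 2 (volume : Measure ℝ)}
    (h : ∀ᵐ t, (𝓕 y : Lp ℂ 2 (volume : Measure ℝ)) t = 0) : y = 0 := by
  have h0 : (𝓕 y : Lp ℂ 2 (volume : Measure ℝ)) = 0 := (Lp.eq_zero_iff_ae_eq_zero).2 h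
  rw [← norm_eq_zero, ← Lp.norm_fourier_eq, h0, norm_zero]

theorem IsTest.zero : IsTest fun _ => 0 := ⟨contDiff_const, HasCompactSupport.zero⟩

theorem mkPair_fourierLaplace_mem {F₁ F₂ : ℝ → ℂ} (h₁ : IsTest F₁) (h₂ : IsTest F₂) :
    mkPair (fourierLaplace F₁) (fourierLaplace F₂) ∈ domH :=
  mkPair_mem ⟨1, one_pos, h₁.differentiable_fourierLaplace.differentiableOn⟩
    ⟨1, one_pos, h₂.differentiable_fourierLaplace.differentiableOn⟩
    h₁.decays_fourierLaplace h₂.decays_fourierLaplace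

section

variable {φ τ : ℝ} {D : Submodule ℂ ((ℂ → ℂ) × (ℂ → ℂ))}

theorem mem_graph_of_mem {f : (ℂ → ℂ) × (ℂ → ℂ)} (hf : f ∈ pairsOff (poles τ)) (hD : f ∈ D) :
    (toL2 τ ⟨f, hf⟩, diffToL2 φ τ ⟨f, hf⟩) ∈ (diffSum φ τ D).graph := by
  rw [graph_diffSum]
  exact ⟨⟨f, hf⟩, hD, rfl⟩

theorem inner_toL2_mkPair {F₁ F₂ : ℝ → ℂ} (h₁ : IsTest F₁) (h₂ : IsTest F₂)
    (hm : mkPair (fourierLaplace F₁) (fourierLaplace F₂) ∈ pairsOff (poles τ)) (y : L2Sum) :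
    ⟪toL2 τ ⟨_, hm⟩, y⟫_ℂ =
      (∫ t, conj (F₁ t) * (𝓕 y.fst : Lp ℂ 2 (volume : Measure ℝ)) t)
      + ∫ t, conj (F₂ t) * (𝓕 (expSnd y) : Lp ℂ 2 (volume : Measure ℝ)) t := by
  have m : ∀ {F : ℝ → ℂ}, IsTest F → MemLp (fun x : ℝ => fourierLaplace F x) 2 volume :=
    fun {F} hF => by
      have h := hF.isTransformPair 1 0 τ
      simpa using memLp_shift h.holomorphic h.decays (z := 0) (by simp)
  rw [inner_toL2]
  simp only [expMul_mkPair]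
  rw [← integral_conj_mul_fourier h₁.integrable h₁.memLp (m h₁) (fun _ => rfl),
    ← integral_conj_mul_fourier h₂.integrable h₂.memLp (m h₂) (fun _ => rfl)]
  rfl

/-- Pairs of transforms of test functions already lie in `𝓗`. By Plancherel, a vector orthogonal to
them has both Fourier components orthogonal to all test functions. -/
theorem dense_domain_diffSum (hD : domH ≤ D) : Dense ((diffSum φ τ D).domain : Set L2Sum) := by
  rw [Submodule.dense_iff_topologicalClosure_eq_top, Submodule.topologicalClosure_eq_top_iff,
    Submodule.eq_bot_iff]
  intro y hy
  have key : ∀ {F₁ F₂ : ℝ → ℂ}, IsTest F₁ → IsTest F₂ →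
      (∫ t, conj (F₁ t) * (𝓕 y.fst : Lp ℂ 2 (volume : Measure ℝ)) t)
      + ∫ t, conj (F₂ t) * (𝓕 (expSnd y) : Lp ℂ 2 (volume : Measure ℝ)) t = 0 :=
    fun h₁ h₂ => by
      have hm := mkPair_fourierLaplace_mem h₁ h₂
      rw [← inner_toL2_mkPair h₁ h₂ (domH_le τ hm)]
      exact hy _ (LinearPMap.mem_domain_of_mem_graph
        (mem_graph_of_mem (φ := φ) (domH_le τ hm) (hD hm)))
  refine eq_zero_of_expSnd (eq_zero_of_fourier_ae_eq_zero ?_) (eq_zero_of_fourier_ae_eq_zero ?_)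
  · refine ae_eq_zero_of_integral_test ((Lp.memLp _).locallyIntegrable (by norm_num)) fun F hF => ?_
    simpa using key hF IsTest.zero
  · refine ae_eq_zero_of_integral_test ((Lp.memLp _).locallyIntegrable (by norm_num)) fun F hF => ?_
    simpa using key IsTest.zero hF

end

/-! ### Pairs with prescribed poles -/

section EdgePairs

variable {φ τ σ η : ℝ} {a b : ℂ}

/-- A pair of functions with a pole at `edgePole η τ` only. -/
noncomputable def edgePair (η τ : ℝ) (a b : ℂ) : (ℂ → ℂ) × (ℂ → ℂ) :=
  mkPair (fun s => a * edgeTransform η τ s) (fun s => b * edgeTransform η τ s)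

theorem edgePair_mem (hη : η = 1 ∨ η = -1) : edgePair η τ a b ∈ pairsOff (poles τ) :=
  ((isTransformPair_edge hη 1 0 τ).const_mul a).mkPair_mem
    ((isTransformPair_edge hη (-1) 0 τ).const_mul b)

theorem hasSimplePoleResidue_edgePair_fst (hη : η = 1 ∨ η = -1) :
    HasSimplePoleResidue (edgePair η τ a b).1 (edgePole η τ)
      (a * (-η * Complex.I / (2 * Real.pi))) :=
  (hasSimplePoleResidue_edge hη τ).smul a

theorem hasSimplePoleResidue_edgePair_snd (hη : η = 1 ∨ η = -1) :
    HasSimplePoleResidue (edgePair η τ a b).2 (edgePole η τ)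
      (Complex.exp (-Real.pi * edgePole η τ) * (b * (-η * Complex.I / (2 * Real.pi)))) :=
  ((hasSimplePoleResidue_edge hη τ).smul b).mul_analytic
    (u := fun s => Complex.exp (-Real.pi * s)) (by fun_prop)

theorem hasSimplePoleResidue_edgePair_fst_zero (hη : η = 1 ∨ η = -1) {p : ℂ}
    (hp : p ≠ edgePole η τ) : HasSimplePoleResidue (edgePair η τ a b).1 p 0 := by
  have h := (hasSimplePoleResidue_edge_zero hη τ hp).smul a
  rw [mul_zero] at h
  exact h

theorem hasSimplePoleResidue_edgePair_snd_zero (hη : η = 1 ∨ η = -1) {p : ℂ}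
    (hp : p ≠ edgePole η τ) : HasSimplePoleResidue (edgePair η τ a b).2 p 0 := by
  have h := ((hasSimplePoleResidue_edge_zero hη τ hp).smul b).mul_analytic
    (u := fun s => Complex.exp (-Real.pi * s)) (by fun_prop)
  rw [mul_zero, mul_zero] at h
  exact h

theorem poles_ne (τ : ℝ) : (Complex.I / 2 : ℂ) ≠ -Complex.I / 2 + 2 * τ := fun h => by
  have := congrArg Complex.im h
  norm_num [Complex.div_im] at this

theorem exp_neg_pi_mul_I_half : Complex.exp (-Real.pi * (Complex.I / 2)) = -Complex.I := by
  rw [show -(Real.pi : ℂ) * (Complex.I / 2) = -(Real.pi / 2 * Complex.I) by ring, Complex.exp_neg,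
    Complex.exp_pi_div_two_mul_I, Complex.inv_I]

theorem exp_two_pi_mul_exp_neg_pi (τ : ℝ) : Complex.exp (2 * Real.pi * τ)
    * Complex.exp (-Real.pi * (-Complex.I / 2 + 2 * τ)) = Complex.I := by
  refine Eq.trans ?_ Complex.exp_pi_div_two_mul_I
  rw [← Complex.exp_add]
  ring_nf

/-- The residues of `edgePair 1 τ 1 b`. -/
theorem edgePair_one_residues (τ : ℝ) (b : ℂ) :
    HasSimplePoleResidue (edgePair 1 τ 1 b).1 (Complex.I / 2) (-Complex.I / (2 * Real.pi)) ∧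
    HasSimplePoleResidue (edgePair 1 τ 1 b).2 (Complex.I / 2)
      (-Complex.I * b * (-Complex.I / (2 * Real.pi))) ∧
    HasSimplePoleResidue (edgePair 1 τ 1 b).1 (-Complex.I / 2 + 2 * τ) 0 ∧
    HasSimplePoleResidue (edgePair 1 τ 1 b).2 (-Complex.I / 2 + 2 * τ) 0 := by
  have hp := edgePole_one τ
  have hη : (1 : ℝ) = 1 ∨ (1 : ℝ) = -1 := .inl rfl
  refine ⟨?_, ?_, ?_, ?_⟩
  · have := hasSimplePoleResidue_edgePair_fst (τ := τ) (a := 1) (b := b) hη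
    rw [hp] at this
    simpa using this
  · have := hasSimplePoleResidue_edgePair_snd (τ := τ) (a := 1) (b := b) hη
    rw [hp, exp_neg_pi_mul_I_half] at this
    convert this using 1
    push_cast
    ring
  · exact hasSimplePoleResidue_edgePair_fst_zero hη (by rw [hp]; exact (poles_ne τ).symm)
  · exact hasSimplePoleResidue_edgePair_snd_zero hη (by rw [hp]; exact (poles_ne τ).symm)

theorem edgePair_neg_one_residues (τ : ℝ) (a b : ℂ) :
    HasSimplePoleResidue (edgePair (-1) τ a b).1 (Complex.I / 2) 0 ∧
    HasSimplePoleResidue (edgePair (-1) τ a b).2 (Complex.I / 2) 0 ∧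
    HasSimplePoleResidue (edgePair (-1) τ a b).1 (-Complex.I / 2 + 2 * τ)
      (a * (Complex.I / (2 * Real.pi))) ∧
    HasSimplePoleResidue (edgePair (-1) τ a b).2 (-Complex.I / 2 + 2 * τ)
      (Complex.exp (-Real.pi * (-Complex.I / 2 + 2 * τ)) * (b * (Complex.I / (2 * Real.pi)))) := by
  have hp := edgePole_neg_one τ
  have hη : (-1 : ℝ) = 1 ∨ (-1 : ℝ) = -1 := .inr rfl
  refine ⟨?_, ?_, ?_, ?_⟩
  · exact hasSimplePoleResidue_edgePair_fst_zero hη (by rw [hp]; exact poles_ne τ)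
  · exact hasSimplePoleResidue_edgePair_snd_zero hη (by rw [hp]; exact poles_ne τ)
  · have := hasSimplePoleResidue_edgePair_fst (τ := τ) (a := a) (b := b) hη
    rw [hp] at this
    simpa using this
  · have := hasSimplePoleResidue_edgePair_snd (τ := τ) (a := a) (b := b) hη
    rw [hp] at this
    simpa using this

/-- The coefficient `i` compensates the value `-i` of `e^{-πs}` at `i/2`, so the two residues agree.
-/
theorem edgePair_one_mem (τ σ : ℝ) : edgePair 1 τ 1 Complex.I ∈ domHσ τ σ := by
  obtain ⟨h1, h2, h3, h4⟩ := edgePair_one_residues τ Complex.I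
  refine ⟨edgePair_mem (.inl rfl), ⟨_, _, h1, h2, ?_⟩, ⟨_, _, h3, h4, by simp⟩⟩
  linear_combination (-Complex.I / (2 * Real.pi)) * Complex.I_mul_I

/-- The coefficient of the pair in `𝓗_σ` with a pole at `-i/2 + 2τ`. -/
noncomputable def phase (σ : ℝ) : ℂ := -Complex.I * Complex.exp (2 * Real.pi * Complex.I * σ)

/-- The residue condition at `-i/2 + 2τ` forces this coefficient, once the factor `e^{-πs}` of the
second component is evaluated there. The real exponentials in `τ` cancel, which is why `phase σ` has
modulus `1`. -/
theorem phase_eq (τ σ : ℝ) : phase σ = -Complex.exp (2 * Real.pi * (τ + Complex.I * σ)) *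
    Complex.exp (-Real.pi * (-Complex.I / 2 + 2 * τ)) := by
  rw [mul_add, Complex.exp_add, phase, mul_assoc (2 * Real.pi : ℂ)]
  linear_combination Complex.exp (2 * Real.pi * (Complex.I * σ)) * exp_two_pi_mul_exp_neg_pi τ

theorem norm_phase (σ : ℝ) : ‖phase σ‖ = 1 := by
  rw [phase, norm_mul, Complex.norm_exp]
  simp

theorem edgePair_neg_one_mem (τ σ : ℝ) : edgePair (-1) τ (phase σ) 1 ∈ domHσ τ σ := by
  obtain ⟨h1, h2, h3, h4⟩ := edgePair_neg_one_residues τ (phase σ) 1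
  refine ⟨edgePair_mem (.inr rfl), ⟨_, _, h1, h2, rfl⟩, ⟨_, _, h3, h4, ?_⟩⟩
  rw [phase_eq τ]
  ring

theorem inner_edgePair (hφ₀ : 0 < φ) (hφ : φ < Real.pi) (hη : η = 1 ∨ η = -1) (ζ : ℂ)
    (y : L2Sum) {c₁ c₂ : ℂ}
    (h₁ : ∀ᵐ t : ℝ, conj ((1 : ℝ) * weight 1 φ t * gauge 1 φ τ ζ t : ℂ)
      * (𝓕 y.fst : Lp ℂ 2 (volume : Measure ℝ)) t = c₁)
    (h₂ : ∀ᵐ t : ℝ, conj ((-1 : ℝ) * weight (-1) φ t * gauge (-1) φ τ ζ t : ℂ)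
      * (𝓕 (expSnd y) : Lp ℂ 2 (volume : Measure ℝ)) t = c₂) :
    ⟪diffToL2 φ τ ⟨edgePair η τ a b, edgePair_mem hη⟩
      - ζ • toL2 τ ⟨edgePair η τ a b, edgePair_mem hη⟩, y⟫_ℂ =
    conj (-η * Complex.I / (2 * Real.pi)) *
      (conj (a * Complex.exp (2 * Real.pi * Complex.I * ζ * (primitiveEnd 1 φ η : ℝ))) * c₁
      + conj (b * Complex.exp (2 * Real.pi * Complex.I * ζ * (primitiveEnd (-1) φ η : ℝ))) * c₂) := by
  have e : ∀ (c : ℂ) (G F y : ℝ → ℂ), ∫ t, conj (c * G t - ζ * (c * F t)) * y t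
      = conj c * ∫ t, conj (G t - ζ * F t) * y t := fun c G F y => by
    rw [← integral_const_mul]
    refine integral_congr_ae (Eventually.of_forall fun t => ?_)
    simp only [map_sub, map_mul]
    ring
  refine (inner_mkPair ((isTransformPair_edge hη 1 φ τ).const_mul a)
    ((isTransformPair_edge hη (-1) φ τ).const_mul b) ζ y).trans ?_
  rw [e, e, integral_edge_pairing (.inl rfl) hφ₀ hφ hη _ h₁,
    integral_edge_pairing (.inr rfl) hφ₀ hφ hη _ h₂]
  simp only [map_mul]
  ring

end EdgePairs

section

variable {φ τ : ℝ}

/-! ### Defect vectors on `𝓗_σ` -/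

theorem primitiveEnd_one_lt (hφ₀ : 0 < φ) (hφ : φ < Real.pi) :
    primitiveEnd 1 φ 1 < primitiveEnd 1 φ (-1) := by
  have hs := Real.sin_pos_of_pos_of_lt_pi hφ₀ hφ
  have hpi := Real.pi_pos
  have hne : (-1 : ℝ) ≠ 1 := by norm_num
  rw [primitiveEnd, primitiveEnd, if_pos rfl, if_neg hne]
  exact mul_lt_mul_of_pos_left (Real.arctan_lt_pi_div_two _) (by positivity)

theorem primitiveEnd_neg_one_lt (hφ₀ : 0 < φ) (hφ : φ < Real.pi) :
    primitiveEnd (-1) φ (-1) < primitiveEnd (-1) φ 1 := by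
  have hs := Real.sin_pos_of_pos_of_lt_pi hφ₀ hφ
  have hpi := Real.pi_pos
  have hne : (-1 : ℝ) ≠ 1 := by norm_num
  rw [primitiveEnd, primitiveEnd, if_pos rfl, if_neg hne]
  refine mul_lt_mul_of_neg_left (Real.arctan_lt_pi_div_two _) ?_
  exact div_neg_of_neg_of_pos (by norm_num) (by positivity)

/-- For purely imaginary `ζ` the exponentials are real and positive. Passing to moduli discards the
unimodular coefficients, and with them the dependence on `σ`. -/
theorem norm_mul_eq_of_conj_mul_add_eq_zero {a b c₁ c₂ ζ : ℂ} {κ x₁ x₂ : ℝ} (ha : ‖a‖ = 1)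
    (hb : ‖b‖ = 1) (hζ : ζ = -κ * Complex.I)
    (h : conj (a * Complex.exp (2 * Real.pi * Complex.I * ζ * x₁)) * c₁
      + conj (b * Complex.exp (2 * Real.pi * Complex.I * ζ * x₂)) * c₂ = 0) :
    Real.exp (2 * Real.pi * κ * x₁) * ‖c₁‖ = Real.exp (2 * Real.pi * κ * x₂) * ‖c₂‖ := by
  have e : ∀ x : ℝ, ‖Complex.exp (2 * Real.pi * Complex.I * ζ * x)‖
      = Real.exp (2 * Real.pi * κ * x) := fun x => by
    have : 2 * Real.pi * Complex.I * ζ * x = ((2 * Real.pi * κ * x : ℝ) : ℂ) := by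
      rw [hζ]
      push_cast
      linear_combination (-2 * Real.pi * κ * x : ℂ) * Complex.I_mul_I
    rw [this, Complex.norm_exp_ofReal]
  have := congrArg norm (eq_neg_of_add_eq_zero_left h)
  simpa only [norm_neg, norm_mul, RCLike.norm_conj, ha, hb, one_mul, e] using this

theorem eq_zero_of_exp_mul_eq {x₁ x₂ y₁ y₂ n₁ n₂ : ℝ}
    (hx : Real.exp x₁ * n₁ = Real.exp x₂ * n₂) (hy : Real.exp y₁ * n₁ = Real.exp y₂ * n₂)
    (hne : x₁ + y₂ ≠ y₁ + x₂) : n₁ = 0 ∧ n₂ = 0 := by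
  have h1 : n₁ = 0 := by
    have h : (Real.exp (x₁ + y₂) - Real.exp (y₁ + x₂)) * n₁ = 0 := by
      rw [Real.exp_add, Real.exp_add]
      linear_combination Real.exp y₂ * hx - Real.exp x₂ * hy
    refine (mul_eq_zero.1 h).resolve_left fun h0 => hne (Real.exp_injective (sub_eq_zero.1 h0))
  refine ⟨h1, ?_⟩
  rw [h1, mul_zero] at hx
  exact (mul_eq_zero.1 hx.symm).resolve_left (Real.exp_pos _).ne'

theorem inner_sub_smul_eq_zero {σ : ℝ} {z : ℂ} {y : L2Sum}
    (hy : y ∈ defectSpace (diffSum φ τ (domHσ τ σ)) z) {f : (ℂ → ℂ) × (ℂ → ℂ)}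
    (hf : f ∈ pairsOff (poles τ)) (hD : f ∈ domHσ τ σ) :
    ⟪diffToL2 φ τ ⟨f, hf⟩ - conj z • toL2 τ ⟨f, hf⟩, y⟫_ℂ = 0 := by
  have hd : Dense ((diffSum φ τ (domHσ τ σ)).domain : Set L2Sum) :=
    dense_domain_diffSum (domH_le_domHσ τ σ)
  have hg := mem_graph_of_mem (φ := φ) hf hD
  have h := (mem_defectSpace_iff hd).1 hy
  generalize diffToL2 φ τ ⟨f, hf⟩ = v at hg ⊢
  generalize toL2 τ ⟨f, hf⟩ = u at hg ⊢
  generalize (diffSum φ τ (domHσ τ σ)).graph = g at h hg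
  exact h (u, v) hg

theorem integral_add_integral_eq_zero {σ : ℝ} {z : ℂ} {y : L2Sum}
    (hy : y ∈ defectSpace (diffSum φ τ (domHσ τ σ)) z) {F₁ F₂ : ℝ → ℂ} (h₁ : IsTest F₁)
    (h₂ : IsTest F₂) :
    (∫ t, conj (dualOp 1 φ τ F₁ t - conj z * F₁ t) * (𝓕 y.fst : Lp ℂ 2 (volume : Measure ℝ)) t)
      + ∫ t, conj (dualOp (-1) φ τ F₂ t - conj z * F₂ t)
        * (𝓕 (expSnd y) : Lp ℂ 2 (volume : Measure ℝ)) t = 0 := by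
  rw [← inner_mkPair (h₁.isTransformPair 1 φ τ) (h₂.isTransformPair (-1) φ τ)]
  exact inner_sub_smul_eq_zero hy _ (domH_le_domHσ τ σ (mkPair_fourierLaplace_mem h₁ h₂))

theorem dualOp_zero_sub (ε φ τ : ℝ) (ζ : ℂ) (t : ℝ) :
    dualOp ε φ τ (fun _ => 0) t - ζ * 0 = 0 := by
  simp [dualOp]

theorem eq_zero_of_leadingCoeff_mul {ε : ℝ} {ζ : ℂ} (hε : ε = 1 ∨ ε = -1) (hφ₀ : 0 < φ)
    (hφ : φ < Real.pi) {y : Lp ℂ 2 (volume : Measure ℝ)}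
    (h : ∀ᵐ t : ℝ, conj (ε * weight ε φ t * gauge ε φ τ ζ t : ℂ)
      * (𝓕 y : Lp ℂ 2 (volume : Measure ℝ)) t = 0) : y = 0 := by
  refine eq_zero_of_fourier_ae_eq_zero ?_
  filter_upwards [h] with t ht
  exact (mul_eq_zero.1 ht).resolve_left ((map_ne_zero _).2 (leadingCoeff_ne_zero hε hφ₀ hφ t))

/-- Test functions in one component at a time reduce the vector to two constants, and the one-pole
pairs of `𝓗_σ` give two relations between their moduli. -/
theorem defectSpace_domHσ_eq_bot (hφ₀ : 0 < φ) (hφ : φ < Real.pi) (σ : ℝ) {z : ℂ} {κ : ℝ}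
    (hκ : κ ≠ 0) (hz : conj z = -κ * Complex.I) :
    defectSpace (diffSum φ τ (domHσ τ σ)) z = ⊥ := by
  rw [Submodule.eq_bot_iff]
  intro y hy
  have h1 : (1 : ℝ) = 1 ∨ (1 : ℝ) = -1 := .inl rfl
  have h2 : (-1 : ℝ) = 1 ∨ (-1 : ℝ) = -1 := .inr rfl
  obtain ⟨c₁, hc₁⟩ := eq_of_weak_solution (τ := τ) (ζ := conj z) h1 hφ₀ hφ (𝓕 y.fst)
    fun F hF => by
      have h := integral_add_integral_eq_zero hy hF IsTest.zero
      simp only [dualOp_zero_sub, map_zero, zero_mul, integral_zero, add_zero] at h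
      exact h
  obtain ⟨c₂, hc₂⟩ := eq_of_weak_solution (τ := τ) (ζ := conj z) h2 hφ₀ hφ (𝓕 (expSnd y))
    fun F hF => by
      have h := integral_add_integral_eq_zero hy IsTest.zero hF
      simp only [dualOp_zero_sub, map_zero, zero_mul, integral_zero, zero_add] at h
      exact h
  have hz₀ : ∀ η : ℝ, η ≠ 0 → conj (-η * Complex.I / (2 * Real.pi) : ℂ) ≠ 0 := fun η hη => by
    simp [hη, Real.pi_ne_zero]
  have p1 := (inner_edgePair (a := 1) (b := Complex.I) hφ₀ hφ h1 (conj z) y hc₁ hc₂).symm.trans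
    (inner_sub_smul_eq_zero hy _ (edgePair_one_mem τ σ))
  have p2 := (inner_edgePair (a := phase σ) (b := 1) hφ₀ hφ h2 (conj z) y hc₁ hc₂).symm.trans
    (inner_sub_smul_eq_zero hy _ (edgePair_neg_one_mem τ σ))
  have n1 := norm_mul_eq_of_conj_mul_add_eq_zero norm_one Complex.norm_I hz
    ((mul_eq_zero.1 p1).resolve_left (hz₀ 1 one_ne_zero))
  have n2 := norm_mul_eq_of_conj_mul_add_eq_zero (norm_phase σ) norm_one hz
    ((mul_eq_zero.1 p2).resolve_left (hz₀ (-1) (by norm_num)))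
  -- The two relations are incompatible for nonzero constants: between the ends of the line
  -- `primitive 1 φ` increases and `primitive (-1) φ` decreases, so the differences of their end
  -- values have opposite signs.
  obtain ⟨z1, z2⟩ := eq_zero_of_exp_mul_eq n1 n2 fun h => by
    rw [← mul_add, ← mul_add] at h
    have := mul_left_cancel₀ (mul_ne_zero Real.two_pi_pos.ne' hκ) h
    linarith [primitiveEnd_one_lt hφ₀ hφ, primitiveEnd_neg_one_lt hφ₀ hφ]
  rw [norm_eq_zero] at z1 z2
  rw [z1] at hc₁
  rw [z2] at hc₂
  exact eq_zero_of_expSnd (eq_zero_of_leadingCoeff_mul h1 hφ₀ hφ hc₁)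
    (eq_zero_of_leadingCoeff_mul h2 hφ₀ hφ hc₂)

/-! ### `𝓗_σ` as an extension of `𝓗` -/

/-- A vanishing residue leaves a removable singularity, but the value of `f` at the pole is
arbitrary, whereas `𝓗` requires holomorphy there. The function is therefore corrected at the two
points, one after the other. -/
theorem exists_holomorphicOff_empty {f : ℂ → ℂ} (hf : HolomorphicOff (poles τ) f)
    (h₁ : HasSimplePoleResidue f (Complex.I / 2) 0)
    (h₂ : HasSimplePoleResidue f (-Complex.I / 2 + 2 * τ) 0) :
    ∃ g, HolomorphicOff ∅ g ∧ ∀ s ∉ poles τ, g s = f s := by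
  obtain ⟨δ, hδ, hd⟩ := hf
  have hU : IsOpen {s : ℂ | |s.im| < 1 + δ} := isOpen_lt (by fun_prop) (by fun_prop)
  obtain ⟨u, hu, huf⟩ := exists_holomorphic_of_hasSimplePoleResidue
    (U := {s : ℂ | |s.im| < 1 + δ} \ {-Complex.I / 2 + 2 * τ}) (a := Complex.I / 2)
    (hU.sdiff isClosed_singleton) (hd.mono fun s hs => ⟨hs.1.1, fun h => h.elim hs.2 hs.1.2⟩) h₁
  have h₂' : HasSimplePoleResidue u (-Complex.I / 2 + 2 * τ) 0 := by
    obtain ⟨g, hg, he⟩ := h₂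
    refine ⟨g, hg, ?_⟩
    have hn : ∀ᶠ s in 𝓝 (-Complex.I / 2 + 2 * (τ : ℂ)), s ≠ Complex.I / 2 :=
      isOpen_ne.mem_nhds (poles_ne τ).symm
    filter_upwards [he, hn.filter_mono nhdsWithin_le_nhds] with s hs hs'
    rw [huf s hs', ← hs, zero_div, sub_zero]
  obtain ⟨g, hg, hgu⟩ := exists_holomorphic_of_hasSimplePoleResidue hU hu h₂'
  refine ⟨g, ⟨δ, hδ, by simpa using hg⟩, fun s hs => ?_⟩
  rw [hgu s fun h => hs (.inr h), huf s fun h => hs (.inl h)]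
  simp

theorem eventually_notMem_poles (τ : ℝ) : ∀ᶠ s in stripInfty, s ∉ poles τ := by
  have hre : Tendsto (fun s : ℂ => |s.re|) stripInfty atTop := tendsto_comap.mono_left inf_le_left
  filter_upwards [hre.eventually_gt_atTop |2 * τ|] with s hs
  rintro (rfl | rfl)
  · simp at hs
    exact absurd hs (not_lt.2 (by positivity))
  · simp at hs

theorem Decays.congr {f g : ℂ → ℂ} (hf : Decays f) (h : ∀ s ∉ poles τ, g s = f s) : Decays g := by
  obtain ⟨ε, hε, hf⟩ := hf
  refine ⟨ε, hε, hf.congr' ?_ EventuallyEq.rfl⟩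
  filter_upwards [eventually_notMem_poles τ] with s hs
  exact (h s hs).symm

theorem exists_mem_domH {f : (ℂ → ℂ) × (ℂ → ℂ)} (hf : f ∈ pairsOff (poles τ))
    (h₁ : HasSimplePoleResidue f.1 (Complex.I / 2) 0)
    (h₂ : HasSimplePoleResidue f.2 (Complex.I / 2) 0)
    (h₁' : HasSimplePoleResidue f.1 (-Complex.I / 2 + 2 * τ) 0)
    (h₂' : HasSimplePoleResidue f.2 (-Complex.I / 2 + 2 * τ) 0) :
    ∃ g ∈ domH, ∀ s ∉ poles τ, g.1 s = f.1 s ∧ g.2 s = f.2 s := by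
  obtain ⟨g₁, k₁, e₁⟩ := exists_holomorphicOff_empty hf.1 h₁ h₁'
  obtain ⟨g₂, k₂, e₂⟩ := exists_holomorphicOff_empty hf.2.1 h₂ h₂'
  refine ⟨(g₁, g₂), ⟨k₁, k₂, hf.2.2.1.congr e₁, hf.2.2.2.congr (τ := τ) fun s hs => ?_⟩,
    fun s hs => ⟨e₁ s hs, e₂ s hs⟩⟩
  simp only [e₂ s hs]

theorem restrict_congr {f g : ℂ → ℂ} (h : ∀ s ∉ poles τ, g s = f s) : restrict g = restrict f :=
  funext fun x => h x (notMem_poles (by simp))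

theorem restrict_diffOp_congr {f g : ℂ → ℂ} (h : ∀ s ∉ poles τ, g s = f s) :
    restrict (diffOp φ τ g) = restrict (diffOp φ τ f) := funext fun x => by
  simp only [restrict, diffOp, LinearMap.coe_mk, AddHom.coe_mk]
  rw [h x (notMem_poles (by simp)), h (x + Complex.I) (notMem_poles (by simp)),
    h (x - Complex.I) (notMem_poles (by simp))]

/-- The class in `L²` and the values of `𝓛` use only the lines `Im s = 0, ±1`, none of which meets
the poles. -/
theorem graph_congr {f g : pairsOff (poles τ)}
    (h : ∀ s ∉ poles τ, g.1.1 s = f.1.1 s ∧ g.1.2 s = f.1.2 s) :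
    ((toL2 τ).prod (diffToL2 φ τ)) g = ((toL2 τ).prod (diffToL2 φ τ)) f := by
  have h₁ : ∀ s ∉ poles τ, g.1.1 s = f.1.1 s := fun s hs => (h s hs).1
  have h₂ : ∀ s ∉ poles τ, g.1.2 s = f.1.2 s := fun s hs => (h s hs).2
  refine Prod.ext (WithLp.ofLp_injective 2 (Prod.ext ?_ ?_))
    (WithLp.ofLp_injective 2 (Prod.ext ?_ ?_))
  · exact MemLp.toLp_congr (memLp_pair (φ := 0) g.2).1.1 (memLp_pair (φ := 0) f.2).1.1
      (Eventually.of_forall (congrFun (restrict_congr h₁)))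
  · exact MemLp.toLp_congr (memLp_pair (φ := 0) g.2).1.2 (memLp_pair (φ := 0) f.2).1.2
      (Eventually.of_forall (congrFun (restrict_congr h₂)))
  · exact MemLp.toLp_congr (memLp_pair (φ := φ) g.2).2.1 (memLp_pair (φ := φ) f.2).2.1
      (Eventually.of_forall (congrFun (restrict_diffOp_congr h₁)))
  · exact MemLp.toLp_congr (memLp_pair (φ := φ) g.2).2.2 (memLp_pair (φ := φ) f.2).2.2
      (Eventually.of_forall (congrFun (restrict_diffOp_congr h₂)))

/-- The element of the graph given by `edgePair 1 τ 1 Complex.I`. -/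
noncomputable def edgeVec₁ (φ τ : ℝ) : L2Sum × L2Sum :=
  ((toL2 τ).prod (diffToL2 φ τ)) ⟨edgePair 1 τ 1 Complex.I, edgePair_mem (.inl rfl)⟩

/-- The element of the graph given by `edgePair (-1) τ (phase σ) 1`. -/
noncomputable def edgeVec₂ (φ τ σ : ℝ) : L2Sum × L2Sum :=
  ((toL2 τ).prod (diffToL2 φ τ)) ⟨edgePair (-1) τ (phase σ) 1, edgePair_mem (.inr rfl)⟩

theorem two_pi_ne_zero : (2 * Real.pi : ℂ) ≠ 0 := by simp [Real.pi_ne_zero]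

/-- The residue conditions leave two free parameters, the residues of the second component at the
two poles. Combinations of the two one-pole pairs realise all of them, and what remains has
removable singularities only. -/
theorem exists_sub_mem_graph (σ : ℝ) {p : L2Sum × L2Sum}
    (hp : p ∈ (diffSum φ τ (domHσ τ σ)).graph) :
    ∃ a b : ℂ, p - (a • edgeVec₁ φ τ + b • edgeVec₂ φ τ σ) ∈ (diffSum φ τ domH).graph := by
  rw [graph_diffSum] at hp ⊢
  obtain ⟨f, ⟨-, ⟨r, _, k₁, k₂, rfl⟩, ⟨q₁, q₂, k₁', k₂', hq⟩⟩, rfl⟩ := hp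
  obtain ⟨l₁, l₂, l₁', l₂'⟩ := edgePair_one_residues τ Complex.I
  obtain ⟨m₁, m₂, m₁', m₂'⟩ := edgePair_neg_one_residues τ (phase σ) 1
  have hpi := two_pi_ne_zero
  have hX := Complex.exp_ne_zero (-Real.pi * (-Complex.I / 2 + 2 * τ))
  set X := Complex.exp (-Real.pi * (-Complex.I / 2 + 2 * τ)) with hX'
  -- `a` and `b` cancel the residues of the second component of `f` at the two poles. Those of the
  -- first component then vanish by the conditions defining `𝓗_σ`.
  set a : ℂ := -r / (-Complex.I / (2 * Real.pi)) with ha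
  set b : ℂ := -q₂ / (X * (Complex.I / (2 * Real.pi))) with hb
  have ea : a * (-Complex.I / (2 * Real.pi)) = -r := by
    rw [ha]; field_simp
  have eb : b * (X * (Complex.I / (2 * Real.pi))) = -q₂ := by
    rw [hb]; field_simp
  set h : pairsOff (poles τ) := f + (a • ⟨edgePair 1 τ 1 Complex.I, edgePair_mem (.inl rfl)⟩
    + b • ⟨edgePair (-1) τ (phase σ) 1, edgePair_mem (.inr rfl)⟩) with hh
  have w₁ : HasSimplePoleResidue h.1.1 _ _ := k₁.add ((l₁.smul a).add (m₁.smul b))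
  have w₂ : HasSimplePoleResidue h.1.2 _ _ := k₂.add ((l₂.smul a).add (m₂.smul b))
  have w₁' : HasSimplePoleResidue h.1.1 _ _ := k₁'.add ((l₁'.smul a).add (m₁'.smul b))
  have w₂' : HasSimplePoleResidue h.1.2 _ _ := k₂'.add ((l₂'.smul a).add (m₂'.smul b))
  have v₁ : r + (a * (-Complex.I / (2 * Real.pi)) + b * 0) = 0 := by rw [ea]; ring
  have v₂ : r + (a * (-Complex.I * Complex.I * (-Complex.I / (2 * Real.pi))) + b * 0) = 0 := by
    linear_combination ea - a * (-Complex.I / (2 * Real.pi)) * Complex.I_mul_I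
  have v₁' : q₁ + (a * 0 + b * (phase σ * (Complex.I / (2 * Real.pi)))) = 0 := by
    rw [hq, phase_eq τ]
    linear_combination -Complex.exp (2 * Real.pi * (τ + Complex.I * σ)) * eb
  have v₂' : q₂ + (a * 0 + b * (X * (1 * (Complex.I / (2 * Real.pi))))) = 0 := by
    linear_combination eb
  rw [v₁] at w₁
  rw [v₂] at w₂
  rw [v₁'] at w₁'
  rw [v₂'] at w₂'
  obtain ⟨g, hg, hgh⟩ := exists_mem_domH h.2 w₁ w₂ w₁' w₂'
  refine ⟨-a, -b, ⟨⟨g, domH_le τ hg⟩, hg, (graph_congr (f := h) hgh).trans ?_⟩⟩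
  rw [hh, map_add, map_add, map_smul, map_smul, edgeVec₁, edgeVec₂]
  module

/-- Elements of the closure satisfy Green's formula without boundary terms against every pair with
simple poles, including pairs outside `𝓗_σ`. Such pairs isolate the individual residues. -/
theorem eq_zero_of_mem_closure (σ : ℝ) {a b : ℂ}
    (h : a • edgeVec₁ φ τ + b • edgeVec₂ φ τ σ ∈ (diffSum φ τ domH).graph.topologicalClosure) :
    a = 0 ∧ b = 0 := by
  obtain ⟨l₁, l₂, l₁', l₂'⟩ := edgePair_one_residues τ Complex.I
  obtain ⟨m₁, m₂, m₁', m₂'⟩ := edgePair_neg_one_residues τ (phase σ) 1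
  have hpi := Real.pi_ne_zero
  have hph : phase σ ≠ 0 := norm_ne_zero_iff.1 (by simp [norm_phase])
  set f : pairsOff (poles τ) := a • ⟨edgePair 1 τ 1 Complex.I, edgePair_mem (.inl rfl)⟩
    + b • ⟨edgePair (-1) τ (phase σ) 1, edgePair_mem (.inr rfl)⟩ with hf
  have e : a • edgeVec₁ φ τ + b • edgeVec₂ φ τ σ = ((toL2 τ).prod (diffToL2 φ τ)) f := by
    rw [hf, map_add, map_smul, map_smul, edgeVec₁, edgeVec₂]
  rw [e] at h
  have w₁ : HasSimplePoleResidue f.1.1 _ _ := (l₁.smul a).add (m₁.smul b)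
  have w₂ : HasSimplePoleResidue f.1.2 _ _ := (l₂.smul a).add (m₂.smul b)
  have w₁' : HasSimplePoleResidue f.1.1 _ _ := (l₁'.smul a).add (m₁'.smul b)
  have w₂' : HasSimplePoleResidue f.1.2 _ _ := (l₂'.smul a).add (m₂'.smul b)
  constructor
  -- With second coefficient `0`, this pair has a pole only in its first component and only at
  -- `i/2`, so the boundary form reduces to a nonzero multiple of `conj a`.
  · obtain ⟨q₁, q₂, q₁', q₂'⟩ := edgePair_one_residues τ 0
    have h1 := inner_diffToL2_sub (φ := φ) f ⟨_, edgePair_mem (.inl rfl)⟩ w₁ w₂ w₁' w₂' q₁ q₂ q₁' q₂'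
    have h2 := inner_eq_of_mem_closure h ⟨_, edgePair_mem (.inl rfl)⟩ q₁ q₂ q₁' q₂'
    have h3 := h1.symm.trans (sub_eq_zero.2 h2)
    simpa [hpi] using h3
  -- Likewise at `-i/2 + 2τ`; here the multiple of `conj b` contains the nonzero factor `conj (phase
  -- σ)`.
  · obtain ⟨q₁, q₂, q₁', q₂'⟩ := edgePair_neg_one_residues τ 1 0
    have h1 := inner_diffToL2_sub (φ := φ) f ⟨_, edgePair_mem (.inr rfl)⟩ w₁ w₂ w₁' w₂' q₁ q₂ q₁' q₂'
    have h2 := inner_eq_of_mem_closure h ⟨_, edgePair_mem (.inr rfl)⟩ q₁ q₂ q₁' q₂'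
    have h3 := h1.symm.trans (sub_eq_zero.2 h2)
    simpa [hpi, hph] using h3

theorem rank_defectSpace_domH (hφ₀ : 0 < φ) (hφ : φ < Real.pi) {z : ℂ} {κ : ℝ} (hκ : κ ≠ 0)
    (hz : conj z = -κ * Complex.I) (hz' : conj z = -z) (hz'' : ‖z‖ = 1) :
    Module.rank ℂ (defectSpace (diffSum φ τ domH) z) = 2 :=
  rank_defectSpace_eq_two (dense_domain_diffSum le_rfl)
    (dense_domain_diffSum (domH_le_domHσ τ 0)) (graph_domH_le 0) (graph_symmetric 0)
    (mem_graph_of_mem _ (edgePair_one_mem τ 0)) (mem_graph_of_mem _ (edgePair_neg_one_mem τ 0))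
    (fun _ hp => exists_sub_mem_graph 0 hp) (fun _ _ h => eq_zero_of_mem_closure 0 h)
    hz' hz'' (defectSpace_domHσ_eq_bot hφ₀ hφ 0 hκ hz)

end

end DiffSL

/-! ### The theorem: the extension with `σ = 0` serves for (a), every `σ` for (b) -/

theorem propositionl (φ τ : ℝ) (hφ₀ : 0 < φ) (hφ : φ < Real.pi) :
    DiffSL.HasDefectIndices (DiffSL.diffSum φ τ DiffSL.domH) 2 2 ∧
      ∀ σ : ℝ, DiffSL.IsEssentiallySelfAdjoint (DiffSL.diffSum φ τ (DiffSL.domHσ τ σ)) := by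
  have h1 : conj Complex.I = -((1 : ℝ) : ℂ) * Complex.I := by simp
  have h2 : conj (-Complex.I) = -((-1 : ℝ) : ℂ) * Complex.I := by simp
  refine ⟨⟨DiffSL.dense_domain_diffSum le_rfl, DiffSL.isFormalAdjoint_of_graph fun p hp q hq =>
    DiffSL.graph_symmetric 0 p (DiffSL.graph_domH_le 0 hp) q (DiffSL.graph_domH_le 0 hq), ?_, ?_⟩,
    fun σ => DiffSL.isEssentiallySelfAdjoint_of_defectSpace_eq_bot
      (DiffSL.dense_domain_diffSum (DiffSL.domH_le_domHσ τ σ))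
      (DiffSL.isFormalAdjoint_of_graph (DiffSL.graph_symmetric σ)) ?_ ?_⟩
  · exact_mod_cast DiffSL.rank_defectSpace_domH hφ₀ hφ one_ne_zero h1 (by simp) (by simp)
  · exact_mod_cast DiffSL.rank_defectSpace_domH hφ₀ hφ (neg_ne_zero.2 one_ne_zero) h2 (by simp)
      (by simp)
  · exact DiffSL.defectSpace_domHσ_eq_bot hφ₀ hφ σ one_ne_zero h1
  · exact DiffSL.defectSpace_domHσ_eq_bot hφ₀ hφ σ (neg_ne_zero.2 one_ne_zero) h2
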